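/- **Notation.** For sequences of integers $\lambda=(\lambda_1,\dots,\lambda_l)$, $\mu=(\mu_1,\dots,\mu_{l'})$ the universal character $S_{[\lambda,\mu]}(x,y)$ is the determinant of size $l+l'$ with entries $p_{\mu_{l'-i+1}+i-j}(y)$ for $1\le i\le l'$ and $p_{\lambda_{i-l'}-i+j}(x)$ for $l'+1\le i\le l+l'$, where $\sum_k p_k(x)z^k=\exp\big(\sum_{n\ge1}x_nz^n\big)$. For variables $t_i$ ($i\in I$), $t_j$ ($j\in J$) and a base $Q$ let $s^{Q}_{[\lambda,\mu]}(t_I|t_J)=S_{[\lambda,\mu]}(x,y)$ with $$x_n=\frac{\sum_I t_i^n-Q^n\sum_J t_j^n}{n(1-Q^n)},\qquad y_n=\frac{\sum_I t_i^{-n}-Q^{-n}\sum_J t_j^{-n}}{n(1-Q^{-n})}.$$ For $\boldsymbol n=(n_1,\dots,n_N)\in\mathbb Z^N$ (indices mod $N$) let $|\boldsymbol n|=n_1+\dots+n_N$ and let $\lambda(\boldsymbol n)$ be the $N$-core partition of the Maya diagram $\bigcup_{j=1}^N\{Nl+j: l<n_j\}$, i.e. $\lambda_i=\lambda(\boldsymbol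 n)_i$ is the number of integers outside the diagram that are smaller than its $i$-th largest element. Let $\boldsymbol n(i)=\boldsymbol n+(1,\dots,1,0,\dots,0)$ with $i$ ones for $0\le i\le N$, and $\boldsymbol n(i+N)=\boldsymbol n(i)+(1,\dots,1)$ for all $i\in\mathbb Z$. **Equations.** They are considered for elements of a field $K\supset\mathbb C$ with a $\mathbb C$-automorphism $\sigma$. * $A_{2g+1}^{(1)}$ ($g\ge 1$): the unknowns are $f_i$, the parameters $a_i$ with $\sigma(a_i)=a_i$ ($i\in\mathbb Z/(2g+2)$), $\prod_i a_i=q$, the time is $t\neq0$ with $\sigma(t)=qt$; $\prod_{i\text{ even}}f_i=\prod_{i\text{ odd}}f_i=t$ and $$\sigma(f_i)=a_ia_{i+1}f_{i+1}\frac{D_{i+2}}{D_i},\qquad D_i=\sum_{k=0}^{2g+1}\ \prod_{l=0}^{k-1}a_{i+l}f_{i+l}\neq0 .$$ * $D_5^{(1)}$ (q-Painlevé VI): nonzero constants $\alpha,\beta,\gamma,\delta$ (fixed by $\sigma$), time $x\ne0$ with $\sigma(x)=qx$, unknowns $f,g$, nonvanishing denominators, and $$\sigma(f)f=\frac{(g+\alpha^{-1}\beta^{-1}\gamma\delta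 x)(g+\alpha\beta\gamma^{-1}\delta^{-1}qx)}{(xg+\alpha\beta\gamma\delta)(qxg+\alpha^{-1}\beta^{-1}\gamma^{-1}\delta^{-1})},\qquad \sigma^{-1}(g)g=\frac{(f+\alpha^{-1}\beta\gamma^{-1}\delta x)(f+\alpha\beta^{-1}\gamma\delta^{-1}x)}{(xf+\alpha\beta^{-1}\gamma^{-1}\delta)(xf+\alpha^{-1}\beta\gamma\delta^{-1})}.$$ * $E_6^{(1)}$: let $s_0,\dots,s_6$ act on $\mathbb C(a_0^{1/3},\dots,a_6^{1/3};f,g)$ by $s_i(a_j)=a_ja_i^{-C_{ij}}$ (and likewise on cube roots), with $C$ the Cartan matrix of the diagram $1-2-3-4-5$, $3-6-0$; $s_i$ fixes $f,g$ for $i\ne3$, and $$s_3(f)=f\,\frac{c_xf+a_3^{-1}c_yg+a_3c_z}{a_3^{-1}c_xf+a_3c_yg+c_z},\qquad s_3(g)=g\,\frac{a_3c_xf+c_yg+a_3^{-1}c_z}{a_3^{-1}c_xf+a_3c_yg+c_z},$$ $c_x=a_1^{1/3}a_2^{2/3}a_4^{-2/3}a_5^{-1/3}$, $c_y=a_5^{1/3}a_4^{2/3}a_6^{-2/3}a_0^{-1/3}$,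 $c_z=a_0^{1/3}a_6^{2/3}a_2^{-2/3}a_1^{-1/3}$. Let $\ell=(s_2s_4s_6s_0s_1s_5s_3s_2s_4s_6s_3)^2$, the factors being applied to functions from left to right, so that $\ell(a)=(a_0,a_1,q^{-1}a_2,q^2a_3,q^{-1}a_4,a_5,q^{-1}a_6)$ with $q=a_0a_1a_2^2a_3^3a_4^2a_5a_6^2$; put $F=\ell(f)$, $G=\ell(g)$. The equation is $\sigma(f)=F(a;f,g)$, $\sigma(g)=G(a;f,g)$, where $a_i\neq 0$, $a_0a_1a_2^2a_3^3a_4^2a_5a_6^2=q$, the parameters evolve by $\sigma(a)=\ell(a)$ (cube roots accordingly, with $q^{1/3}$ the product of the corresponding cube roots), and $F,G$ are regular at $(a;f,g)$. A solution is called *algebraic* if its components are algebraic over the field generated over $\mathbb C$ by the parameters and the time variable ($a_i,t$ for $A_{2g+1}^{(1)}$; $\alpha,\beta,\gamma,\delta,x$ for $D_5^{(1)}$; $a_i$ for $E_6^{(1)}$). **Statement.** The $q$-Painlevé equations of types $A_{2g+1}^{(1)}$ $(g\ge1)$, $D_5^{(1)}$ and $E_6^{(1)}$ admit a class of algebraic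 solutions expressed in terms of universal characters attached to pairs of $(g+1)$-, $2$- and $3$-core partitions, respectively. Precisely: (A) Let $g\ge1$, $N=g+1$, $r\in\mathbb C^\times$ not a root of unity, $q=r^{2g+2}$, and $\boldsymbol m,\boldsymbol n\in\mathbb Z^{N}$. In $K=\mathbb C(\kappa,z)$ with $\sigma(\kappa)=\kappa$, $\sigma(z)=r^2z$ put, with base $Q=r^4$, $$\tau_{2i}(w)=s_{[\lambda(\boldsymbol m(-i)),\lambda(\boldsymbol n(i))]}(w^{-1},w\,|\,r^{-6}\kappa,r^{-4}\kappa),\quad \tau_{2i+1}(w)=s_{[\lambda(\boldsymbol m(-i)),\lambda(\boldsymbol n(i+1))]}(w^{-1},w\,|\,r^{-4}\kappa,r^{-2}\kappa).$$ Then all $\tau_j(r^{\pm1}z)$ are nonzero, and $$f_j=z\,\frac{\tau_{j+2}(rz)\,\tau_j(r^{-1}z)}{\tau_{j+2}(r^{-1}z)\,\tau_j(rz)}$$ is an algebraic solution of the equation of type $A_{2g+1}^{(1)}$ with $t=z^{g+1}$ and $a_{2i}=-r\kappa^{-1}r^{-2(N(m_{-i}+n_{i+1})-|\boldsymbol m|-|\boldsymbol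 n|)}$, $a_{2i+1}=-r\kappa\, r^{2(N(m_{-i}+n_{i+2})-|\boldsymbol m|-|\boldsymbol n|)}$. (D) Let $p\in\mathbb C^\times$ not be a root of unity, $q=p^2$, $\boldsymbol m,\boldsymbol n\in\mathbb Z^2$. In $K=\mathbb C(\alpha,\beta,x)$ with $\sigma(\alpha)=\alpha$, $\sigma(\beta)=\beta$, $\sigma(x)=qx$ let $\rho_{i,j}(\alpha,\beta;x)=s^{q}_{[\lambda(\boldsymbol m(i)),\lambda(\boldsymbol n(j))]}(\alpha,\alpha^{-1}\,|\,-q^{-1}\beta x,-q^{-1}\beta^{-1}x)$ and $\Phi_i^{(-)}=\rho_{i,i}(\alpha,\beta;x)$, $\Phi_i^{(+)}=\rho_{i,i}(p\alpha,p\beta;x)$, $\Psi_i^{(-)}=\rho_{i,i+1}(\alpha,p\beta;px)$, $\Psi_i^{(+)}=\rho_{i,i+1}(p\alpha,\beta;px)$. All of these are nonzero, and $$f=\frac{\Phi_1^{(+)}\Phi_2^{(-)}}{\Phi_1^{(-)}\Phi_2^{(+)}},\qquad g=\frac{\Psi_1^{(+)}\Psi_2^{(-)}}{\Psi_1^{(-)}\Psi_2^{(+)}}$$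 is an algebraic solution of the equation of type $D_5^{(1)}$ with $\gamma=p^{2n_2-|\boldsymbol n|}$, $\delta=p^{2m_2-|\boldsymbol m|}$. (E) Let $\zeta\in\mathbb C^\times$ not be a root of unity, $q=\zeta^9$ (with $q^{1/3}=\zeta^3$, $q^{1/9}=\zeta$), $\boldsymbol m,\boldsymbol n\in\mathbb Z^3$. In $K=\mathbb C(A,B)$ with $\sigma(A)=A$, $\sigma(B)=q^{-1/3}B$ put $a=A^3$, $b=B^3$, let $R_{i,j}(a,b)=s^{q}_{[\lambda(\boldsymbol m(i)),\lambda(\boldsymbol n(j))]}(a^{-1},b^{-1},ab\,|\,\varnothing)$ and $U_i=R_{i,-i}(a,b)$, $V_i=R_{i+1,-i+1}(q^{1/3}a,q^{-2/3}b)$, $W_i=R_{i+2,-i+2}(q^{-1/3}a,q^{-1/3}b)$. All of these are nonzero, and $$f=\frac{U_1V_1W_1}{U_3V_3W_3},\qquad g=\frac{U_2V_2W_2}{U_3V_3W_3}$$ is an algebraic solution of the equation of type $E_6^{(1)}$ with, writing $M=\frac{|\boldsymbol m|+|\boldsymbol n|}3$, $a_1=aq^{M-m_1-n_3}$, $a_5=aq^{M-m_2-n_2}$,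 $a_0=aq^{M-m_3-n_1}$, $a_2=bq^{M-\frac13-m_3-n_2}$, $a_4=bq^{M-\frac13-m_1-n_1}$, $a_6=bq^{M-\frac13-m_2-n_3}$, $a_3=q\,a^{-1}b^{-2}$ (cube roots: $A$, $B$, $\zeta^3A^{-1}B^{-2}$ times the corresponding powers of $\zeta$). -/

import Mathlib

noncomputable section

/-! ### Universal characters -/

/-- The elementary polynomial `p_k(x)`, given by `∑ p_k(x) z ^ k = exp (∑_{n ≥ 1} x_n z ^ n)`,
with `p_k = 0` for `k < 0`. The value `x 0` is not used. -/
def elemP {K : Type*} [Field K] [CharZero K] (x : ℕ → K) (k : ℤ) : K :=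
  if k < 0 then 0
  else PowerSeries.coeff k.toNat
    ((PowerSeries.exp K).subst (PowerSeries.mk fun n => if n = 0 then 0 else x n))

/-- The universal character `S_{[lam, mu]}(x, y)`, by the twisted Jacobi-Trudi determinant of size
`l' + l`, where `l = lam.length` and `l' = mu.length`. With rows and columns numbered from `1`, the
rows `i ≤ l'` hold `p_{mu_{l'-i+1}+i-j}(y)`, the others `p_{lam_{i-l'}-i+j}(x)`. In the code rows,
columns and lists are numbered from `0`. -/
def universalCharacter {K : Type*} [Field K] [CharZero K] (lam mu : List ℤ) (x y : ℕ → K) : K :=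
  Matrix.det (Matrix.of fun i j : Fin (mu.length + lam.length) =>
    if (i : ℕ) < mu.length then
      elemP y (mu.getD (mu.length - 1 - i) 0 + (i : ℤ) - (j : ℤ))
    else
      elemP x (lam.getD (i - mu.length) 0 - (i : ℤ) + (j : ℤ)))

/-- `x_n = (∑_I t_i ^ n - q ^ n ∑_J t_j ^ n) / (n (1 - q ^ n))`; the variables `t_i`, `i ∈ I`, and
`t_j`, `j ∈ J`, are listed in `tI` and `tJ`. -/
def powerVar {K : Type*} [Field K] (q : K) {k l : ℕ} (tI : Fin k → K) (tJ : Fin l → K)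
    (n : ℕ) : K :=
  (∑ i, tI i ^ n - q ^ n * ∑ j, tJ j ^ n) / (n * (1 - q ^ n))

/-- The symmetric function `s_{[lam, mu]}(t) = S_{[lam, mu]}(x, y)`, where `x_n` is as above and
`y_n = (∑_I t_i ^ (-n) - q ^ (-n) ∑_J t_j ^ (-n)) / (n (1 - q ^ (-n)))`. -/
def ucSym {K : Type*} [Field K] [CharZero K] (q : K) {k l : ℕ} (tI : Fin k → K) (tJ : Fin l → K)
    (lam mu : List ℤ) : K :=
  universalCharacter lam mu (powerVar q tI tJ)
    (powerVar q⁻¹ (fun i => (tI i)⁻¹) (fun j => (tJ j)⁻¹))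

/-! ### Core partitions

An integer vector `(n_1, …, n_N)` is a function `n : ZMod N → ℤ`; so `n_i` makes sense for every
integer `i`, and `n_N` is `n 0`. -/

/-- The Maya diagram `M(n)`, the union over `1 ≤ j ≤ N` of all `N l + j` with `l < n_j`. An
integer `k` is `N l + j` with `1 ≤ j ≤ N` exactly for `l = ⌊(k - 1) / N⌋` and `j ≡ k mod N`. -/
def InMaya {N : ℕ} (n : ZMod N → ℤ) (k : ℤ) : Prop := (k - 1) / (N : ℤ) < n (k : ZMod N)

instance {N : ℕ} (n : ZMod N → ℤ) : DecidablePred (InMaya n) := fun _ => Int.decLt _ _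

/-- A bound: every integer `≤ -mayaBound n` lies in `M(n)` and no integer `> mayaBound n` does. -/
def mayaBound {N : ℕ} [NeZero N] (n : ZMod N → ℤ) : ℕ := N * (1 + ∑ j, (n j).natAbs)

/-- The `N`-core partition `λ(n)`, as the decreasing list of its positive parts. If
`m_1 > m_2 > …` are the elements of `M(n)`, the partition with
`m_i - m_{i+1} = λ_i - λ_{i+1} + 1` is `λ_i = #{k < m_i : k ∉ M(n)}`. -/
def corePartition {N : ℕ} [NeZero N] (n : ZMod N → ℤ) : List ℕ :=
  ((((List.range (2 * mayaBound n + 1)).map fun s => (mayaBound n : ℤ) - (s : ℤ)).filter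
    fun k => InMaya n k).map
      fun k => ((Finset.Ico (-(mayaBound n : ℤ)) k).filter fun k' => ¬ InMaya n k').card).filter
        fun c => 0 < c

/-- `n(i) = n + (1, …, 1, 0, …, 0)` with `i` ones for `0 ≤ i ≤ N`, continued to all integers `i`
by `n(i + N) = n(i) + (1, …, 1)`. (In the code `(j - 1).val + 1` is the representative of `j` in
`{1, …, N}`.) -/
def coreShift {N : ℕ} (n : ZMod N → ℤ) (i : ℤ) : ZMod N → ℤ :=
  fun j => n j + ((i - (((j - 1).val : ℤ) + 1)) / (N : ℤ) + 1)

/-- `|n| = n_1 + ⋯ + n_N`. -/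
def vecSum {N : ℕ} [NeZero N] (n : ZMod N → ℤ) : ℤ := ∑ j, n j

/-- `s_{[λ(m(i)), λ(n(j))]}(t)`: the universal character attached to a pair of `N`-cores. -/
def coreUC {K : Type*} [Field K] [CharZero K] {N : ℕ} [NeZero N] (q : K) {k l : ℕ}
    (tI : Fin k → K) (tJ : Fin l → K) (m n : ZMod N → ℤ) (i j : ℤ) : K :=
  ucSym q tI tJ ((corePartition (coreShift m i)).map fun c => (c : ℤ))
    ((corePartition (coreShift n j)).map fun c => (c : ℤ))

/-! ### Fields of rational functions -/

/-- The field of rational functions over `ℂ` in `k` variables. -/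
abbrev RatFun (k : ℕ) : Type := FractionRing (MvPolynomial (Fin k) ℂ)

/-- The variables of `RatFun k`. -/
def rvar {k : ℕ} (i : Fin k) : RatFun k := algebraMap (MvPolynomial (Fin k) ℂ) (RatFun k) (.X i)

/-- The constants of `RatFun k`. -/
def rconst {k : ℕ} (c : ℂ) : RatFun k := algebraMap ℂ (RatFun k) c

/-- `y` is an algebraic function of the elements of `S`: it is algebraic over the field `ℂ(S)`. -/
def AlgebraicIn {K : Type*} [Field K] [Algebra ℂ K] (S : Set K) (y : K) : Prop :=
  IsAlgebraic (IntermediateField.adjoin ℂ S) y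

/-! ### The q-Painlevé equation of type `A_{2g+1}^{(1)}` -/

/-- `1 + a_i f_i + a_i a_{i+1} f_i f_{i+1} + ⋯`, the sum of the products of the first
`k = 0, …, M - 1` of the factors `a_i f_i, a_{i+1} f_{i+1}, …`. -/
def cyclicSum {K : Type*} [Field K] (M : ℕ) (a f : ℤ → K) (i : ℤ) : K :=
  ∑ k ∈ Finset.range M, ∏ l ∈ Finset.range k, (a (i + l) * f (i + l))

/-- `f` solves the q-Painlevé equation of type `A_{2g+1}^{(1)}` in the difference field `(K, σ)`,
with time variable `t` and parameters `a_i` (indices mod `2g+2`):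
`∏ a_i = q`, `∏_{i even} f_i = ∏_{i odd} f_i = t`, `σ(t) = q t`, `σ(a_i) = a_i` and
`σ(f_i) = a_i a_{i+1} f_{i+1} D_{i+2} / D_i`, where
`D_i = 1 + a_i f_i + ⋯ + a_i ⋯ a_{i+2g} f_i ⋯ f_{i+2g}`. -/
structure IsSolutionA (g : ℕ) {K : Type*} [Field K] [Algebra ℂ K] (σ : K ≃ₐ[ℂ] K) (q : ℂ)
    (t : K) (a f : ℤ → K) : Prop where
  t_ne : t ≠ 0
  shift_t : σ t = algebraMap ℂ K q * t
  periodic_a : ∀ i, a (i + (2 * g + 2)) = a i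
  periodic_f : ∀ i, f (i + (2 * g + 2)) = f i
  shift_a : ∀ i, σ (a i) = a i
  prod_a : ∏ i ∈ Finset.range (2 * g + 2), a i = algebraMap ℂ K q
  prod_even : ∏ i ∈ Finset.range (g + 1), f (2 * i) = t
  prod_odd : ∏ i ∈ Finset.range (g + 1), f (2 * i + 1) = t
  denom_ne : ∀ i, cyclicSum (2 * g + 2) a f i ≠ 0
  shift_f : ∀ i, σ (f i) = a i * a (i + 1) * f (i + 1) *
    cyclicSum (2 * g + 2) a f (i + 2) / cyclicSum (2 * g + 2) a f i

/-- The universal characters `τ_j` (`j` mod `2g+2`) of the solution of type `A_{2g+1}^{(1)}`, in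
base `r ^ 4`:
`τ_{2i} = s_{[λ(m(-i)), λ(n(i))]}` at `I : (w⁻¹, w)`, `J : (r⁻⁶ κ, r⁻⁴ κ)`, and
`τ_{2i+1} = s_{[λ(m(-i)), λ(n(i+1))]}` at `I : (w⁻¹, w)`, `J : (r⁻⁴ κ, r⁻² κ)`. -/
def tauA {K : Type*} [Field K] [CharZero K] {g : ℕ} (m n : ZMod (g + 1) → ℤ) (r κ w : K)
    (j : ℤ) : K :=
  if Even j then
    coreUC (r ^ 4) ![w⁻¹, w] ![r⁻¹ ^ 6 * κ, r⁻¹ ^ 4 * κ] m n (-(j / 2)) (j / 2)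
  else
    coreUC (r ^ 4) ![w⁻¹, w] ![r⁻¹ ^ 4 * κ, r⁻¹ ^ 2 * κ] m n (-(j / 2)) (j / 2 + 1)

/-- The parameters of the solution of type `A_{2g+1}^{(1)}`:
`a_{2i} = -r κ⁻¹ r ^ (-2 ((g+1) (m_{-i} + n_{i+1}) - |m| - |n|))` and
`a_{2i+1} = -r κ r ^ (2 ((g+1) (m_{-i} + n_{i+2}) - |m| - |n|))`. -/
def paramA {K : Type*} [Field K] {g : ℕ} (m n : ZMod (g + 1) → ℤ) (r κ : K) (j : ℤ) : K :=
  if Even j then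
    -r * κ⁻¹ * r ^ (-2 * ((g + 1) * (m ((-(j / 2) : ℤ) : ZMod (g + 1))
      + n ((j / 2 + 1 : ℤ) : ZMod (g + 1))) - vecSum m - vecSum n))
  else
    -r * κ * r ^ (2 * ((g + 1) * (m ((-(j / 2) : ℤ) : ZMod (g + 1))
      + n ((j / 2 + 2 : ℤ) : ZMod (g + 1))) - vecSum m - vecSum n))

/-- `f_j = z τ_{j+2}(r z) τ_j(r⁻¹ z) / (τ_{j+2}(r⁻¹ z) τ_j(r z))`. -/
def solA {K : Type*} [Field K] [CharZero K] {g : ℕ} (m n : ZMod (g + 1) → ℤ) (r κ z : K)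
    (j : ℤ) : K :=
  z * (tauA m n r κ (r * z) (j + 2) * tauA m n r κ (r⁻¹ * z) j) /
    (tauA m n r κ (r⁻¹ * z) (j + 2) * tauA m n r κ (r * z) j)

/-! ### The q-Painlevé equation of type `D_5^{(1)}` -/

/-- `(f, g)` solves the q-Painlevé equation of type `D_5^{(1)}` (the q-Painlevé VI equation) in the
difference field `(K, σ)`, with time variable `x`, `σ(x) = q x`, and constant parameters
`α, β, γ, δ`. -/
structure IsSolutionD5 {K : Type*} [Field K] [Algebra ℂ K] (σ : K ≃ₐ[ℂ] K) (q : ℂ)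
    (x α β γ δ f g : K) : Prop where
  x_ne : x ≠ 0
  α_ne : α ≠ 0
  β_ne : β ≠ 0
  γ_ne : γ ≠ 0
  δ_ne : δ ≠ 0
  shift_x : σ x = algebraMap ℂ K q * x
  shift_α : σ α = α
  shift_β : σ β = β
  shift_γ : σ γ = γ
  shift_δ : σ δ = δ
  denom₁_ne : x * g + α * β * γ * δ ≠ 0
  denom₂_ne : algebraMap ℂ K q * x * g + α⁻¹ * β⁻¹ * γ⁻¹ * δ⁻¹ ≠ 0
  denom₃_ne : x * f + α * β⁻¹ * γ⁻¹ * δ ≠ 0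
  denom₄_ne : x * f + α⁻¹ * β * γ * δ⁻¹ ≠ 0
  eq_f : σ f * f =
    (g + α⁻¹ * β⁻¹ * γ * δ * x) * (g + α * β * γ⁻¹ * δ⁻¹ * algebraMap ℂ K q * x) /
      ((x * g + α * β * γ * δ) * (algebraMap ℂ K q * x * g + α⁻¹ * β⁻¹ * γ⁻¹ * δ⁻¹))
  eq_g : σ.symm g * g =
    (f + α⁻¹ * β * γ⁻¹ * δ * x) * (f + α * β⁻¹ * γ * δ⁻¹ * x) /
      ((x * f + α * β⁻¹ * γ⁻¹ * δ) * (x * f + α⁻¹ * β * γ * δ⁻¹))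

/-- `ρ_{i,j}(α, β; x) = s_{[λ(m(i)), λ(n(j))]}(t)` in base `p ^ 2`, at
`I : (α, α⁻¹)` and `J : (-p⁻² β x, -p⁻² β⁻¹ x)`. -/
def rhoD5 {K : Type*} [Field K] [CharZero K] (m n : ZMod 2 → ℤ) (p α β x : K) (i j : ℤ) : K :=
  coreUC (p ^ 2) ![α, α⁻¹] ![-(p⁻¹ ^ 2 * β * x), -(p⁻¹ ^ 2 * β⁻¹ * x)] m n i j

/-- `Φ_i^{(-)}`. -/
def phiMinus {K : Type*} [Field K] [CharZero K] (m n : ZMod 2 → ℤ) (p α β x : K) (i : ℤ) : K :=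
  rhoD5 m n p α β x i i

/-- `Φ_i^{(+)}`. -/
def phiPlus {K : Type*} [Field K] [CharZero K] (m n : ZMod 2 → ℤ) (p α β x : K) (i : ℤ) : K :=
  rhoD5 m n p (p * α) (p * β) x i i

/-- `Ψ_i^{(-)}`. -/
def psiMinus {K : Type*} [Field K] [CharZero K] (m n : ZMod 2 → ℤ) (p α β x : K) (i : ℤ) : K :=
  rhoD5 m n p α (p * β) (p * x) i (i + 1)

/-- `Ψ_i^{(+)}`. -/
def psiPlus {K : Type*} [Field K] [CharZero K] (m n : ZMod 2 → ℤ) (p α β x : K) (i : ℤ) : K :=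
  rhoD5 m n p (p * α) β (p * x) i (i + 1)

/-- `f = Φ_1^{(+)} Φ_2^{(-)} / (Φ_1^{(-)} Φ_2^{(+)})`. -/
def solD5f {K : Type*} [Field K] [CharZero K] (m n : ZMod 2 → ℤ) (p α β x : K) : K :=
  phiPlus m n p α β x 1 * phiMinus m n p α β x 2 /
    (phiMinus m n p α β x 1 * phiPlus m n p α β x 2)

/-- `g = Ψ_1^{(+)} Ψ_2^{(-)} / (Ψ_1^{(-)} Ψ_2^{(+)})`. -/
def solD5g {K : Type*} [Field K] [CharZero K] (m n : ZMod 2 → ℤ) (p α β x : K) : K :=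
  psiPlus m n p α β x 1 * psiMinus m n p α β x 2 /
    (psiMinus m n p α β x 1 * psiPlus m n p α β x 2)

/-! ### The q-Painlevé equation of type `E_6^{(1)}` -/

/-- A point with coordinates `α_i = a_i ^ (1/3)`, `0 ≤ i ≤ 6`, and `(f, g)`. -/
structure E6Point (K : Type*) where
  α : Fin 7 → K
  f : K
  g : K

/-- The Cartan matrix of type `E_6^{(1)}`; the edges of the Dynkin diagram are
`1 - 2 - 3 - 4 - 5` and `3 - 6 - 0`. -/
def cartanE6 : Matrix (Fin 7) (Fin 7) ℤ :=
  !![ 2,  0,  0,  0,  0,  0, -1;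
      0,  2, -1,  0,  0,  0,  0;
      0, -1,  2, -1,  0,  0,  0;
      0,  0, -1,  2, -1,  0, -1;
      0,  0,  0, -1,  2, -1,  0;
      0,  0,  0,  0, -1,  2,  0;
     -1,  0,  0, -1,  0,  0,  2]

/-- The birational action of the simple reflection `s_i`: the coordinates of `reflE6 i X` are the
functions `s_i(α_j) = α_j α_i ^ (-C_ij)`, `s_i(f)`, `s_i(g)` evaluated at `X`. Here
`c_x = a_1^{1/3} a_2^{2/3} a_4^{-2/3} a_5^{-1/3}`, `c_y = a_5^{1/3} a_4^{2/3} a_6^{-2/3} a_0^{-1/3}`,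
`c_z = a_0^{1/3} a_6^{2/3} a_2^{-2/3} a_1^{-1/3}`, `a_3 = α_3 ^ 3`; only `s_3` moves `f`, `g`. -/
def reflE6 {K : Type*} [Field K] (i : Fin 7) (X : E6Point K) : E6Point K :=
  let cx := X.α 1 * X.α 2 ^ 2 / (X.α 4 ^ 2 * X.α 5)
  let cy := X.α 5 * X.α 4 ^ 2 / (X.α 6 ^ 2 * X.α 0)
  let cz := X.α 0 * X.α 6 ^ 2 / (X.α 2 ^ 2 * X.α 1)
  let a3 := X.α 3 ^ 3
  { α := fun j => X.α j * X.α i ^ (-cartanE6 i j)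
    f := if i = 3 then
        X.f * ((cx * X.f + a3⁻¹ * cy * X.g + a3 * cz) / (a3⁻¹ * cx * X.f + a3 * cy * X.g + cz))
      else X.f
    g := if i = 3 then
        X.g * ((a3 * cx * X.f + cy * X.g + a3⁻¹ * cz) / (a3⁻¹ * cx * X.f + a3 * cy * X.g + cz))
      else X.g }

/-- The word `(2 4 6 0 1 5 3 2 4 6 3) ^ 2` of the translation `ℓ`. -/
def ellWord : List (Fin 7) :=
  [2, 4, 6, 0, 1, 5, 3, 2, 4, 6, 3, 2, 4, 6, 0, 1, 5, 3, 2, 4, 6, 3]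

/-- The point of `E6Point` over `ℂ(a^{1/3}; f, g)` whose coordinates are the nine variables. -/
def genericE6 : E6Point (RatFun 9) where
  α := fun j => rvar (Fin.castLE (by norm_num) j)
  f := rvar 7
  g := rvar 8

/-- The functions `ℓ(α_j)`, `ℓ(f)`, `ℓ(g)` in `ℂ(a^{1/3}; f, g)`. In the product
`ℓ = s_{i_1} ⋯ s_{i_k}` the factors act on functions from left to right; this is the order in which
`ℓ(a) = (a_0, a_1, q⁻¹ a_2, q² a_3, q⁻¹ a_4, a_5, q⁻¹ a_6)`. Acting with one more `s_i` on a
function means to substitute into it the coordinates of `reflE6 i`. -/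
def ellE6 : E6Point (RatFun 9) := ellWord.foldr reflE6 genericE6

/-- The rational function `F` takes the value `v` at `x`, where it is regular: `F = P / Q` with
polynomials `P`, `Q` such that `Q(x) ≠ 0` and `v = P(x) / Q(x)`. -/
def HasValueAt {k : ℕ} {K : Type*} [Field K] [Algebra ℂ K] (F : RatFun k) (x : Fin k → K)
    (v : K) : Prop :=
  ∃ P Q : MvPolynomial (Fin k) ℂ,
    F = algebraMap (MvPolynomial (Fin k) ℂ) (RatFun k) P /
      algebraMap (MvPolynomial (Fin k) ℂ) (RatFun k) Q ∧
    MvPolynomial.aeval x Q ≠ 0 ∧ v = MvPolynomial.aeval x P / MvPolynomial.aeval x Q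

/-- `(f, g)` solves the q-Painlevé equation of type `E_6^{(1)}` in the difference field `(K, σ)`,
with parameters `a_i = α_i ^ 3`, `a_0 a_1 a_2² a_3³ a_4² a_5 a_6² = q`, that evolve by
`σ(a) = (a_0, a_1, q⁻¹ a_2, q² a_3, q⁻¹ a_4, a_5, q⁻¹ a_6)`:
`σ(f) = F(a; f, g)` and `σ(g) = G(a; f, g)`, where `F = ℓ(f)` and `G = ℓ(g)`. The evolution is
stated for the cube roots, `q3 = α_0 α_1 α_2² α_3³ α_4² α_5 α_6²` being a cube root of `q`. -/
structure IsSolutionE6 {K : Type*} [Field K] [Algebra ℂ K] (σ : K ≃ₐ[ℂ] K) (q3 : ℂ)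
    (α : Fin 7 → K) (f g : K) : Prop where
  prod_α : α 0 * α 1 * α 2 ^ 2 * α 3 ^ 3 * α 4 ^ 2 * α 5 * α 6 ^ 2 = algebraMap ℂ K q3
  α_ne : ∀ j, α j ≠ 0
  q3_ne : q3 ≠ 0
  shift_α : ∀ j, σ (α j) =
    algebraMap ℂ K (q3 ^ ((![0, 0, -1, 2, -1, 0, -1] : Fin 7 → ℤ) j)) * α j
  eq_f : HasValueAt ellE6.f ![α 0, α 1, α 2, α 3, α 4, α 5, α 6, f, g] (σ f)
  eq_g : HasValueAt ellE6.g ![α 0, α 1, α 2, α 3, α 4, α 5, α 6, f, g] (σ g)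

/-- `R_{[λ(m(i)), λ(n(j))]}(a, b)` in base `ζ ^ 9`: the universal character at
`(t_1, t_2, t_3) = (a⁻¹, b⁻¹, a b)`, `J = ∅`. -/
def coreR {K : Type*} [Field K] [CharZero K] (m n : ZMod 3 → ℤ) (ζ a b : K) (i j : ℤ) : K :=
  coreUC (ζ ^ 9) ![a⁻¹, b⁻¹, a * b] ![] m n i j

/-- `U_i(a, b)`. -/
def solU {K : Type*} [Field K] [CharZero K] (m n : ZMod 3 → ℤ) (ζ a b : K) (i : ℤ) : K :=
  coreR m n ζ a b i (-i)

/-- `V_i(a, b)`; here `ζ ^ 3` is `q ^ (1/3)`. -/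
def solV {K : Type*} [Field K] [CharZero K] (m n : ZMod 3 → ℤ) (ζ a b : K) (i : ℤ) : K :=
  coreR m n ζ (ζ ^ 3 * a) (ζ⁻¹ ^ 6 * b) (i + 1) (-i + 1)

/-- `W_i(a, b)`. -/
def solW {K : Type*} [Field K] [CharZero K] (m n : ZMod 3 → ℤ) (ζ a b : K) (i : ℤ) : K :=
  coreR m n ζ (ζ⁻¹ ^ 3 * a) (ζ⁻¹ ^ 3 * b) (i + 2) (-i + 2)

/-- `f = U_1 V_1 W_1 / (U_3 V_3 W_3)`. -/
def solE6f {K : Type*} [Field K] [CharZero K] (m n : ZMod 3 → ℤ) (ζ a b : K) : K :=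
  solU m n ζ a b 1 * solV m n ζ a b 1 * solW m n ζ a b 1 /
    (solU m n ζ a b 3 * solV m n ζ a b 3 * solW m n ζ a b 3)

/-- `g = U_2 V_2 W_2 / (U_3 V_3 W_3)`. -/
def solE6g {K : Type*} [Field K] [CharZero K] (m n : ZMod 3 → ℤ) (ζ a b : K) : K :=
  solU m n ζ a b 2 * solV m n ζ a b 2 * solW m n ζ a b 2 /
    (solU m n ζ a b 3 * solV m n ζ a b 3 * solW m n ζ a b 3)

/-- The cube roots `α_0, …, α_6` of the parameters of the solution of type `E_6^{(1)}`, with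
`a = A ^ 3`, `b = B ^ 3`, `q = ζ ^ 9`. -/
def paramE6 {K : Type*} [Field K] (m n : ZMod 3 → ℤ) (ζ A B : K) : Fin 7 → K :=
  ![A * ζ ^ (vecSum m + vecSum n - 3 * (m 3 + n 1)),
    A * ζ ^ (vecSum m + vecSum n - 3 * (m 1 + n 3)),
    B * ζ ^ (vecSum m + vecSum n - 1 - 3 * (m 3 + n 2)),
    ζ ^ 3 * A⁻¹ * B⁻¹ ^ 2,
    B * ζ ^ (vecSum m + vecSum n - 1 - 3 * (m 1 + n 1)),
    A * ζ ^ (vecSum m + vecSum n - 3 * (m 2 + n 2)),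
    B * ζ ^ (vecSum m + vecSum n - 1 - 3 * (m 2 + n 3))]

end

/-! Everything rests on one observation: the universal character of a pair of cores is a determinant
whose rows are labelled by the points of two truncated Maya diagrams (`coreTau_eq_mayaDet`), and all
operations occurring in the equations act on such determinants by inserting rows.

Multiplying a variable t of I by the base, or dividing a variable t of J by it, multiplies the
generating series of the p_k(x) by 1 - tz and that of the p_k(y) by 1 - z/t (`elemP_shift`,
`shiftRel_varPair`). On determinants this is the effect of one extra row of powers of t
(`rowDet_geomRow_cons`, `rowShift_yRow`). Passing from n(i) to n(i+1) adds one point to the Maya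
diagram, hence also one row (`coreShift_succ`). The three-term Plücker relation `rowDet_plucker` for
four such rows therefore gives bilinear relations between universal characters with shifted
variables and shifted cores: `coreTau_bilinear`, `coreTau_bilinear_left`, `coreTau_bilinear_right`.

These relations close up for two reasons. N unit steps lead back to the same core
(`corePartition_coreShift_add`), so the indices are cyclic. Moreover, the characters are homogeneous
(`coreTau_scale`), so shifted variables can be rescaled to the normal form used in the statement.
The powers so produced are governed by the change N n_{i+1} - |n| of the size of the core
(`coreWeight_coreShift_succ`), and these are the exponents seen in the parameters.

Non-vanishing comes from a degeneration (`coreTau_ne_zero`): at a suitable point the leading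
coefficient is a product of two principally specialised Schur determinants, which are Vandermonde
determinants up to nonzero factors (`det_principal_ne_zero`).

The equations then follow algebraically. In type A the bilinear relations yield a closed product
formula for the sums D_i, by uniqueness of the periodic solution of a first order recursion
(`isSolutionA_of_bilinear`). In type D four relations give the factors of the numerators and
denominators of each half of q-Painlevé VI (`quotient_of_bilinear`). In type E the reflection s_3
replaces one of the three triples U, V, W in f and g by its shifted partner
(`reflE6_three_of_bilinear`). The translation contains s_3 four times, and the four replacements
together amount to the shift σ (`translE6_of_bilinear`). Algebraicity is immediate, since the
generators of the rational function field are algebraic over the parameters and time. -/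

noncomputable section

/-! ### Elementary polynomials -/

theorem hasSubst_mk {K : Type*} [Field K] (x : ℕ → K) :
    PowerSeries.HasSubst (PowerSeries.mk fun n => if n = 0 then 0 else x n) := by
  apply PowerSeries.HasSubst.of_constantCoeff_zero'
  simp [← PowerSeries.coeff_zero_eq_constantCoeff_apply]

section ElemP

variable {K : Type*} [Field K] [CharZero K]

theorem elemP_of_neg (x : ℕ → K) {k : ℤ} (hk : k < 0) : elemP x k = 0 := if_pos hk

/-- The exponential series defining the elementary polynomials. -/
def expSeries (x : ℕ → K) : PowerSeries K :=
  (PowerSeries.exp K).subst (PowerSeries.mk fun n => if n = 0 then 0 else x n)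

theorem elemP_natCast (x : ℕ → K) (k : ℕ) : elemP x k = PowerSeries.coeff k (expSeries x) := by
  simp [elemP, expSeries]

theorem elemP_zero (x : ℕ → K) : elemP x 0 = 1 := by
  have h := elemP_natCast x 0
  rw [Nat.cast_zero] at h
  rw [h, expSeries, PowerSeries.coeff_subst' (hasSubst_mk x), finsum_eq_single _ 0]
  · simp
  · intro n hn
    have h0 : PowerSeries.constantCoeff (PowerSeries.mk fun n => if n = 0 then 0 else x n) = 0 := by
      rw [← PowerSeries.coeff_zero_eq_constantCoeff_apply, PowerSeries.coeff_mk, if_pos rfl]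
    simp [h0, hn]

theorem derivative_expSeries (x : ℕ → K) :
    PowerSeries.derivative K (expSeries x) =
      expSeries x * PowerSeries.mk fun n => ((n : K) + 1) * x (n + 1) := by
  rw [expSeries, PowerSeries.derivative_subst (hasSubst_mk x), PowerSeries.derivative_exp]
  congr 1
  ext n
  simp [PowerSeries.coeff_derivative, mul_comm]

theorem elemP_succ (x : ℕ → K) (k : ℕ) :
    ((k : K) + 1) * elemP x ((k + 1 : ℕ) : ℤ) =
      ∑ p ∈ Finset.HasAntidiagonal.antidiagonal k, elemP x p.1 * (((p.2 : K) + 1) * x (p.2 + 1)) := by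
  have h := congrArg (PowerSeries.coeff k) (derivative_expSeries x)
  rw [PowerSeries.coeff_derivative, PowerSeries.coeff_mul] at h
  simp only [PowerSeries.coeff_mk, ← elemP_natCast] at h
  rw [← h, mul_comm]

/-- The recursion comes from H' = H · X' for H = exp X. In characteristic zero it determines every
p_k from p_0 = 1, so identities between elementary polynomials are proved by checking it rather than
by expanding exponentials. -/
theorem elemP_unique (x : ℕ → K) (h : ℕ → K) (h0 : h 0 = 1)
    (hs : ∀ k : ℕ, ((k : K) + 1) * h (k + 1) =
      ∑ p ∈ Finset.HasAntidiagonal.antidiagonal k, h p.1 * (((p.2 : K) + 1) * x (p.2 + 1))) (k : ℕ) :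
    elemP x k = h k := by
  induction k using Nat.strong_induction_on with
  | _ k ih =>
    rcases k with _ | k
    · simpa [h0] using elemP_zero x
    · have hk : ((k : K) + 1) ≠ 0 := Nat.cast_add_one_ne_zero k
      apply mul_left_cancel₀ hk
      rw [elemP_succ, hs]
      apply Finset.sum_congr rfl
      intro p hp
      rw [ih p.1 (by have := Finset.HasAntidiagonal.mem_antidiagonal.1 hp; omega)]

theorem elemP_map {L : Type*} [Field L] [CharZero L] (φ : K →+* L) (x : ℕ → K) (k : ℤ) :
    φ (elemP x k) = elemP (fun n => φ (x n)) k := by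
  rcases lt_or_ge k 0 with hk | hk
  · simp [elemP_of_neg _ hk]
  lift k to ℕ using hk
  symm
  apply elemP_unique (fun n => φ (x n)) (fun k : ℕ => φ (elemP x k))
  · simp [elemP_zero]
  · intro k
    have := congrArg φ (elemP_succ x k)
    simpa using this

/-- Weighted homogeneity, i.e. the substitution z ↦ cz in the generating series; c = 0 is allowed.
-/
theorem elemP_scale {x y : ℕ → K} {c : K} 
    (h : ∀ n, y (n + 1) = c ^ (n + 1) * x (n + 1)) (k : ℤ) :
    elemP y k = c ^ k * elemP x k := by
  rcases lt_or_ge k 0 with hk | hk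
  · simp [elemP_of_neg _ hk]
  lift k to ℕ using hk
  rw [zpow_natCast]
  apply elemP_unique y (fun k : ℕ => c ^ k * elemP x k)
  · simp [elemP_zero]
  · intro k
    rw [mul_left_comm, elemP_succ, Finset.mul_sum]
    apply Finset.sum_congr rfl
    intro p hp
    rw [h, ← Finset.HasAntidiagonal.mem_antidiagonal.1 hp]
    ring

/-- Subtracting t^n / n from x_n multiplies the generating series by exp(-∑ t^n z^n / n) = 1 - tz.
The proof compares logarithmic derivatives. -/
theorem elemP_shift {x y : ℕ → K} {t : K}
    (h : ∀ n : ℕ, ((n : K) + 1) * y (n + 1) = ((n : K) + 1) * x (n + 1) - t ^ (n + 1)) (k : ℤ) :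
    elemP y k = elemP x k - t * elemP x (k - 1) := by
  rcases lt_or_ge k 0 with hk | hk
  · simp [elemP_of_neg _ hk, elemP_of_neg x (show k - 1 < 0 by omega)]
  lift k to ℕ using hk
  set Z : PowerSeries K := (1 - PowerSeries.C t * PowerSeries.X) * expSeries x with hZ
  have hcoef : ∀ k : ℕ, PowerSeries.coeff k Z = elemP x k - t * elemP x ((k : ℤ) - 1) := by
    intro k
    rw [hZ, sub_mul, one_mul, map_sub, ← elemP_natCast, mul_assoc, PowerSeries.coeff_C_mul]
    rcases k with _ | k
    · simp [elemP_of_neg x (show (-1 : ℤ) < 0 by omega)]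
    · rw [PowerSeries.coeff_succ_X_mul, ← elemP_natCast]
      push_cast
      simp
  rw [← hcoef]
  have hder : PowerSeries.derivative K Z =
      Z * PowerSeries.mk fun n => ((n : K) + 1) * y (n + 1) := by
    -- The logarithmic derivative of 1 - tz is -t/(1 - tz), written here without division.
    have hgeom : (1 - PowerSeries.C t * PowerSeries.X) *
        (PowerSeries.mk fun n => t ^ (n + 1)) = PowerSeries.C t := by
      ext n
      rw [sub_mul, one_mul, map_sub, mul_assoc, PowerSeries.coeff_C_mul]
      rcases n with _ | n
      · simp
      · rw [PowerSeries.coeff_succ_X_mul]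
        simp
        ring
    have hsplit : (PowerSeries.mk fun n => ((n : K) + 1) * y (n + 1)) =
        (PowerSeries.mk fun n => ((n : K) + 1) * x (n + 1)) -
          PowerSeries.mk fun n => t ^ (n + 1) := by
      ext n
      rw [map_sub, PowerSeries.coeff_mk, PowerSeries.coeff_mk, PowerSeries.coeff_mk, h]
    have hd : PowerSeries.derivative K (1 - PowerSeries.C t * PowerSeries.X) =
        - PowerSeries.C t := by
      rw [map_sub, Derivation.leibniz]
      simp
    rw [hZ, Derivation.leibniz, derivative_expSeries, hd, hsplit, smul_eq_mul, smul_eq_mul]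
    linear_combination expSeries x * hgeom
  clear_value Z
  apply elemP_unique y (fun k => PowerSeries.coeff k Z)
  · rw [hcoef]
    simp [elemP_zero, elemP_of_neg x (show (-1 : ℤ) < 0 by omega)]
  · intro k
    have := congrArg (PowerSeries.coeff k) hder
    rw [PowerSeries.coeff_derivative, PowerSeries.coeff_mul] at this
    simp only [PowerSeries.coeff_mk] at this
    rw [← this, mul_comm]

/-- For these x_n, multiplication by q^n is the same as subtraction of c^n / n. Computing p_k once
by scaling and once by shifting gives (1 - q^k) p_k = c p_{k-1}. -/
theorem elemP_principal {c q : K} (hq : ∀ k : ℕ, 0 < k → q ^ k ≠ 1) (k : ℕ) :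
    elemP (fun n => c ^ n / (n * (1 - q ^ n))) k = c ^ k / ∏ s ∈ Finset.range k, (1 - q ^ (s + 1)) := by
  have hne : ∀ n : ℕ, (1 : K) - q ^ (n + 1) ≠ 0 := fun n h =>
    hq (n + 1) n.succ_pos (sub_eq_zero.1 h).symm
  induction k with
  | zero => simpa using elemP_zero _
  | succ k ih =>
    set x : ℕ → K := fun n => c ^ n / (n * (1 - q ^ n)) with hx
    have h1 := elemP_scale (x := x) (y := fun n => q ^ n * x n) (c := q) (fun n => rfl)
      ((k + 1 : ℕ) : ℤ)
    have h2 := elemP_shift (x := x) (y := fun n => q ^ n * x n) (t := c) (fun n => by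
      have : ((n : K) + 1) ≠ 0 := Nat.cast_add_one_ne_zero _
      have h3 := hne n
      simp only [hx]
      push_cast
      field_simp
      ring) ((k + 1 : ℕ) : ℤ)
    rw [h1, zpow_natCast] at h2
    push_cast at h2
    rw [add_sub_cancel_right, ih] at h2
    rw [Finset.prod_range_succ]
    have h3 := hne k
    push_cast
    field_simp
    field_simp at h2
    linear_combination -h2

end ElemP

end

noncomputable section

/-! ### Determinants of lists of rows -/

section RowDet

variable {K : Type*} [Field K]

/-- The determinant of the first `n` rows in the list, in the columns `u, u + 1, …, u + n - 1`. -/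
def rowDet (n : ℕ) (u : ℤ) (rows : List (ℤ → K)) : K :=
  Matrix.det (Matrix.of fun i j : Fin n => rows.getD i 0 (u + (j : ℕ)))

theorem rowDet_swap {n : ℕ} (u : ℤ) (P Q : List (ℤ → K)) (x y : ℤ → K) (h : P.length + 1 < n) :
    rowDet n u (P ++ x :: y :: Q) = - rowDet n u (P ++ y :: x :: Q) := by
  set a : Fin n := ⟨P.length, by omega⟩
  set b : Fin n := ⟨P.length + 1, h⟩
  have hab : a ≠ b := by simp [a, b]
  have key := Matrix.det_permute (Equiv.swap a b)
    (Matrix.of fun i j : Fin n => (P ++ y :: x :: Q).getD i 0 (u + (j : ℕ)))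
  rw [Equiv.Perm.sign_swap hab] at key
  simp only [Units.val_neg, Units.val_one, Int.cast_neg, Int.cast_one, neg_mul, one_mul] at key
  rw [rowDet, rowDet, ← key]
  congr 1
  ext i j
  simp only [Matrix.of_apply, Matrix.submatrix_apply, id]
  rcases eq_or_ne i a with rfl | hia
  · rw [Equiv.swap_apply_left]
    simp [a, b, List.getD_eq_getElem?_getD]
  rcases eq_or_ne i b with rfl | hib
  · rw [Equiv.swap_apply_right]
    simp [a, b, List.getD_eq_getElem?_getD]
  rw [Equiv.swap_apply_of_ne_of_ne hia hib]
  have h1 : (i : ℕ) ≠ P.length := fun h => hia (Fin.ext h)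
  have h2 : (i : ℕ) ≠ P.length + 1 := fun h => hib (Fin.ext h)
  rcases lt_or_gt_of_ne h1 with h3 | h3
  · rw [List.getD_append _ _ _ _ h3, List.getD_append _ _ _ _ h3]
  · rw [List.getD_append_right _ _ _ _ h3.le, List.getD_append_right _ _ _ _ h3.le]
    obtain ⟨s, hs⟩ : ∃ s, (i : ℕ) - P.length = s + 2 := ⟨i - P.length - 2, by omega⟩
    rw [hs]
    simp

/-- Uniformity is the point: a single sign, depending only on the permutation, serves all sizes,
windows, row families and surrounding rows. It can then be cancelled from a Plücker relation without
ever being computed. -/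
theorem rowDet_perm {α : Type*} {l l' : List α} (h : l.Perm l') :
    ∃ ε : K, ε * ε = 1 ∧ ∀ (n : ℕ) (u : ℤ) (φ : α → ℤ → K) (P Q : List (ℤ → K)),
      P.length + l.length ≤ n →
      rowDet n u (P ++ (l'.map φ ++ Q)) = ε * rowDet n u (P ++ (l.map φ ++ Q)) := by
  induction h with
  | nil => exact ⟨1, by simp, by simp⟩
  | cons x h ih =>
    obtain ⟨ε, h1, h2⟩ := ih
    refine ⟨ε, h1, fun n u φ P Q hn => ?_⟩
    have := h2 n u φ (P ++ [φ x]) Q (by simp at hn ⊢; omega)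
    simpa using this
  | swap x y l =>
    refine ⟨-1, by simp, fun n u φ P Q hn => ?_⟩
    have := rowDet_swap u P (l.map φ ++ Q) (φ x) (φ y) (n := n) (by simp at hn; omega)
    simpa using this
  | trans h1 h2 ih1 ih2 =>
    obtain ⟨ε, a1, a2⟩ := ih1
    obtain ⟨ε', b1, b2⟩ := ih2
    refine ⟨ε' * ε, by linear_combination ε' * ε' * a1 + b1, fun n u φ P Q hn => ?_⟩
    rw [b2 n u φ P Q (by rw [← h1.length_eq]; exact hn), a2 n u φ P Q hn, mul_assoc]

theorem rowDet_move {n : ℕ} (u : ℤ) (x : ℤ → K) (P A Q : List (ℤ → K))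
    (h : A.length + P.length < n) :
    rowDet n u (A ++ (P ++ x :: Q)) = (-1) ^ P.length * rowDet n u (A ++ x :: (P ++ Q)) := by
  induction P generalizing A with
  | nil => simp
  | cons p P ih =>
    have h1 := ih (A ++ [p]) (by simp at h ⊢; omega)
    have h2 := rowDet_swap u A (P ++ Q) p x (n := n) (by simp at h; omega)
    simp only [List.append_assoc, List.nil_append, List.cons_append, List.length_cons] at h1 ⊢
    rw [h1, h2]
    ring

theorem rowDet_smul {n : ℕ} (u : ℤ) (c : K) (x : ℤ → K) (P Q : List (ℤ → K)) (h : P.length < n) :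
    rowDet n u (P ++ (c • x) :: Q) = c * rowDet n u (P ++ x :: Q) := by
  set a : Fin n := ⟨P.length, h⟩
  have key := Matrix.det_updateRow_smul
    (Matrix.of fun i j : Fin n => (P ++ x :: Q).getD i 0 (u + (j : ℕ))) a c
    (fun j => x (u + (j : ℕ)))
  have h0 : ∀ y : ℤ → K, (Matrix.of fun i j : Fin n => (P ++ x :: Q).getD i 0
      (u + (j : ℕ))).updateRow a (fun j => y (u + (j : ℕ))) =
      Matrix.of fun i j : Fin n => (P ++ y :: Q).getD i 0 (u + (j : ℕ)) := by
    intro y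
    ext i j
    rcases eq_or_ne i a with rfl | hia
    · simp [a, List.getD_eq_getElem?_getD]
    · rw [Matrix.updateRow_ne hia]
      have h1 : (i : ℕ) ≠ P.length := fun h => hia (Fin.ext h)
      simp only [Matrix.of_apply]
      rcases lt_or_gt_of_ne h1 with h3 | h3
      · rw [List.getD_append _ _ _ _ h3, List.getD_append _ _ _ _ h3]
      · rw [List.getD_append_right _ _ _ _ h3.le, List.getD_append_right _ _ _ _ h3.le]
        obtain ⟨s, hs⟩ : ∃ s, (i : ℕ) - P.length = s + 1 := ⟨i - P.length - 1, by omega⟩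
        rw [hs]
        simp
  rw [h0] at key
  rw [rowDet, rowDet, ← key, ← h0 (c • x)]
  rfl

theorem rowDet_smul_map {α : Type*} {n : ℕ} (u : ℤ) (c : K) (φ : α → ℤ → K) (L : List α)
    (P Q : List (ℤ → K)) (h : P.length + L.length ≤ n) :
    rowDet n u (P ++ (L.map (fun k => c • φ k) ++ Q)) =
      c ^ L.length * rowDet n u (P ++ (L.map φ ++ Q)) := by
  induction L generalizing P with
  | nil => simp
  | cons k L ih =>
    have h1 := rowDet_smul u c (φ k) P (L.map (fun k => c • φ k) ++ Q) (n := n)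
      (by simp at h; omega)
    have h2 := ih (P ++ [φ k]) (by simp at h ⊢; omega)
    simp only [List.map_cons, List.cons_append, List.append_assoc, List.nil_append,
      List.length_cons] at h2 ⊢
    rw [h1, h2]
    ring

/-- The three-term Plücker relation. -/
theorem rowDet_plucker {n : ℕ} (hn : 2 ≤ n) (u : ℤ) (a b c d : ℤ → K) (C : List (ℤ → K)) :
    rowDet n u (a :: b :: C) * rowDet n u (c :: d :: C) -
      rowDet n u (a :: c :: C) * rowDet n u (b :: d :: C) +
      rowDet n u (a :: d :: C) * rowDet n u (b :: c :: C) = 0 := by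
  obtain ⟨k, rfl⟩ : ∃ k, n = k + 2 := ⟨n - 2, by omega⟩
  let M : (ℤ → K) → (ℤ → K) → Matrix (Fin (k + 2)) (Fin (k + 2)) K := fun x y =>
    Matrix.of fun i j => (x :: y :: C).getD i 0 (u + (j : ℕ))
  let w : (ℤ → K) → Fin (k + 2) → K := fun x j => x (u + (j : ℕ))
  have hM : ∀ x y, rowDet (k + 2) u (x :: y :: C) = (M x y).det := fun x y => rfl
  have upd0 : ∀ x y z, (M x y).updateRow 0 (w z) = M z y := by
    intro x y z
    ext i j
    refine Fin.cases ?_ (fun i => ?_) i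
    · simp [M, w]
    · rw [Matrix.updateRow_ne (Fin.succ_ne_zero i)]
      simp [M]
  have upd1 : ∀ x y z, (M x y).updateRow 1 (w z) = M x z := by
    intro x y z
    ext i j
    refine Fin.cases ?_ (fun i => Fin.cases ?_ (fun i => ?_) i) i
    · rw [Matrix.updateRow_ne (by simp)]
      simp [M]
    · simp [M, w]
    · rw [Matrix.updateRow_ne (by simp [Fin.ext_iff])]
      simp [M]
  -- Cramer's rule writes det(a, b, C) · c as a combination of the rows a, b, C. Inserting both
  -- sides as first row of det(·, d, C) kills the rows of C, which are then repeated, and leaves the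
  -- three products.
  have key := Matrix.mulVec_cramer (M a b).transpose (w c)
  rw [Matrix.det_transpose] at key
  have key2 : ∑ i, (Matrix.cramer (M a b).transpose (w c) i) • (M a b i) = (M a b).det • w c := by
    rw [← key]
    ext j
    simp [Matrix.mulVec, dotProduct, mul_comm]
  have key3 := congrFun (congrArg (Matrix.cramer (M a d).transpose) key2) 0
  rw [map_sum, map_smul, Finset.sum_apply, Fin.sum_univ_succ, Fin.sum_univ_succ,
    Finset.sum_eq_zero] at key3
  · simp only [Pi.smul_apply, Matrix.cramer_transpose_apply, smul_eq_mul,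
      Matrix.det_updateRow_smul] at key3
    have e0 : M a b 0 = w a := rfl
    have e1 : M a b (Fin.succ 0) = w b := rfl
    rw [e0, e1, upd0, upd0, upd0, upd0] at key3
    have e2 : (M a b).updateRow (Fin.succ 0) (w c) = M a c := upd1 a b c
    rw [e2] at key3
    have hbc : rowDet (k + 2) u (b :: c :: C) = - rowDet (k + 2) u (c :: b :: C) :=
      rowDet_swap u [] C b c (by simp)
    rw [hbc]
    simp only [hM]
    linear_combination -key3
  · intro i _
    simp only [Matrix.cramer_transpose_apply, Matrix.det_updateRow_smul]
    rw [Matrix.det_zero_of_row_eq (M := (M a d).updateRow 0 _) (i := 0) (j := i.succ.succ)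
      (Fin.succ_ne_zero _).symm, mul_zero]
    rw [Matrix.updateRow_self, Matrix.updateRow_ne (Fin.succ_ne_zero _)]
    rfl

/-- The operator `1 - t S` on rows, `S` being the shift by one column. -/
def rowShift (t : K) (v : ℤ → K) : ℤ → K := fun d => v d - t * v (d - 1)

/-- The row of the powers of `t`. -/
def geomRow (t : K) : ℤ → K := fun d => t ^ d

/-- Rows of powers are eigenvectors of the column shift. For s = t the eigenvalue is zero, which
clears the first row in the next lemma; for s ≠ t it produces the difference of the two variables in
the bilinear relations. -/
theorem rowShift_geomRow {s t : K} (hs : s ≠ 0) :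
    rowShift t (geomRow s) = (1 - t / s) • geomRow s := by
  funext d
  simp only [rowShift, geomRow, Pi.smul_apply, smul_eq_mul, zpow_sub_one₀ hs]
  field_simp

/-- Subtracting t times the preceding column from every column but the first turns the row of powers
into (t^u, 0, …, 0) and applies 1 - tS to all other rows. It remains to expand along the first row.
-/
theorem rowDet_geomRow_cons (n : ℕ) (u : ℤ) {t : K} (ht : t ≠ 0) (rows : List (ℤ → K)) :
    rowDet (n + 1) u (geomRow t :: rows) = t ^ u * rowDet n (u + 1) (rows.map (rowShift t)) := by
  set A : Matrix (Fin (n + 1)) (Fin (n + 1)) K :=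
    Matrix.of fun i j => (geomRow t :: rows).getD i 0 (u + (j : ℕ)) with hA
  set B : Matrix (Fin (n + 1)) (Fin (n + 1)) K := Matrix.of fun i j =>
    Fin.cases ((geomRow t :: rows).getD i 0 u)
      (fun j => rowShift t ((geomRow t :: rows).getD i 0) (u + ((j : ℕ) + 1))) j with hB
  have h1 : A.det = B.det := by
    apply Matrix.det_eq_of_forall_col_eq_smul_add_pred (fun _ => t)
    · intro i
      simp [hA, hB]
    · intro i j
      simp only [hA, hB, Matrix.of_apply, Fin.cases_succ, rowShift, Fin.val_succ, Fin.val_castSucc]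
      push_cast
      rw [show u + ((j : ℤ) + 1) - 1 = u + j by ring]
      ring
  rw [rowDet, ← hA, h1, Matrix.det_succ_row_zero, Finset.sum_eq_single 0]
  · have e0 : B 0 0 = t ^ u := by simp [hB, geomRow]
    rw [e0, rowDet]
    simp only [Fin.val_zero, pow_zero, one_mul]
    congr 2
    ext i j
    simp only [hB, Matrix.submatrix_apply, Matrix.of_apply, Fin.zero_succAbove, Fin.cases_succ,
      Fin.val_succ, List.getD_cons_succ]
    -- The default row 0 is fixed by the shift operator, so mapping the list commutes with lookup
    -- even past its end.
    have h0 : rowShift t (0 : ℤ → K) = 0 := by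
      funext d
      simp [rowShift]
    rw [← h0, List.getD_map, h0, add_assoc, add_comm (1 : ℤ)]
  · intro j _ hj
    obtain ⟨j, rfl⟩ := Fin.exists_succ_eq.2 hj
    have : B 0 j.succ = 0 := by
      simp [hB, rowShift_geomRow ht, div_self ht]
    rw [this]
    ring
  · simp

/-- This lemma and the next remove the row contributed by a trailing zero part: of μ, which is the
first row (1, 0, …, 0), and of λ, which is the last row (0, …, 0, 1). -/
theorem rowDet_unit_cons (n : ℕ) (u : ℤ) (x : ℤ → K) (rows : List (ℤ → K)) (h0 : x u = 1)
    (h1 : ∀ d, u < d → x d = 0) : rowDet (n + 1) u (x :: rows) = rowDet n (u + 1) rows := by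
  rw [rowDet, Matrix.det_succ_row_zero, Finset.sum_eq_single 0]
  · simp only [Matrix.of_apply, Fin.val_zero, Nat.cast_zero, add_zero, List.getD_cons_zero, h0,
      pow_zero, one_mul]
    rw [rowDet]
    congr 1
    ext i j
    simp [add_assoc, add_comm (1 : ℤ)]
  · intro j _ hj
    have : (0 : ℕ) < j := Nat.pos_of_ne_zero fun h => hj (Fin.ext h)
    simp [h1 (u + (j : ℕ)) (by omega)]
  · simp

theorem rowDet_append_unit (n : ℕ) (u : ℤ) (x : ℤ → K) (rows : List (ℤ → K))
    (hr : rows.length = n) (h0 : x (u + n) = 1) (h1 : ∀ d, d < u + n → x d = 0) :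
    rowDet (n + 1) u (rows ++ [x]) = rowDet n u rows := by
  rw [rowDet, Matrix.det_succ_row _ (Fin.last n), Finset.sum_eq_single (Fin.last n)]
  · rw [rowDet]
    have e : (rows ++ [x]).getD n 0 = x := by
      rw [List.getD_append_right _ _ _ _ hr.le]
      simp [hr]
    simp only [Matrix.of_apply, Fin.val_last, e, h0, Even.neg_pow (Even.add_self n), one_pow,
      one_mul]
    congr 1
    ext i j
    simp only [Matrix.submatrix_apply, Matrix.of_apply, Fin.succAbove_last, Fin.val_castSucc]
    rw [List.getD_append _ _ _ _ (by rw [hr]; exact i.2)]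
  · intro j _ hj
    have e : (rows ++ [x]).getD n 0 = x := by
      rw [List.getD_append_right _ _ _ _ hr.le]
      simp [hr]
    have : (j : ℕ) < n := by
      have := j.2
      have h3 : (j : ℕ) ≠ n := fun h => hj (Fin.ext h)
      omega
    simp only [Matrix.of_apply, Fin.val_last, e]
    rw [h1 _ (by omega)]
    ring
  · simp

end RowDet

end

noncomputable section

/-! ### Maya diagrams and core partitions -/

section Maya

variable {N : ℕ} [NeZero N]

/-- The elements of the Maya diagram `M(n)` in `[-W, W]`, in decreasing order. -/
def mayaList (n : ZMod N → ℤ) (W : ℕ) : List ℤ :=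
  ((List.range (2 * W + 1)).map fun s : ℕ => (W : ℤ) - (s : ℤ)).filter fun k => InMaya n k

theorem mem_mayaList {n : ZMod N → ℤ} {W : ℕ} {k : ℤ} :
    k ∈ mayaList n W ↔ (-(W : ℤ) ≤ k ∧ k ≤ W) ∧ InMaya n k := by
  simp only [mayaList, List.mem_filter, List.mem_map, List.mem_range, decide_eq_true_eq]
  apply and_congr_left
  intro _
  constructor
  · rintro ⟨s, hs, rfl⟩
    omega
  · rintro ⟨h1, h2⟩
    exact ⟨(W - k).toNat, by omega, by omega⟩

theorem pairwise_mayaList (n : ZMod N → ℤ) (W : ℕ) : (mayaList n W).Pairwise (· > ·) := by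
  apply List.Pairwise.filter
  rw [List.pairwise_map]
  exact List.pairwise_lt_range.imp fun h => by omega

theorem nodup_mayaList (n : ZMod N → ℤ) (W : ℕ) : (mayaList n W).Nodup :=
  (pairwise_mayaList n W).imp fun h => h.ne'

theorem eq_of_pairwise_gt {l l' : List ℤ} (h : l.Pairwise (· > ·)) (h' : l'.Pairwise (· > ·))
    (hm : ∀ k, k ∈ l ↔ k ∈ l') : l = l' :=
  ((List.perm_ext_iff_of_nodup (h.imp fun h => h.ne') (h'.imp fun h => h.ne')).2 hm).eq_of_pairwise
    (fun _ _ _ _ h1 h2 => absurd h1 (not_lt_of_gt h2)) h h'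

theorem natAbs_le_mayaBound (n : ZMod N → ℤ) (j : ZMod N) :
    (N : ℤ) * (1 + (n j).natAbs) ≤ mayaBound n := by
  have : (n j).natAbs ≤ ∑ j, (n j).natAbs :=
    Finset.single_le_sum (f := fun j => (n j).natAbs) (fun _ _ => Nat.zero_le _) (Finset.mem_univ j)
  have h := Int.ofNat_le.2 (Nat.mul_le_mul_left N (Nat.add_le_add_left this 1))
  rw [mayaBound]
  push_cast at h ⊢
  exact h

theorem inMaya_of_le {n : ZMod N → ℤ} {k : ℤ} (h : k ≤ -(mayaBound n : ℤ)) : InMaya n k := by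
  have hN : (0 : ℤ) < N := by exact_mod_cast NeZero.pos N
  have h1 := natAbs_le_mayaBound n k
  rw [InMaya, Int.ediv_lt_iff_lt_mul hN]
  have : -((n k).natAbs : ℤ) ≤ n k := by omega
  nlinarith

theorem not_inMaya_of_lt {n : ZMod N → ℤ} {k : ℤ} (h : (mayaBound n : ℤ) < k) : ¬ InMaya n k := by
  have hN : (0 : ℤ) < N := by exact_mod_cast NeZero.pos N
  have h1 := natAbs_le_mayaBound n k
  rw [InMaya, not_lt, Int.le_ediv_iff_mul_le hN]
  have : n k ≤ ((n k).natAbs : ℤ) := by omega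
  nlinarith

/-- Past the bound the diagram is full below and empty above, so a wider window gains only its
lowest position. -/
theorem mayaList_succ {n : ZMod N → ℤ} {W : ℕ} (h : mayaBound n ≤ W) :
    mayaList n (W + 1) = mayaList n W ++ [-((W : ℤ) + 1)] := by
  apply eq_of_pairwise_gt (pairwise_mayaList n _)
  · rw [List.pairwise_append]
    refine ⟨pairwise_mayaList n W, List.pairwise_singleton _ _, ?_⟩
    intro a ha b hb
    rw [List.mem_singleton] at hb
    have := (mem_mayaList.1 ha).1
    omega
  · intro k
    rw [List.mem_append, List.mem_singleton, mem_mayaList, mem_mayaList]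
    push_cast
    constructor
    · rintro ⟨h1, h2⟩
      have : ¬ (mayaBound n : ℤ) < k := fun h => not_inMaya_of_lt h h2
      by_cases h3 : k = -((W : ℤ) + 1)
      · exact Or.inr h3
      · exact Or.inl ⟨by omega, h2⟩
    · rintro (⟨h1, h2⟩ | rfl)
      · exact ⟨by omega, h2⟩
      · exact ⟨by omega, inMaya_of_le (by omega)⟩

/-- The representative of `j` in `{1, …, N}`. -/
def posRep (j : ZMod N) : ℤ := ((j - 1).val : ℤ) + 1

/-- The position which `M(n + e_j)` has in addition to `M(n)`. -/
def addPos (n : ZMod N → ℤ) (j : ZMod N) : ℤ := N * n j + posRep j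

theorem posRep_intCast (k : ℤ) : posRep (k : ZMod N) = (k - 1) % N + 1 := by
  rw [posRep, ← ZMod.val_intCast]
  push_cast
  rfl

theorem posRep_bounds (j : ZMod N) : 1 ≤ posRep j ∧ posRep j ≤ N := by
  have := ZMod.val_lt (j - 1)
  rw [posRep]
  omega

/-- Within the residue class of j, membership only bounds the quotient (k - 1) / N by n_j. Raising
n_j by one admits exactly the quotient n_j, that is, the single position N n_j + j with j
represented in {1, …, N}. -/
theorem inMaya_update {n : ZMod N → ℤ} {j : ZMod N} {k : ℤ} :
    InMaya (Function.update n j (n j + 1)) k ↔ InMaya n k ∨ k = addPos n j := by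
  have hdiv := Int.mul_ediv_add_emod (k - 1) N
  by_cases hj : (k : ZMod N) = j
  · subst hj
    rw [InMaya, InMaya, Function.update_self, Int.lt_add_one_iff, le_iff_lt_or_eq]
    apply or_congr_right
    rw [addPos, posRep_intCast]
    constructor
    · intro h
      rw [← h]
      omega
    · intro h
      have hN : (N : ℤ) ≠ 0 := by exact_mod_cast NeZero.ne N
      have : (N : ℤ) * ((k - 1) / N) = N * n k := by omega
      exact mul_left_cancel₀ hN this
  · rw [InMaya, InMaya, Function.update_of_ne hj]
    have : k ≠ addPos n j := by
      rintro rfl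
      apply hj
      simp [addPos, posRep]
    simp [this]

theorem not_inMaya_addPos (n : ZMod N → ℤ) (j : ZMod N) : ¬ InMaya n (addPos n j) := by
  have hN : (0 : ℤ) < N := by exact_mod_cast NeZero.pos N
  have h1 : ((addPos n j : ℤ) : ZMod N) = j := by simp [addPos, posRep]
  have h2 := posRep_bounds j
  rw [InMaya, h1, not_lt, Int.le_ediv_iff_mul_le hN, addPos]
  linarith

theorem mayaList_update_perm {n : ZMod N → ℤ} {j : ZMod N} {W : ℕ} (h : mayaBound n ≤ W)
    (h' : mayaBound (Function.update n j (n j + 1)) ≤ W) :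
    (addPos n j :: mayaList n W).Perm (mayaList (Function.update n j (n j + 1)) W) := by
  have hin : InMaya (Function.update n j (n j + 1)) (addPos n j) := inMaya_update.2 (Or.inr rfl)
  have h1 : addPos n j ≤ W := by
    by_contra hlt
    exact not_inMaya_of_lt (by omega) hin
  have h2 : -(W : ℤ) ≤ addPos n j := by
    by_contra hlt
    exact not_inMaya_addPos n j (inMaya_of_le (by omega))
  rw [List.perm_ext_iff_of_nodup]
  · intro k
    rw [List.mem_cons, mem_mayaList, mem_mayaList, inMaya_update]
    constructor
    · rintro (rfl | ⟨h3, h4⟩)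
      · exact ⟨⟨h2, h1⟩, Or.inr rfl⟩
      · exact ⟨h3, Or.inl h4⟩
    · rintro ⟨h3, h4 | h4⟩
      · exact Or.inr ⟨h3, h4⟩
      · exact Or.inl h4
  · rw [List.nodup_cons]
    exact ⟨fun h => not_inMaya_addPos n j (mem_mayaList.1 h).2, nodup_mayaList n W⟩
  · exact nodup_mayaList _ W

theorem vecSum_update (n : ZMod N → ℤ) (j : ZMod N) :
    vecSum (Function.update n j (n j + 1)) = vecSum n + 1 := by
  rw [vecSum, vecSum, Finset.sum_update_of_mem (Finset.mem_univ j),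
    ← Finset.add_sum_erase _ n (Finset.mem_univ j), Finset.sdiff_singleton_eq_erase]
  ring

theorem length_mayaList_of_length {n : ZMod N → ℤ} {W : ℕ} (hW : mayaBound n ≤ W) {c : ℤ}
    (h : ((mayaList n W).length : ℤ) = W + 1 + c) {W' : ℕ} (hW' : mayaBound n ≤ W') :
    ((mayaList n W').length : ℤ) = W' + 1 + c := by
  have key : ∀ V : ℕ, ((mayaList n (mayaBound n + V)).length : ℤ) =
      (mayaList n (mayaBound n)).length + V := by
    intro V
    induction V with
    | zero => simp
    | succ V ih =>
      rw [← add_assoc, mayaList_succ (Nat.le_add_right _ _)]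
      push_cast
      simp only [List.length_append, List.length_singleton]
      push_cast
      rw [ih]
      ring
  obtain ⟨V, rfl⟩ := Nat.exists_eq_add_of_le hW
  obtain ⟨V', rfl⟩ := Nat.exists_eq_add_of_le hW'
  rw [key] at h ⊢
  push_cast at h ⊢
  linarith

/-- The charge of the diagram is |n|. Changing one coordinate by one adds or removes one position,
so induction on ∑ |n_j| reduces to n = 0. -/
theorem length_mayaList {n : ZMod N → ℤ} {W : ℕ} (hW : mayaBound n ≤ W) :
    ((mayaList n W).length : ℤ) = W + 1 + vecSum n := by
  have step : ∀ (n : ZMod N → ℤ) (j : ZMod N) (W : ℕ), mayaBound n ≤ W →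
      mayaBound (Function.update n j (n j + 1)) ≤ W →
      ((mayaList (Function.update n j (n j + 1)) W).length : ℤ) = (mayaList n W).length + 1 := by
    intro n j W h h'
    rw [← (mayaList_update_perm h h').length_eq, List.length_cons]
    push_cast
    rfl
  induction hs : ∑ j, (n j).natAbs generalizing n W with
  | zero =>
    have h0 : n = 0 := by
      funext j
      simpa using (Finset.sum_eq_zero_iff.1 hs) j (Finset.mem_univ j)
    subst h0
    -- M(0) consists of all integers ≤ 0, so the window holds W + 1 of them.
    have e : mayaList (0 : ZMod N → ℤ) W = (List.range (W + 1)).map fun s : ℕ => -(s : ℤ) := by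
      apply eq_of_pairwise_gt (pairwise_mayaList _ _)
      · rw [List.pairwise_map]
        exact List.pairwise_lt_range.imp fun h => by omega
      · intro k
        have hN : (0 : ℤ) < N := by exact_mod_cast NeZero.pos N
        simp only [mem_mayaList, InMaya, Pi.zero_apply, Int.ediv_lt_iff_lt_mul hN, List.mem_map,
          List.mem_range]
        constructor
        · rintro ⟨h1, h2⟩
          exact ⟨(-k).toNat, by omega, by omega⟩
        · rintro ⟨s, h1, rfl⟩
          omega
    simp [e, vecSum]
  | succ s ih =>
    obtain ⟨j, hj⟩ : ∃ j, n j ≠ 0 := by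
      by_contra hcon
      push Not at hcon
      simp [hcon] at hs
    have hother : ∀ v : ℤ, ∑ i, (Function.update n j v i).natAbs =
        v.natAbs + ∑ i ∈ Finset.univ.erase j, (n i).natAbs := by
      intro v
      rw [← Finset.add_sum_erase _ _ (Finset.mem_univ j), Function.update_self]
      congr 1
      exact Finset.sum_congr rfl fun i hi => by rw [Function.update_of_ne (Finset.ne_of_mem_erase hi)]
    have hself := hother (n j)
    rw [Function.update_eq_self, hs] at hself
    -- One coordinate is moved towards zero. Since the adding step only goes upwards, a positive n_j
    -- is treated as the result of raising the smaller vector n'. The comparison takes place in a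
    -- window large enough for both vectors and is then carried back to W.
    rcases lt_or_gt_of_ne hj with hneg | hpos
    · set n' := Function.update n j (n j + 1) with hn'
      set V := max (mayaBound n) (mayaBound n') with hV
      have h1 := ih (n := n') (W := V) (le_max_right _ _) (by
        rw [hn', hother]; omega)
      have h2 := step n j V (le_max_left _ _) (le_max_right _ _)
      have h3 := vecSum_update n j
      rw [← hn'] at h2 h3
      exact length_mayaList_of_length (W := V) (le_max_left _ _) (by linarith) hW
    · set n' := Function.update n j (n j - 1) with hn'
      have hback : Function.update n' j (n' j + 1) = n := by
        rw [hn', Function.update_self, Function.update_idem]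
        simp
      set V := max (mayaBound n) (mayaBound n') with hV
      have h1 := ih (n := n') (W := V) (le_max_right _ _) (by
        rw [hn', hother]; omega)
      have h2 := step n' j V (le_max_right _ _) (by rw [hback]; exact le_max_left _ _)
      have h3 := vecSum_update n' j
      rw [hback] at h2 h3
      exact length_mayaList_of_length (W := V) (le_max_left _ _) (by linarith) hW

/-- The quotient ⌊(i - j) / N⌋ increases with i exactly when i + 1 ≡ j mod N, so one step of the
shift raises one coordinate. The position gained involves i + 1 itself and not its residue, since
the quotient of i by N accounts for the full turns. -/
theorem coreShift_succ (n : ZMod N → ℤ) (i : ℤ) :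
    coreShift n (i + 1) = Function.update (coreShift n i) ((i + 1 : ℤ) : ZMod N)
      (coreShift n i ((i + 1 : ℤ) : ZMod N) + 1) ∧
    addPos (coreShift n i) ((i + 1 : ℤ) : ZMod N) = N * n ((i + 1 : ℤ) : ZMod N) + (i + 1) := by
  have hN : (0 : ℤ) < N := by exact_mod_cast NeZero.pos N
  have hN0 : (N : ℤ) ≠ 0 := hN.ne'
  have hval : ∀ j, coreShift n i j = n j + ((i - posRep j) / N + 1) := fun j => rfl
  have hval' : ∀ j, coreShift n (i + 1) j = n j + ((i + 1 - posRep j) / N + 1) := fun j => rfl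
  set j₀ : ZMod N := ((i + 1 : ℤ) : ZMod N) with hj₀
  have hrep : posRep j₀ = i % N + 1 := by rw [hj₀, posRep_intCast, add_sub_cancel_right]
  have hdm := Int.mul_ediv_add_emod i N
  have e1 : i + 1 - posRep j₀ = N * (i / N) := by rw [hrep]; linarith
  have e2 : (i - posRep j₀) / N = i / N - 1 := by
    rw [show i - posRep j₀ = -1 + (i / N) * N by linarith [mul_comm (N : ℤ) (i / N)],
      Int.add_mul_ediv_right _ _ hN0]
    have : (-1 : ℤ) / N = -1 := by
      rw [Int.ediv_eq_iff_of_pos hN]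
      constructor <;> linarith
    rw [this]
    ring
  constructor
  · funext j
    by_cases hj : j = j₀
    · subst hj
      rw [Function.update_self, hval, hval', e1, e2, Int.mul_ediv_cancel_left _ hN0]
      ring
    · rw [Function.update_of_ne hj, hval, hval']
      have hnd : (i - posRep j) / (N : ℤ) = (i + 1 - posRep j) / N := by
        have h2 := Int.mul_ediv_add_emod (i + 1 - posRep j) N
        have h3 := Int.emod_nonneg (i + 1 - posRep j) hN0
        have h4 := Int.emod_lt_of_pos (i + 1 - posRep j) hN
        have h5 : (i + 1 - posRep j) % N ≠ 0 := by
          intro h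
          apply hj
          have h6 : (((i + 1 - posRep j : ℤ)) : ZMod N) = 0 :=
            (ZMod.intCast_zmod_eq_zero_iff_dvd _ _).2 (Int.dvd_of_emod_eq_zero h)
          have h7 : ((posRep j : ℤ) : ZMod N) = j := by simp [posRep]
          rw [Int.cast_sub, h7, sub_eq_zero] at h6
          exact h6.symm
        rw [Int.ediv_eq_iff_of_pos hN]
        constructor <;> nlinarith [show 1 ≤ (i + 1 - posRep j) % (N : ℤ) by omega]
      rw [hnd]
  · rw [addPos, hval, e2, hrep]
    linear_combination hdm

theorem coreShift_zero (n : ZMod N → ℤ) : coreShift n 0 = n := by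
  have hN : (0 : ℤ) < N := by exact_mod_cast NeZero.pos N
  funext j
  have h1 := posRep_bounds j
  have hval : coreShift n 0 j = n j + ((0 - posRep j) / N + 1) := rfl
  have : (0 - posRep j) / (N : ℤ) = -1 := by
    rw [Int.ediv_eq_iff_of_pos hN]
    constructor <;> linarith
  rw [hval, this]
  ring

theorem vecSum_coreShift (n : ZMod N → ℤ) (i : ℤ) : vecSum (coreShift n i) = vecSum n + i := by
  have step : ∀ i : ℤ, vecSum (coreShift n (i + 1)) = vecSum (coreShift n i) + 1 := fun i => by
    rw [(coreShift_succ n i).1, vecSum_update]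
  induction i using Int.induction_on with
  | zero => rw [coreShift_zero, add_zero]
  | succ i ih => rw [step, ih]; ring
  | pred i ih =>
    have := step (-(i : ℤ) - 1)
    rw [sub_add_cancel, ih] at this
    linarith

theorem coreShift_add_period (n : ZMod N → ℤ) (i : ℤ) (j : ZMod N) :
    coreShift n (i + N) j = coreShift n i j + 1 := by
  have hN : (N : ℤ) ≠ 0 := by exact_mod_cast NeZero.ne N
  have hval : ∀ i, coreShift n i j = n j + ((i - posRep j) / N + 1) := fun j => rfl
  rw [hval, hval, show i + N - posRep j = i - posRep j + 1 * N by ring,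
    Int.add_mul_ediv_right _ _ hN]
  ring

end Maya

end

noncomputable section

/-! ### Core partitions with trailing zeros -/

section Padded

variable {N : ℕ} [NeZero N]

/-- The core partition `λ(n)`, followed by zeros: the `i`-th part is `m_i - |n| + i - 1` for
the elements `m_1 > m_2 > …` of `M(n)`. -/
def padPart (n : ZMod N → ℤ) (W : ℕ) : List ℤ :=
  (mayaList n W).mapIdx fun i k => k - vecSum n + (i : ℤ)

theorem length_filter_lt {L : List ℤ} (h : L.Pairwise (· > ·)) (i : ℕ) (hi : i < L.length) :
    (L.filter (fun k => k < L[i])).length + i + 1 = L.length := by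
  induction L generalizing i with
  | nil => simp at hi
  | cons x L ih =>
    rw [List.pairwise_cons] at h
    rcases i with _ | i
    · have : (x :: L).filter (fun k => k < x) = L := by
        rw [List.filter_cons_of_neg (by simp), List.filter_eq_self]
        intro a ha
        simpa using h.1 a ha
      simp only [List.getElem_cons_zero, List.length_cons]
      rw [this]
    · simp only [List.length_cons] at hi
      have hi' : i < L.length := by omega
      have := ih h.2 i hi'
      simp only [List.getElem_cons_succ, List.length_cons]
      rw [List.filter_cons_of_neg]
      · omega
      · have := h.1 L[i] (List.getElem_mem _)
        simp only [decide_eq_true_eq, not_lt]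
        exact this.le

/-- Of the k + W integers in [-W, k), those in the diagram are the later entries of the decreasing
list; their number is known from the position i and from the charge. The remaining ones are the
gaps. -/
theorem card_gaps {n : ZMod N → ℤ} {W : ℕ} (hW : mayaBound n ≤ W) (i : ℕ)
    (hi : i < (mayaList n W).length) :
    ((((Finset.Ico (-(W : ℤ)) (mayaList n W)[i]).filter fun k' => ¬ InMaya n k').card : ℕ) : ℤ) =
      (mayaList n W)[i] - vecSum n + i := by
  set k := (mayaList n W)[i] with hk
  have hmem : k ∈ mayaList n W := List.getElem_mem _
  have hb := (mem_mayaList.1 hmem).1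
  have h1 := Finset.card_filter_add_card_filter_not (s := Finset.Ico (-(W : ℤ)) k)
    (fun k' => InMaya n k')
  have h2 : ((Finset.Ico (-(W : ℤ)) k).filter fun k' => InMaya n k').card =
      ((mayaList n W).filter (fun k' => k' < k)).length := by
    rw [← List.toFinset_card_of_nodup ((nodup_mayaList n W).filter _)]
    congr 1
    ext k'
    simp only [Finset.mem_filter, Finset.mem_Ico, List.mem_toFinset, List.mem_filter, mem_mayaList,
      decide_eq_true_eq]
    constructor
    · rintro ⟨⟨h3, h4⟩, h5⟩
      exact ⟨⟨⟨h3, by omega⟩, h5⟩, h4⟩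
    · rintro ⟨⟨⟨h3, h4⟩, h5⟩, h6⟩
      exact ⟨⟨h3, h6⟩, h5⟩
  have h3 := length_filter_lt (pairwise_mayaList n W) i hi
  have h4 := length_mayaList hW
  rw [← hk] at h3
  rw [Int.card_Ico] at h1
  omega

theorem corePartition_eq (n : ZMod N → ℤ) :
    corePartition n = ((mayaList n (mayaBound n)).map fun k =>
      ((Finset.Ico (-(mayaBound n : ℤ)) k).filter fun k' => ¬ InMaya n k').card).filter
        fun c => 0 < c := by
  -- The list of naturals enters the definition through a monadic cast to ℤ, which is the entrywise
  -- cast.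
  have : (do let a ← List.range (2 * mayaBound n + 1); pure (a : ℤ) : List ℤ) =
      (List.range (2 * mayaBound n + 1)).map fun s : ℕ => (s : ℤ) := by
    simp [List.bind_eq_flatMap, List.pure_def, List.map_eq_flatMap]
  rw [corePartition, mayaList, this, List.map_map]
  rfl

theorem eq_filter_append_replicate {L : List ℕ} (h : L.Pairwise (· ≥ ·)) :
    ∃ z, L = L.filter (fun c => 0 < c) ++ List.replicate z 0 := by
  induction L with
  | nil => exact ⟨0, rfl⟩
  | cons x L ih =>
    rw [List.pairwise_cons] at h
    obtain ⟨z, hz⟩ := ih h.2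
    rcases Nat.eq_zero_or_pos x with rfl | hx
    · have h0 : ∀ a ∈ L, a = 0 := fun a ha => Nat.le_zero.1 (h.1 a ha)
      refine ⟨L.length + 1, ?_⟩
      have : (0 :: L).filter (fun c => 0 < c) = [] := by
        rw [List.filter_eq_nil_iff]
        intro a ha
        rcases List.mem_cons.1 ha with rfl | ha
        · simp
        · simp [h0 a ha]
      rw [this, List.nil_append, List.replicate_succ, List.cons_inj_right]
      exact List.eq_replicate_of_mem h0
    · refine ⟨z, ?_⟩
      rw [List.filter_cons_of_pos (by simpa using hx), List.cons_append, ← hz]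

theorem padPart_mayaBound (n : ZMod N → ℤ) :
    ∃ z, padPart n (mayaBound n) =
      (corePartition n).map (fun c : ℕ => (c : ℤ)) ++ List.replicate z 0 := by
  set L : List ℕ := (mayaList n (mayaBound n)).map fun k =>
      ((Finset.Ico (-(mayaBound n : ℤ)) k).filter fun k' => ¬ InMaya n k').card with hL
  have h1 : padPart n (mayaBound n) = L.map (fun c : ℕ => (c : ℤ)) := by
    apply List.ext_getElem
    · simp [padPart, hL]
    · intro i h1 h2
      have hi : i < (mayaList n (mayaBound n)).length := by simpa [padPart] using h1
      simp only [padPart, hL, List.getElem_mapIdx, List.getElem_map]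
      exact (card_gaps le_rfl i hi).symm
  have h2 : L.Pairwise (· ≥ ·) := by
    rw [hL, List.pairwise_map]
    refine (pairwise_mayaList n _).imp fun h => ?_
    apply Finset.card_le_card
    apply Finset.filter_subset_filter
    exact Finset.Ico_subset_Ico_right (le_of_lt h)
  obtain ⟨z, hz⟩ := eq_filter_append_replicate h2
  refine ⟨z, ?_⟩
  rw [h1, corePartition_eq, ← hL]
  conv_lhs => rw [hz]
  simp

theorem padPart_succ {n : ZMod N → ℤ} {W : ℕ} (hW : mayaBound n ≤ W) :
    padPart n (W + 1) = padPart n W ++ [0] := by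
  rw [padPart, mayaList_succ hW, List.mapIdx_append]
  have := length_mayaList hW
  simp only [List.mapIdx_cons, List.mapIdx_nil, padPart]
  congr 2
  simp
  omega

theorem padPart_eq {n : ZMod N → ℤ} {W : ℕ} (hW : mayaBound n ≤ W) :
    ∃ z, padPart n W = (corePartition n).map (fun c : ℕ => (c : ℤ)) ++ List.replicate z 0 := by
  obtain ⟨V, rfl⟩ := Nat.exists_eq_add_of_le hW
  clear hW
  induction V with
  | zero => exact padPart_mayaBound n
  | succ V ih =>
    obtain ⟨z, hz⟩ := ih
    refine ⟨z + 1, ?_⟩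
    rw [← add_assoc, padPart_succ (Nat.le_add_right _ _), hz, List.append_assoc,
      List.replicate_succ']

theorem corePartition_pos {n : ZMod N → ℤ} {c : ℕ} (h : c ∈ corePartition n) : 0 < c := by
  rw [corePartition_eq, List.mem_filter] at h
  simpa using h.2

theorem filter_padPart {n : ZMod N → ℤ} {W : ℕ} (hW : mayaBound n ≤ W) :
    (padPart n W).filter (fun c => 0 < c) = (corePartition n).map (fun c : ℕ => (c : ℤ)) := by
  obtain ⟨z, hz⟩ := padPart_eq hW
  rw [hz, List.filter_append, List.filter_eq_self.2, List.filter_eq_nil_iff.2, List.append_nil]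
  · intro a ha
    simp [List.eq_of_mem_replicate ha]
  · intro a ha
    obtain ⟨c, hc, rfl⟩ := List.mem_map.1 ha
    simpa using corePartition_pos hc

theorem vecSum_add_one (n : ZMod N → ℤ) : vecSum (fun j => n j + 1) = vecSum n + N := by
  simp [vecSum, Finset.sum_add_distrib, ZMod.card]

/-- Raising all coordinates by one translates the diagram by N and the charge |n| by N as well, so
the differences defining the parts do not change. -/
theorem corePartition_add_one (n : ZMod N → ℤ) :
    corePartition (fun j => n j + 1) = corePartition n := by
  set n' : ZMod N → ℤ := fun j => n j + 1 with hn'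
  set W := max (mayaBound n + N) (mayaBound n') with hW
  have h1 : mayaBound n + N ≤ W := le_max_left _ _
  have h2 : mayaBound n' ≤ W := le_max_right _ _
  have hN : (N : ℤ) ≠ 0 := by exact_mod_cast NeZero.ne N
  have hin : ∀ k, InMaya n' k ↔ InMaya n (k - N) := by
    intro k
    have e1 : ((k - N : ℤ) : ZMod N) = k := by simp
    rw [InMaya, InMaya, e1, show k - N - 1 = k - 1 + (-1) * N by ring,
      Int.add_mul_ediv_right _ _ hN, hn']
    constructor <;> intro h <;> linarith
  -- The translate of the window [-W - N, W + N] reaches above W. No entries are lost there because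
  -- the diagram of n ends at or below W - N.
  have hlist : mayaList n' W = (mayaList n (W + N)).map fun k : ℤ => k + N := by
    apply eq_of_pairwise_gt (pairwise_mayaList _ _)
    · rw [List.pairwise_map]
      exact (pairwise_mayaList _ _).imp fun h => by omega
    · intro k
      simp only [mem_mayaList, List.mem_map, hin]
      push_cast
      constructor
      · rintro ⟨h3, h4⟩
        exact ⟨k - N, ⟨by omega, h4⟩, by omega⟩
      · rintro ⟨k, ⟨h3, h4⟩, rfl⟩
        have : ¬ (mayaBound n : ℤ) < k := fun h => not_inMaya_of_lt h h4
        rw [add_sub_cancel_right]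
        exact ⟨by omega, h4⟩
  have hpad : padPart n' W = padPart n (W + N) := by
    rw [padPart, padPart, hlist, vecSum_add_one]
    apply List.ext_getElem
    · simp
    · intro i _ _
      simp
  have h3 := filter_padPart h2
  rw [hpad, filter_padPart (by omega)] at h3
  exact (List.map_injective_iff.2 Nat.cast_injective h3).symm

theorem corePartition_coreShift_add (n : ZMod N → ℤ) (i : ℤ) :
    corePartition (coreShift n (i + N)) = corePartition (coreShift n i) := by
  rw [← corePartition_add_one (coreShift n i)]
  congr 1
  funext j
  exact coreShift_add_period n i j

/-- The size of the core partition `λ(n)`. -/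
def coreWeight (n : ZMod N → ℤ) : ℤ := ((corePartition n).map fun c : ℕ => (c : ℤ)).sum

theorem sum_mapIdx (L : List ℤ) (c : ℤ) :
    2 * (L.mapIdx fun i k => k - c + (i : ℤ)).sum =
      2 * L.sum - 2 * c * L.length + L.length * (L.length - 1) := by
  induction L using List.reverseRecOn with
  | nil => simp
  | append_singleton L x ih =>
    rw [List.mapIdx_append, List.sum_append, mul_add, ih]
    simp
    ring

theorem coreWeight_eq {n : ZMod N → ℤ} {W : ℕ} (hW : mayaBound n ≤ W) :
    2 * coreWeight n = 2 * (mayaList n W).sum - 2 * vecSum n * (mayaList n W).length +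
      (mayaList n W).length * ((mayaList n W).length - 1) := by
  obtain ⟨z, hz⟩ := padPart_eq hW
  rw [← sum_mapIdx, ← padPart, hz, coreWeight]
  simp

/-- The size is the sum of the positions corrected by the charge and by a triangular number of the
length. The new position enters linearly and the window cancels; the factor 2 in `coreWeight_eq`
keeps the triangular number integral. -/
theorem coreWeight_update (n : ZMod N → ℤ) (j : ZMod N) :
    coreWeight (Function.update n j (n j + 1)) = coreWeight n + addPos n j - vecSum n - 1 := by
  set n' := Function.update n j (n j + 1) with hn'
  set W := max (mayaBound n) (mayaBound n') with hW
  have h1 : mayaBound n ≤ W := le_max_left _ _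
  have h2 : mayaBound n' ≤ W := le_max_right _ _
  have hp := mayaList_update_perm h1 h2
  have e1 := coreWeight_eq h1
  have e2 := coreWeight_eq h2
  rw [← hp.sum_eq, ← hp.length_eq, vecSum_update, List.sum_cons, List.length_cons] at e2
  push_cast at e2
  have e3 := length_mayaList h1
  rw [e3] at e1 e2
  have : 2 * coreWeight n' = 2 * (coreWeight n + addPos n j - vecSum n - 1) := by
    linear_combination e2 - e1
  linarith

/-- The dependence on i cancels between the added position and the charge of n(i). The remaining
increments N n_{i+1} - |n| are the exponents in the parameters of all three families. -/
theorem coreWeight_coreShift_succ (n : ZMod N → ℤ) (i : ℤ) :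
    coreWeight (coreShift n (i + 1)) =
      coreWeight (coreShift n i) + (N * n ((i + 1 : ℤ) : ZMod N) - vecSum n) := by
  rw [(coreShift_succ n i).1, coreWeight_update, (coreShift_succ n i).2, vecSum_coreShift]
  ring

end Padded

/-! ### Universal characters -/

section UniversalCharacter

variable {K : Type*} [Field K] [CharZero K]

/-- The rows of the matrix defining the universal character. -/
def ucRow (lam mu : List ℤ) (x y : ℕ → K) (i : ℕ) (d : ℤ) : K :=
  if i < mu.length then elemP y (mu.getD (mu.length - 1 - i) 0 + (i : ℤ) - d)
  else elemP x (lam.getD (i - mu.length) 0 - (i : ℤ) + d)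

theorem rowDet_congr {n : ℕ} {u u' : ℤ} {R R' : List (ℤ → K)}
    (h : ∀ i j : ℕ, i < n → j < n → R.getD i 0 (u + j) = R'.getD i 0 (u' + j)) :
    rowDet n u R = rowDet n u' R' := by
  rw [rowDet, rowDet]
  congr 1
  ext i j
  exact h i j i.2 j.2

theorem getD_map_range (n i : ℕ) (f : ℕ → ℤ → K) (h : i < n) :
    ((List.range n).map f).getD i 0 = f i := by
  simp [List.getD_eq_getElem?_getD, h]

theorem universalCharacter_eq_rowDet (lam mu : List ℤ) (x y : ℕ → K) {n : ℕ}
    (hn : mu.length + lam.length = n) :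
    universalCharacter lam mu x y = rowDet n 0 ((List.range n).map (ucRow lam mu x y)) := by
  subst hn
  rw [universalCharacter, rowDet]
  congr 1
  ext i j
  rw [Matrix.of_apply, Matrix.of_apply, getD_map_range _ _ _ i.2, ucRow, zero_add]

theorem universalCharacter_append_zero (lam mu : List ℤ) (x y : ℕ → K) :
    universalCharacter (lam ++ [0]) mu x y = universalCharacter lam mu x y := by
  rw [universalCharacter_eq_rowDet (lam ++ [0]) mu x y (n := mu.length + lam.length + 1)
    (by simp [add_assoc]), universalCharacter_eq_rowDet lam mu x y rfl, List.range_succ,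
    List.map_append, List.map_singleton, rowDet_append_unit]
  · apply rowDet_congr
    intro i j hi hj
    rw [getD_map_range _ _ _ hi, getD_map_range _ _ _ hi, ucRow, ucRow]
    split_ifs with h
    · rfl
    · rw [List.getD_append _ _ _ _ (by omega)]
  · simp
  · rw [ucRow, if_neg (by omega), List.getD_append_right _ _ _ _ (by omega)]
    simp [elemP_zero]
  · intro d hd
    rw [ucRow, if_neg (by omega), List.getD_append_right _ _ _ _ (by omega)]
    apply elemP_of_neg
    simp at hd ⊢
    omega

/-- A zero at the end of μ becomes the first row (p_{-j}(y))_j, which is (1, 0, …, 0). Deleting it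
lowers row and column numbers together, and the entries depend only on their difference. -/
theorem universalCharacter_append_zero_right (lam mu : List ℤ) (x y : ℕ → K) :
    universalCharacter lam (mu ++ [0]) x y = universalCharacter lam mu x y := by
  rw [universalCharacter_eq_rowDet lam (mu ++ [0]) x y (n := mu.length + lam.length + 1)
    (by simp [add_assoc, add_comm]), universalCharacter_eq_rowDet lam mu x y rfl,
    List.range_succ_eq_map, List.map_cons, rowDet_unit_cons]
  · apply rowDet_congr
    intro i j hi hj
    rw [List.map_map, getD_map_range _ _ _ hi, getD_map_range _ _ _ hi, Function.comp, ucRow, ucRow]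
    simp only [List.length_append, List.length_singleton, Nat.succ_eq_add_one, Nat.add_lt_add_iff_right]
    split_ifs with h
    · rw [List.getD_append _ _ _ _ (by omega)]
      congr 1
      rw [show mu.length + 1 - 1 - (i + 1) = mu.length - 1 - i by omega]
      push_cast
      ring
    · rw [show i + 1 - (mu.length + 1) = i - mu.length by omega]
      congr 1
      push_cast
      ring
  · rw [ucRow, if_pos (by simp), List.getD_append_right _ _ _ _ (by simp)]
    simp [elemP_zero]
  · intro d hd
    rw [ucRow, if_pos (by simp), List.getD_append_right _ _ _ _ (by simp)]
    apply elemP_of_neg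
    simp
    omega

theorem universalCharacter_append_replicate (lam mu : List ℤ) (z z' : ℕ) (x y : ℕ → K) :
    universalCharacter (lam ++ List.replicate z 0) (mu ++ List.replicate z' 0) x y =
      universalCharacter lam mu x y := by
  induction z with
  | zero =>
    rw [List.replicate_zero, List.append_nil]
    induction z' with
    | zero => simp
    | succ z' ih =>
      rw [List.replicate_succ', ← List.append_assoc, universalCharacter_append_zero_right, ih]
  | succ z ih =>
    rw [List.replicate_succ', ← List.append_assoc, universalCharacter_append_zero, ih]

theorem sum_range_getD (L : List ℤ) : ∑ i ∈ Finset.range L.length, L.getD i 0 = L.sum := by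
  rw [Finset.sum_range, ← Fin.sum_univ_getElem]
  exact Finset.sum_congr rfl fun i _ => by simp

/-- With x_n of degree n and y_n of degree -n, every entry is a power of c depending on the row
times c^j depending on the column. The total exponent of rows and columns is |λ| - |μ|. -/
theorem universalCharacter_scale {x y x' y' : ℕ → K} {c : K} (hc : c ≠ 0)
    (hx : ∀ k, elemP x' k = c ^ k * elemP x k) (hy : ∀ k, elemP y' k = c ^ (-k) * elemP y k)
    (lam mu : List ℤ) :
    universalCharacter lam mu x' y' = c ^ (lam.sum - mu.sum) * universalCharacter lam mu x y := by
  rw [universalCharacter_eq_rowDet lam mu x y rfl, universalCharacter_eq_rowDet lam mu x' y' rfl]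
  set n := mu.length + lam.length with hn
  set s : ℕ → ℤ := fun i => if i < mu.length then -(mu.getD (mu.length - 1 - i) 0) - (i : ℤ)
    else lam.getD (i - mu.length) 0 - (i : ℤ) with hs
  have hsum : ∑ i ∈ Finset.range n, (s i + i) = lam.sum - mu.sum := by
    rw [hn, Finset.sum_range_add, sub_eq_neg_add]
    congr 1
    · rw [← sum_range_getD mu, ← Finset.sum_range_reflect, ← Finset.sum_neg_distrib]
      refine Finset.sum_congr rfl fun i hi => ?_
      have hi' := Finset.mem_range.1 hi
      simp only [hs]
      rw [if_pos (by omega), show mu.length - 1 - (mu.length - 1 - i) = i by omega]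
      ring
    · rw [← sum_range_getD lam]
      refine Finset.sum_congr rfl fun i hi => ?_
      simp only [hs]
      rw [if_neg (by omega), Nat.add_sub_cancel_left]
      ring
  have hrow : ∀ (i : ℕ) (d : ℤ), ucRow lam mu x' y' i d = c ^ d * (c ^ s i * ucRow lam mu x y i d) := by
    intro i d
    simp only [ucRow, hs]
    split_ifs with h
    · rw [hy, ← mul_assoc, ← zpow_add₀ hc]
      congr 2
      ring
    · rw [hx, ← mul_assoc, ← zpow_add₀ hc]
      congr 2
      ring
  rw [rowDet, rowDet]
  have h1 : (Matrix.of fun i j : Fin n => ((List.range n).map (ucRow lam mu x' y')).getD i 0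
      (0 + ((j : ℕ) : ℤ))) = Matrix.of fun i j : Fin n => c ^ ((j : ℕ) : ℤ) *
      (Matrix.of fun i j : Fin n => c ^ s i * (Matrix.of fun i j : Fin n =>
        ((List.range n).map (ucRow lam mu x y)).getD i 0 (0 + ((j : ℕ) : ℤ))) i j) i j := by
    ext i j
    simp only [Matrix.of_apply]
    rw [getD_map_range _ _ _ i.2, getD_map_range _ _ _ i.2, hrow, zero_add]
  rw [h1, Matrix.det_mul_row, Matrix.det_mul_column, ← mul_assoc, ← hsum]
  congr 1
  rw [Finset.sum_range, ← Finset.prod_mul_distrib]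
  have h2 : ∀ t : Finset (Fin n), ∏ i ∈ t, c ^ ((i : ℕ) : ℤ) * c ^ s i =
      c ^ ∑ i ∈ t, (s i + ((i : ℕ) : ℤ)) := by
    intro t
    induction t using Finset.induction_on with
    | empty => simp
    | insert a t ha ih =>
      rw [Finset.prod_insert ha, Finset.sum_insert ha, ih, ← zpow_add₀ hc, ← zpow_add₀ hc]
      congr 1
      ring
  exact h2 _

theorem universalCharacter_map {L : Type*} [Field L] [CharZero L] (φ : K →+* L) (lam mu : List ℤ)
    (x y : ℕ → K) : φ (universalCharacter lam mu x y) =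
      universalCharacter lam mu (fun n => φ (x n)) (fun n => φ (y n)) := by
  rw [universalCharacter, universalCharacter, RingHom.map_det]
  congr 1
  ext i j
  simp only [RingHom.mapMatrix_apply, Matrix.map_apply, Matrix.of_apply]
  split_ifs <;> rw [elemP_map]

end UniversalCharacter

end

noncomputable section

/-! ### Bilinear relations -/

section Bilinear

variable {K : Type*} [Field K] {N : ℕ} [NeZero N]

/-- The row of an element of the first Maya diagram. -/
def xRow (X : ℤ → K) (k : ℤ) : ℤ → K := fun d => X (k - 1 + d)

/-- The row of an element of the second Maya diagram, `e` being the total charge. -/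
def yRow (Y : ℤ → K) (e k : ℤ) : ℤ → K := fun d => Y (k - e - d)

/-- The rows of a pair of Maya diagrams. -/
def mayaRows (X Y : ℤ → K) (m n : ZMod N → ℤ) (W : ℕ) (e : ℤ) : List (ℤ → K) :=
  (mayaList n W).reverse.map (yRow Y e) ++ (mayaList m W).map (xRow X)

/-- Multiplication of a generating series by `1 - t z`. -/
def seqShift (t : K) (X : ℤ → K) : ℤ → K := fun k => X k - t * X (k - 1)

/-- The size of the determinant of a pair of Maya diagrams. -/
def mayaSize (m n : ZMod N → ℤ) (W : ℕ) : ℕ := (mayaList n W).length + (mayaList m W).length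

theorem rowShift_xRow (t : K) (X : ℤ → K) (k : ℤ) :
    rowShift t (xRow X k) = xRow (seqShift t X) k := by
  funext d
  simp only [rowShift, xRow, seqShift]
  rw [show k - 1 + (d - 1) = k - 1 + d - 1 by ring]

/-- In y-rows the column runs against the index, so 1 - tS = -tS(1 - t⁻¹S⁻¹): the generating series
of Y gets the factor 1 - z/t, the scalar -t splits off, and S is absorbed by lowering e. Thus a
single row of powers acts on X and Y exactly as a base shift of the variable t does. -/
theorem rowShift_yRow {t : K} (ht : t ≠ 0) (Y : ℤ → K) (e k : ℤ) :
    rowShift t (yRow Y (e + 1) k) = (-t) • yRow (seqShift t⁻¹ Y) e k := by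
  funext d
  simp only [rowShift, yRow, seqShift, Pi.smul_apply, smul_eq_mul]
  rw [show k - (e + 1) - d = k - e - d - 1 by ring, show k - (e + 1) - (d - 1) = k - e - d by ring]
  field_simp
  ring

theorem rowDet_map_rowShift {t : K} (ht : t ≠ 0) (X Y : ℤ → K) (m n : ZMod N → ℤ) (W : ℕ) (e : ℤ)
    {s : ℕ} (u : ℤ) (P : List (ℤ → K)) (hs : P.length + mayaSize m n W ≤ s) :
    rowDet s u (P ++ (mayaRows X Y m n W (e + 1)).map (rowShift t)) =
      (-t) ^ (mayaList n W).length *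
        rowDet s u (P ++ mayaRows (seqShift t X) (seqShift t⁻¹ Y) m n W e) := by
  have h1 : (mayaRows X Y m n W (e + 1)).map (rowShift t) =
      (mayaList n W).reverse.map (fun k => (-t) • yRow (seqShift t⁻¹ Y) e k) ++
        (mayaList m W).map (xRow (seqShift t X)) := by
    rw [mayaRows, List.map_append, List.map_map, List.map_map]
    congr 1
    · exact List.map_congr_left fun k _ => rowShift_yRow ht Y e k
    · exact List.map_congr_left fun k _ => rowShift_xRow t X k
  rw [h1, rowDet_smul_map, mayaRows, List.length_reverse]
  rw [mayaSize] at hs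
  simp
  omega

theorem rowDet_geomRow_mayaRows {t : K} (ht : t ≠ 0) (X Y : ℤ → K) (m n : ZMod N → ℤ) (W : ℕ)
    (e u : ℤ) :
    rowDet (mayaSize m n W + 1) u (geomRow t :: mayaRows X Y m n W (e + 1)) =
      t ^ u * (-t) ^ (mayaList n W).length *
        rowDet (mayaSize m n W) (u + 1) (mayaRows (seqShift t X) (seqShift t⁻¹ Y) m n W e) := by
  rw [rowDet_geomRow_cons _ _ ht]
  have := rowDet_map_rowShift ht X Y m n W e (u + 1) [] (s := mayaSize m n W) (by simp)
  rw [List.nil_append, List.nil_append] at this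
  rw [this, mul_assoc]

/-- Eliminating the row of s multiplies the row of t by 1 - s/t, which is the origin of the
antisymmetric factor t - s. -/
theorem rowDet_geomRow_geomRow_mayaRows {s t : K} (hs : s ≠ 0) (ht : t ≠ 0) (X Y : ℤ → K)
    (m n : ZMod N → ℤ) (W : ℕ) (e u : ℤ) :
    rowDet (mayaSize m n W + 2) u (geomRow s :: geomRow t :: mayaRows X Y m n W (e + 2)) =
      (t - s) * (s ^ u * t ^ u * (-s) ^ (mayaList n W).length * (-t) ^ (mayaList n W).length) *
        rowDet (mayaSize m n W) (u + 2)
          (mayaRows (seqShift t (seqShift s X)) (seqShift t⁻¹ (seqShift s⁻¹ Y)) m n W e) := by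
  rw [rowDet_geomRow_cons _ _ hs, List.map_cons, rowShift_geomRow ht]
  have h1 := rowDet_smul (u + 1) (1 - s / t) (geomRow t) []
    ((mayaRows X Y m n W (e + 2)).map (rowShift s)) (n := mayaSize m n W + 1) (by simp)
  have h2 := rowDet_map_rowShift hs X Y m n W (e + 1) (u + 1) [geomRow t]
    (s := mayaSize m n W + 1) (by simp [add_comm])
  rw [List.nil_append, List.nil_append] at h1
  rw [List.singleton_append, List.singleton_append, add_assoc, one_add_one_eq_two] at h2
  rw [h1, h2, rowDet_geomRow_mayaRows ht, add_assoc, one_add_one_eq_two, zpow_add_one₀ ht]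
  field_simp

/-- `ε` is the sign by which putting the point of `M(m + e_j) \ M(m)` in front differs from putting
it into its place in the decreasing order. -/
def XSign (m : ZMod N → ℤ) (j : ZMod N) (W : ℕ) (ε : K) : Prop :=
  ∀ (X Y : ℤ → K) (n : ZMod N → ℤ) (e u : ℤ) (s : ℕ) (P : List (ℤ → K)),
      P.length + mayaSize m n W + 1 ≤ s →
      rowDet s u (P ++ xRow X (addPos m j) :: mayaRows X Y m n W e) =
        ε * (-1) ^ (mayaList n W).length *
          rowDet s u (P ++ mayaRows X Y (Function.update m j (m j + 1)) n W e)

/-- The new row passes all y-rows, which gives the power of -1, and is then sorted into the x-rows.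
The sorting sign depends on neither n nor the row data, so it is common to all terms of a Plücker
relation. -/
theorem exists_xSign {m : ZMod N → ℤ} {j : ZMod N} {W : ℕ} (h : mayaBound m ≤ W)
    (h' : mayaBound (Function.update m j (m j + 1)) ≤ W) :
    ∃ ε : K, ε ≠ 0 ∧ XSign m j W ε := by
  obtain ⟨ε, h1, h2⟩ := rowDet_perm (K := K) (mayaList_update_perm h h')
  have hε : ε ≠ 0 := by
    rintro rfl
    simp at h1
  refine ⟨ε, hε, fun X Y n e u s P hs => ?_⟩
  rw [mayaSize] at hs
  have h3 := h2 s u (xRow X) (P ++ (mayaList n W).reverse.map (yRow Y e)) [] (by simp; omega)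
  have h4 := rowDet_move u (xRow X (addPos m j)) ((mayaList n W).reverse.map (yRow Y e)) P
    ((mayaList m W).map (xRow X)) (n := s) (by simp; omega)
  simp only [List.map_cons, List.append_nil, List.append_assoc, List.length_map,
    List.length_reverse] at h3 h4
  rw [mayaRows, mayaRows, h3, h4]
  have h5 : ((-1 : K) ^ (mayaList n W).length) * (-1) ^ (mayaList n W).length = 1 := by
    rw [← mul_pow]
    simp
  linear_combination (-(ε * ε) * rowDet s u (P ++ xRow X (addPos m j) ::
    (List.map (yRow Y e) (mayaList n W).reverse ++ List.map (xRow X) (mayaList m W)))) * h5 -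
    (rowDet s u (P ++ xRow X (addPos m j) ::
    (List.map (yRow Y e) (mayaList n W).reverse ++ List.map (xRow X) (mayaList m W)))) * h1

/-- The analogue of `XSign` for the second Maya diagram. -/
def YSign (n : ZMod N → ℤ) (j : ZMod N) (W : ℕ) (ε : K) : Prop :=
  ∀ (X Y : ℤ → K) (m : ZMod N → ℤ) (e u : ℤ) (s : ℕ) (P : List (ℤ → K)),
      P.length + mayaSize m n W + 1 ≤ s →
      rowDet s u (P ++ yRow Y e (addPos n j) :: mayaRows X Y m n W e) =
        ε * rowDet s u (P ++ mayaRows X Y m (Function.update n j (n j + 1)) W e)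

theorem exists_ySign {n : ZMod N → ℤ} {j : ZMod N} {W : ℕ} (h : mayaBound n ≤ W)
    (h' : mayaBound (Function.update n j (n j + 1)) ≤ W) :
    ∃ ε : K, ε ≠ 0 ∧ YSign n j W ε := by
  have hp : (addPos n j :: (mayaList n W).reverse).Perm
      (mayaList (Function.update n j (n j + 1)) W).reverse :=
    ((List.reverse_perm _).cons _).trans
      ((mayaList_update_perm h h').trans (List.reverse_perm _).symm)
  obtain ⟨ε, h1, h2⟩ := rowDet_perm (K := K) hp
  have hε : ε ≠ 0 := by
    rintro rfl
    simp at h1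
  refine ⟨ε, hε, fun X Y m e u s P hs => ?_⟩
  rw [mayaSize] at hs
  have h3 := h2 s u (yRow Y e) P ((mayaList m W).map (xRow X)) (by simp; omega)
  rw [mayaRows, mayaRows, h3, ← mul_assoc, h1, one_mul]
  simp

/-- The determinant of a pair of Maya diagrams, truncated at `W`. -/
def mayaDet (X Y : ℤ → K) (m n : ZMod N → ℤ) (W : ℕ) : K :=
  rowDet (mayaSize m n W) (-W - (vecSum m + vecSum n)) (mayaRows X Y m n W (vecSum m + vecSum n))

theorem mayaSize_update_left {m n : ZMod N → ℤ} {j : ZMod N} {W : ℕ} (h : mayaBound m ≤ W)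
    (h' : mayaBound (Function.update m j (m j + 1)) ≤ W) :
    mayaSize (Function.update m j (m j + 1)) n W = mayaSize m n W + 1 := by
  rw [mayaSize, mayaSize, ← (mayaList_update_perm h h').length_eq, List.length_cons, add_assoc]

theorem length_mayaList_update {n : ZMod N → ℤ} {j : ZMod N} {W : ℕ} (h : mayaBound n ≤ W)
    (h' : mayaBound (Function.update n j (n j + 1)) ≤ W) :
    (mayaList (Function.update n j (n j + 1)) W).length = (mayaList n W).length + 1 := by
  rw [← (mayaList_update_perm h h').length_eq, List.length_cons]

theorem mayaSize_update_right {m n : ZMod N → ℤ} {j : ZMod N} {W : ℕ} (h : mayaBound n ≤ W)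
    (h' : mayaBound (Function.update n j (n j + 1)) ≤ W) :
    mayaSize m (Function.update n j (n j + 1)) W = mayaSize m n W + 1 := by
  rw [mayaSize, mayaSize, length_mayaList_update h h']
  ring

/-- The common rows of the Plücker relations. -/
def bracket (X Y : ℤ → K) (m n : ZMod N → ℤ) (W : ℕ) (a b : ℤ → K) : K :=
  rowDet (mayaSize m n W + 2) (-W - (vecSum m + vecSum n + 2))
    (a :: b :: mayaRows X Y m n W (vecSum m + vecSum n + 2))

theorem bracket_plucker (X Y : ℤ → K) (m n : ZMod N → ℤ) (W : ℕ) (a b c d : ℤ → K) :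
    bracket X Y m n W a b * bracket X Y m n W c d - bracket X Y m n W a c * bracket X Y m n W b d +
      bracket X Y m n W a d * bracket X Y m n W b c = 0 :=
  rowDet_plucker (Nat.le_add_left _ _) _ a b c d _

/-- The factor relating brackets with a row of powers to shifted determinants. -/
def geomFactor (m n : ZMod N → ℤ) (W : ℕ) (t : K) : K :=
  t ^ (-W - (vecSum m + vecSum n + 2) : ℤ) * (-t) ^ (mayaList n W).length

theorem geomFactor_ne_zero (m n : ZMod N → ℤ) (W : ℕ) {t : K} (ht : t ≠ 0) :
    geomFactor m n W t ≠ 0 :=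
  mul_ne_zero (zpow_ne_zero _ ht) (pow_ne_zero _ (neg_ne_zero.2 ht))

/-- In this lemma and the three that follow, the charge index |m| + |n| + 2 in the bracket makes
every choice of two extra rows end in a correctly normalised `mayaDet`: a row of powers lowers the
index by one when eliminated, an added position raises |m| + |n| by one. -/
theorem bracket_geom_geom {s t : K} (hs : s ≠ 0) (ht : t ≠ 0) (X Y : ℤ → K) (m n : ZMod N → ℤ)
    (W : ℕ) : bracket X Y m n W (geomRow s) (geomRow t) =
      (t - s) * (geomFactor m n W s * geomFactor m n W t) *
        mayaDet (seqShift t (seqShift s X)) (seqShift t⁻¹ (seqShift s⁻¹ Y)) m n W := by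
  rw [bracket, rowDet_geomRow_geomRow_mayaRows hs ht, mayaDet, geomFactor, geomFactor,
    show -(W : ℤ) - (vecSum m + vecSum n + 2) + 2 = -W - (vecSum m + vecSum n) by ring]
  ring

theorem bracket_geom_x {m : ZMod N → ℤ} {j : ZMod N} {W : ℕ} (hm : mayaBound m ≤ W)
    (hm' : mayaBound (Function.update m j (m j + 1)) ≤ W) {ε : K} (ha : XSign m j W ε) {t : K}
    (ht : t ≠ 0) (X Y : ℤ → K) (n : ZMod N → ℤ) :
    bracket X Y m n W (geomRow t) (xRow X (addPos m j)) =
      ε * (-1) ^ (mayaList n W).length * geomFactor m n W t *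
        mayaDet (seqShift t X) (seqShift t⁻¹ Y) (Function.update m j (m j + 1)) n W := by
  have q1 := ha X Y n (vecSum m + vecSum n + 2) (-W - (vecSum m + vecSum n + 2))
    (mayaSize m n W + 2) [geomRow t] (by simp; omega)
  have q2 := rowDet_geomRow_mayaRows ht X Y (Function.update m j (m j + 1)) n W
    (vecSum m + vecSum n + 1) (-W - (vecSum m + vecSum n + 2))
  have sm : mayaSize (Function.update m j (m j + 1)) n W = mayaSize m n W + 1 :=
    mayaSize_update_left hm hm'
  rw [List.singleton_append, List.singleton_append] at q1
  rw [show vecSum m + vecSum n + 1 + 1 = vecSum m + vecSum n + 2 by ring, sm] at q2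
  rw [bracket, q1, q2, mayaDet, sm, vecSum_update, geomFactor,
    show -(W : ℤ) - (vecSum m + vecSum n + 2) + 1 = -W - (vecSum m + 1 + vecSum n) by ring,
    show vecSum m + vecSum n + 1 = vecSum m + 1 + vecSum n by ring]
  ring

theorem bracket_geom_y {n : ZMod N → ℤ} {j : ZMod N} {W : ℕ} (hn : mayaBound n ≤ W)
    (hn' : mayaBound (Function.update n j (n j + 1)) ≤ W) {ε : K} (hb : YSign n j W ε) {t : K}
    (ht : t ≠ 0) (X Y : ℤ → K) (m : ZMod N → ℤ) :
    bracket X Y m n W (geomRow t) (yRow Y (vecSum m + vecSum n + 2) (addPos n j)) =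
      -t * ε * geomFactor m n W t *
        mayaDet (seqShift t X) (seqShift t⁻¹ Y) m (Function.update n j (n j + 1)) W := by
  have q1 := hb X Y m (vecSum m + vecSum n + 2) (-W - (vecSum m + vecSum n + 2))
    (mayaSize m n W + 2) [geomRow t] (by simp; omega)
  have q2 := rowDet_geomRow_mayaRows ht X Y m (Function.update n j (n j + 1)) W
    (vecSum m + vecSum n + 1) (-W - (vecSum m + vecSum n + 2))
  have sn : mayaSize m (Function.update n j (n j + 1)) W = mayaSize m n W + 1 :=
    mayaSize_update_right hn hn'
  rw [List.singleton_append, List.singleton_append] at q1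
  rw [show vecSum m + vecSum n + 1 + 1 = vecSum m + vecSum n + 2 by ring, sn,
    length_mayaList_update hn hn'] at q2
  rw [bracket, q1, q2, mayaDet, sn, vecSum_update, geomFactor,
    show -(W : ℤ) - (vecSum m + vecSum n + 2) + 1 = -W - (vecSum m + (vecSum n + 1)) by ring,
    show vecSum m + vecSum n + 1 = vecSum m + (vecSum n + 1) by ring]
  ring

theorem bracket_x_y {m n : ZMod N → ℤ} {i j : ZMod N} {W : ℕ} (hm : mayaBound m ≤ W)
    (hm' : mayaBound (Function.update m i (m i + 1)) ≤ W) (hn : mayaBound n ≤ W)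
    (hn' : mayaBound (Function.update n j (n j + 1)) ≤ W) {ε ε' : K} (ha : XSign m i W ε)
    (hb : YSign n j W ε') (X Y : ℤ → K) :
    bracket X Y m n W (xRow X (addPos m i)) (yRow Y (vecSum m + vecSum n + 2) (addPos n j)) =
      -ε * (-1) ^ (mayaList n W).length * ε' *
        mayaDet X Y (Function.update m i (m i + 1)) (Function.update n j (n j + 1)) W := by
  have sn : mayaSize m (Function.update n j (n j + 1)) W = mayaSize m n W + 1 :=
    mayaSize_update_right hn hn'
  have smn : mayaSize (Function.update m i (m i + 1)) (Function.update n j (n j + 1)) W =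
      mayaSize m n W + 2 := by
    rw [mayaSize_update_left hm hm', sn]
  have q1 := hb X Y m (vecSum m + vecSum n + 2) (-W - (vecSum m + vecSum n + 2))
    (mayaSize m n W + 2) [xRow X (addPos m i)] (by simp; omega)
  have q2 := ha X Y (Function.update n j (n j + 1)) (vecSum m + vecSum n + 2)
    (-W - (vecSum m + vecSum n + 2)) (mayaSize m n W + 2) [] (by simp [sn])
  rw [List.nil_append, List.nil_append, length_mayaList_update hn hn'] at q2
  rw [List.singleton_append, List.singleton_append, q2] at q1
  rw [bracket, q1, mayaDet, smn, vecSum_update, vecSum_update,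
    show vecSum m + vecSum n + 2 = vecSum m + 1 + (vecSum n + 1) by ring]
  ring

/-- The Plücker relation for two rows of powers and one new point in each of the two diagrams. -/
theorem mayaDet_bilinear {t₁ t₂ : K} (h₁ : t₁ ≠ 0) (h₂ : t₂ ≠ 0) (X Y : ℤ → K)
    (m n : ZMod N → ℤ) (i j : ZMod N) {W : ℕ} (hm : mayaBound m ≤ W)
    (hm' : mayaBound (Function.update m i (m i + 1)) ≤ W) (hn : mayaBound n ≤ W)
    (hn' : mayaBound (Function.update n j (n j + 1)) ≤ W) :
    (t₂ - t₁) * mayaDet (seqShift t₂ (seqShift t₁ X)) (seqShift t₂⁻¹ (seqShift t₁⁻¹ Y)) m n W *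
        mayaDet X Y (Function.update m i (m i + 1)) (Function.update n j (n j + 1)) W =
      t₂ * mayaDet (seqShift t₁ X) (seqShift t₁⁻¹ Y) (Function.update m i (m i + 1)) n W *
        mayaDet (seqShift t₂ X) (seqShift t₂⁻¹ Y) m (Function.update n j (n j + 1)) W -
      t₁ * mayaDet (seqShift t₂ X) (seqShift t₂⁻¹ Y) (Function.update m i (m i + 1)) n W *
        mayaDet (seqShift t₁ X) (seqShift t₁⁻¹ Y) m (Function.update n j (n j + 1)) W := by
  obtain ⟨εa, hεa, ha⟩ := exists_xSign (K := K) hm hm'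
  obtain ⟨εb, hεb, hb⟩ := exists_ySign (K := K) hn hn'
  have key := bracket_plucker X Y m n W (geomRow t₁) (geomRow t₂)
    (xRow X (addPos m i)) (yRow Y (vecSum m + vecSum n + 2) (addPos n j))
  rw [bracket_geom_geom h₁ h₂, bracket_x_y hm hm' hn hn' ha hb, bracket_geom_x hm hm' ha h₁,
    bracket_geom_x hm hm' ha h₂, bracket_geom_y hn hn' hb h₁, bracket_geom_y hn hn' hb h₂] at key
  -- Each of the three products carries the two sorting signs and one geometric factor for each of
  -- t₁ and t₂, so this whole factor is common to them.
  have hne : εa * εb * (-1) ^ (mayaList n W).length *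
      (geomFactor m n W t₁ * geomFactor m n W t₂) ≠ 0 :=
    mul_ne_zero (mul_ne_zero (mul_ne_zero hεa hεb) (pow_ne_zero _ (neg_ne_zero.2 one_ne_zero)))
      (mul_ne_zero (geomFactor_ne_zero m n W h₁) (geomFactor_ne_zero m n W h₂))
  apply mul_left_cancel₀ hne
  linear_combination -key

/-- The Plücker relation for three rows of powers and one new point of the first diagram. -/
theorem mayaDet_bilinear_left {t₁ t₂ t₃ : K} (h₁ : t₁ ≠ 0) (h₂ : t₂ ≠ 0) (h₃ : t₃ ≠ 0)
    (X Y : ℤ → K) (m n : ZMod N → ℤ) (i : ZMod N) {W : ℕ} (hm : mayaBound m ≤ W)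
    (hm' : mayaBound (Function.update m i (m i + 1)) ≤ W) :
    (t₂ - t₁) * mayaDet (seqShift t₂ (seqShift t₁ X)) (seqShift t₂⁻¹ (seqShift t₁⁻¹ Y)) m n W *
        mayaDet (seqShift t₃ X) (seqShift t₃⁻¹ Y) (Function.update m i (m i + 1)) n W -
      (t₃ - t₁) * mayaDet (seqShift t₃ (seqShift t₁ X)) (seqShift t₃⁻¹ (seqShift t₁⁻¹ Y)) m n W *
        mayaDet (seqShift t₂ X) (seqShift t₂⁻¹ Y) (Function.update m i (m i + 1)) n W +
      (t₃ - t₂) * mayaDet (seqShift t₃ (seqShift t₂ X)) (seqShift t₃⁻¹ (seqShift t₂⁻¹ Y)) m n W *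
        mayaDet (seqShift t₁ X) (seqShift t₁⁻¹ Y) (Function.update m i (m i + 1)) n W = 0 := by
  obtain ⟨ε, hε, ha⟩ := exists_xSign (K := K) hm hm'
  have key := bracket_plucker X Y m n W (geomRow t₁) (geomRow t₂) (geomRow t₃)
    (xRow X (addPos m i))
  rw [bracket_geom_geom h₁ h₂, bracket_geom_geom h₁ h₃, bracket_geom_geom h₂ h₃,
    bracket_geom_x hm hm' ha h₁, bracket_geom_x hm hm' ha h₂, bracket_geom_x hm hm' ha h₃] at key
  have hne : ε * (-1) ^ (mayaList n W).length *
      (geomFactor m n W t₁ * geomFactor m n W t₂ * geomFactor m n W t₃) ≠ 0 :=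
    mul_ne_zero (mul_ne_zero hε (pow_ne_zero _ (neg_ne_zero.2 one_ne_zero)))
      (mul_ne_zero (mul_ne_zero (geomFactor_ne_zero m n W h₁) (geomFactor_ne_zero m n W h₂))
        (geomFactor_ne_zero m n W h₃))
  apply mul_left_cancel₀ hne
  linear_combination key

/-- As before with the new point in the second diagram. Eliminating a row of powers past one more
y-row costs an additional factor -t, which explains the extra weights t₁, t₂, t₃. -/
theorem mayaDet_bilinear_right {t₁ t₂ t₃ : K} (h₁ : t₁ ≠ 0) (h₂ : t₂ ≠ 0) (h₃ : t₃ ≠ 0)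
    (X Y : ℤ → K) (m n : ZMod N → ℤ) (j : ZMod N) {W : ℕ} (hn : mayaBound n ≤ W)
    (hn' : mayaBound (Function.update n j (n j + 1)) ≤ W) :
    (t₂ - t₁) * t₃ *
        mayaDet (seqShift t₂ (seqShift t₁ X)) (seqShift t₂⁻¹ (seqShift t₁⁻¹ Y)) m n W *
        mayaDet (seqShift t₃ X) (seqShift t₃⁻¹ Y) m (Function.update n j (n j + 1)) W -
      (t₃ - t₁) * t₂ *
        mayaDet (seqShift t₃ (seqShift t₁ X)) (seqShift t₃⁻¹ (seqShift t₁⁻¹ Y)) m n W *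
        mayaDet (seqShift t₂ X) (seqShift t₂⁻¹ Y) m (Function.update n j (n j + 1)) W +
      (t₃ - t₂) * t₁ *
        mayaDet (seqShift t₃ (seqShift t₂ X)) (seqShift t₃⁻¹ (seqShift t₂⁻¹ Y)) m n W *
        mayaDet (seqShift t₁ X) (seqShift t₁⁻¹ Y) m (Function.update n j (n j + 1)) W = 0 := by
  obtain ⟨ε, hε, hb⟩ := exists_ySign (K := K) hn hn'
  have key := bracket_plucker X Y m n W (geomRow t₁) (geomRow t₂) (geomRow t₃)
    (yRow Y (vecSum m + vecSum n + 2) (addPos n j))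
  rw [bracket_geom_geom h₁ h₂, bracket_geom_geom h₁ h₃, bracket_geom_geom h₂ h₃,
    bracket_geom_y hn hn' hb h₁, bracket_geom_y hn hn' hb h₂, bracket_geom_y hn hn' hb h₃] at key
  have hne : ε * (geomFactor m n W t₁ * geomFactor m n W t₂ * geomFactor m n W t₃) ≠ 0 :=
    mul_ne_zero hε
      (mul_ne_zero (mul_ne_zero (geomFactor_ne_zero m n W h₁) (geomFactor_ne_zero m n W h₂))
        (geomFactor_ne_zero m n W h₃))
  apply mul_left_cancel₀ hne
  linear_combination -key

end Bilinear

/-! ### Universal characters attached to pairs of cores -/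

section CoreTau

variable {K : Type*} [Field K] [CharZero K] {N : ℕ} [NeZero N]

/-- The universal character attached to the pair of cores `λ(m)`, `λ(n)`. -/
def coreTau (p : (ℕ → K) × (ℕ → K)) (m n : ZMod N → ℤ) : K :=
  universalCharacter ((corePartition m).map fun c : ℕ => (c : ℤ))
    ((corePartition n).map fun c : ℕ => (c : ℤ)) p.1 p.2

/-- Trailing zeros do not change the universal character, so both partitions may be padded to the
whole window. Substituting part = position - charge + index, with lengths known from the charge,
removes the row number from the entries. -/
theorem coreTau_eq_mayaDet (p : (ℕ → K) × (ℕ → K)) {m n : ZMod N → ℤ} {W : ℕ}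
    (hm : mayaBound m ≤ W) (hn : mayaBound n ≤ W) :
    coreTau p m n = mayaDet (elemP p.1) (elemP p.2) m n W := by
  obtain ⟨z, hz⟩ := padPart_eq hm
  obtain ⟨z', hz'⟩ := padPart_eq hn
  have hlm := length_mayaList hm
  have hln := length_mayaList hn
  have lm : (padPart m W).length = (mayaList m W).length := by simp [padPart]
  have ln : (padPart n W).length = (mayaList n W).length := by simp [padPart]
  rw [coreTau, ← universalCharacter_append_replicate _ _ z z', ← hz, ← hz',
    universalCharacter_eq_rowDet _ _ _ _ (n := mayaSize m n W) (by rw [lm, ln, mayaSize]), mayaDet]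
  apply rowDet_congr
  intro i j hi hj
  rw [getD_map_range _ _ _ hi, ucRow, ln, mayaRows]
  rw [mayaSize] at hi
  have hpad : ∀ (n : ZMod N → ℤ) (s : ℕ) (hs : s < (mayaList n W).length),
      (padPart n W).getD s 0 = (mayaList n W)[s] - vecSum n + s := by
    intro n s hs
    rw [List.getD_eq_getElem _ _ (by simpa [padPart] using hs)]
    simp [padPart]
  split_ifs with h
  · rw [List.getD_append _ _ _ _ (by simpa using h), hpad _ _ (by omega),
      List.getD_eq_getElem _ _ (by simpa using h), List.getElem_map, List.getElem_reverse, yRow]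
    congr 1
    have : (((mayaList n W).length - 1 - i : ℕ) : ℤ) = (mayaList n W).length - 1 - i := by omega
    rw [this, hln]
    ring
  · rw [List.getD_append_right _ _ _ _ (by simpa using h), hpad _ _ (by omega),
      List.getD_eq_getElem _ _ (by simp; omega), List.getElem_map, xRow]
    simp only [List.length_map, List.length_reverse]
    congr 1
    have : ((i - (mayaList n W).length : ℕ) : ℤ) = i - (mayaList n W).length := by omega
    rw [this, hln]
    ring

/-- `p'` arises from `p` by a shift `t → q t` of a variable. -/
def ShiftRel (t : K) (p p' : (ℕ → K) × (ℕ → K)) : Prop :=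
  elemP p'.1 = seqShift t (elemP p.1) ∧ elemP p'.2 = seqShift t⁻¹ (elemP p.2)

variable {p p₁ p₂ p₃ p₁₂ p₁₃ p₂₃ : (ℕ → K) × (ℕ → K)} {t₁ t₂ t₃ : K}

theorem coreTau_shift (h : ShiftRel t₁ p p₁) {m n : ZMod N → ℤ} {W : ℕ}
    (hm : mayaBound m ≤ W) (hn : mayaBound n ≤ W) :
    coreTau p₁ m n = mayaDet (seqShift t₁ (elemP p.1)) (seqShift t₁⁻¹ (elemP p.2)) m n W := by
  rw [coreTau_eq_mayaDet p₁ hm hn, h.1, h.2]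

theorem coreTau_shift_shift (h : ShiftRel t₁ p p₁) (h' : ShiftRel t₂ p₁ p₁₂) {m n : ZMod N → ℤ}
    {W : ℕ} (hm : mayaBound m ≤ W) (hn : mayaBound n ≤ W) :
    coreTau p₁₂ m n = mayaDet (seqShift t₂ (seqShift t₁ (elemP p.1)))
      (seqShift t₂⁻¹ (seqShift t₁⁻¹ (elemP p.2))) m n W := by
  rw [coreTau_shift h' hm hn, h.1, h.2]

theorem coreTau_bilinear (h₁ : t₁ ≠ 0) (h₂ : t₂ ≠ 0) (s₁ : ShiftRel t₁ p p₁)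
    (s₂ : ShiftRel t₂ p p₂) (s₁₂ : ShiftRel t₂ p₁ p₁₂) (m n : ZMod N → ℤ) (i j : ℤ) :
    (t₂ - t₁) * coreTau p₁₂ (coreShift m i) (coreShift n j) *
        coreTau p (coreShift m (i + 1)) (coreShift n (j + 1)) =
      t₂ * coreTau p₁ (coreShift m (i + 1)) (coreShift n j) *
        coreTau p₂ (coreShift m i) (coreShift n (j + 1)) -
      t₁ * coreTau p₂ (coreShift m (i + 1)) (coreShift n j) *
        coreTau p₁ (coreShift m i) (coreShift n (j + 1)) := by
  set W := max (max (mayaBound (coreShift m i)) (mayaBound (coreShift m (i + 1))))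
    (max (mayaBound (coreShift n j)) (mayaBound (coreShift n (j + 1)))) with hW
  have a1 : mayaBound (coreShift m i) ≤ W := by simp [hW]
  have a2 : mayaBound (coreShift m (i + 1)) ≤ W := by simp [hW]
  have a3 : mayaBound (coreShift n j) ≤ W := by simp [hW]
  have a4 : mayaBound (coreShift n (j + 1)) ≤ W := by simp [hW]
  rw [coreTau_shift_shift s₁ s₁₂ a1 a3, coreTau_eq_mayaDet p a2 a4, coreTau_shift s₁ a2 a3,
    coreTau_shift s₂ a1 a4, coreTau_shift s₂ a2 a3, coreTau_shift s₁ a1 a4]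
  rw [(coreShift_succ m i).1] at a2 ⊢
  rw [(coreShift_succ n j).1] at a4 ⊢
  exact mayaDet_bilinear h₁ h₂ _ _ _ _ _ _ a1 a2 a3 a4

theorem coreTau_bilinear_left (h₁ : t₁ ≠ 0) (h₂ : t₂ ≠ 0) (h₃ : t₃ ≠ 0) (s₁ : ShiftRel t₁ p p₁)
    (s₂ : ShiftRel t₂ p p₂) (s₃ : ShiftRel t₃ p p₃) (s₁₂ : ShiftRel t₂ p₁ p₁₂)
    (s₁₃ : ShiftRel t₃ p₁ p₁₃) (s₂₃ : ShiftRel t₃ p₂ p₂₃) (m n : ZMod N → ℤ) (i : ℤ) :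
    (t₂ - t₁) * coreTau p₁₂ (coreShift m i) n * coreTau p₃ (coreShift m (i + 1)) n -
      (t₃ - t₁) * coreTau p₁₃ (coreShift m i) n * coreTau p₂ (coreShift m (i + 1)) n +
      (t₃ - t₂) * coreTau p₂₃ (coreShift m i) n * coreTau p₁ (coreShift m (i + 1)) n = 0 := by
  set W := max (max (mayaBound (coreShift m i)) (mayaBound (coreShift m (i + 1)))) (mayaBound n)
    with hW
  have a1 : mayaBound (coreShift m i) ≤ W := by simp [hW]
  have a2 : mayaBound (coreShift m (i + 1)) ≤ W := by simp [hW]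
  have a3 : mayaBound n ≤ W := by simp [hW]
  rw [coreTau_shift_shift s₁ s₁₂ a1 a3, coreTau_shift_shift s₁ s₁₃ a1 a3,
    coreTau_shift_shift s₂ s₂₃ a1 a3, coreTau_shift s₁ a2 a3, coreTau_shift s₂ a2 a3,
    coreTau_shift s₃ a2 a3]
  rw [(coreShift_succ m i).1] at a2 ⊢
  exact mayaDet_bilinear_left h₁ h₂ h₃ _ _ _ _ _ a1 a2

theorem coreTau_bilinear_right (h₁ : t₁ ≠ 0) (h₂ : t₂ ≠ 0) (h₃ : t₃ ≠ 0) (s₁ : ShiftRel t₁ p p₁)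
    (s₂ : ShiftRel t₂ p p₂) (s₃ : ShiftRel t₃ p p₃) (s₁₂ : ShiftRel t₂ p₁ p₁₂)
    (s₁₃ : ShiftRel t₃ p₁ p₁₃) (s₂₃ : ShiftRel t₃ p₂ p₂₃) (m n : ZMod N → ℤ) (j : ℤ) :
    (t₂ - t₁) * t₃ * coreTau p₁₂ m (coreShift n j) * coreTau p₃ m (coreShift n (j + 1)) -
      (t₃ - t₁) * t₂ * coreTau p₁₃ m (coreShift n j) * coreTau p₂ m (coreShift n (j + 1)) +
      (t₃ - t₂) * t₁ * coreTau p₂₃ m (coreShift n j) * coreTau p₁ m (coreShift n (j + 1)) = 0 := by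
  set W := max (max (mayaBound (coreShift n j)) (mayaBound (coreShift n (j + 1)))) (mayaBound m)
    with hW
  have a1 : mayaBound (coreShift n j) ≤ W := by simp [hW]
  have a2 : mayaBound (coreShift n (j + 1)) ≤ W := by simp [hW]
  have a3 : mayaBound m ≤ W := by simp [hW]
  rw [coreTau_shift_shift s₁ s₁₂ a3 a1, coreTau_shift_shift s₁ s₁₃ a3 a1,
    coreTau_shift_shift s₂ s₂₃ a3 a1, coreTau_shift s₁ a3 a2, coreTau_shift s₂ a3 a2,
    coreTau_shift s₃ a3 a2]
  rw [(coreShift_succ n j).1] at a2 ⊢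
  exact mayaDet_bilinear_right h₁ h₂ h₃ _ _ _ _ _ a1 a2

/-- The variables of `ucSym`. -/
def varPair (q : K) {k l : ℕ} (tI : Fin k → K) (tJ : Fin l → K) : (ℕ → K) × (ℕ → K) :=
  (powerVar q tI tJ, powerVar q⁻¹ (fun i => (tI i)⁻¹) (fun j => (tJ j)⁻¹))

theorem coreUC_eq_coreTau (q : K) {k l : ℕ} (tI : Fin k → K) (tJ : Fin l → K) (m n : ZMod N → ℤ)
    (i j : ℤ) : coreUC q tI tJ m n i j =
      coreTau (varPair q tI tJ) (coreShift m i) (coreShift n j) := by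
  have h : ∀ L : List ℕ, (do let a ← L; pure (a : ℤ) : List ℤ).map (fun c => c) =
      L.map fun c : ℕ => (c : ℤ) := by
    intro L
    simp [List.bind_eq_flatMap, List.pure_def, List.map_eq_flatMap]
  rw [coreUC, ucSym, coreTau, h, h]
  rfl

theorem seqShift_eq {x y : ℕ → K} {t : K}
    (h : ∀ n : ℕ, ((n : K) + 1) * y (n + 1) = ((n : K) + 1) * x (n + 1) - t ^ (n + 1)) :
    elemP y = seqShift t (elemP x) := funext fun k => elemP_shift h k

theorem powerVar_shift {q : K} (hq : ∀ k : ℕ, 0 < k → q ^ k ≠ 1) {k l : ℕ} {tI tI' : Fin k → K}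
    {tJ tJ' : Fin l → K} {t : K}
    (h : ∀ n : ℕ, ∑ i, tI' i ^ n - q ^ n * ∑ j, tJ' j ^ n =
      ∑ i, tI i ^ n - q ^ n * ∑ j, tJ j ^ n - (1 - q ^ n) * t ^ n) (n : ℕ) :
    ((n : K) + 1) * powerVar q tI' tJ' (n + 1) =
      ((n : K) + 1) * powerVar q tI tJ (n + 1) - t ^ (n + 1) := by
  have h1 : (1 : K) - q ^ (n + 1) ≠ 0 := fun h => hq (n + 1) n.succ_pos (sub_eq_zero.1 h).symm
  have h2 : ((n : K) + 1) ≠ 0 := Nat.cast_add_one_ne_zero _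
  rw [powerVar, powerVar, h]
  push_cast
  field_simp

theorem inv_pow_ne_one {q : K} (hq : ∀ k : ℕ, 0 < k → q ^ k ≠ 1) (k : ℕ) (hk : 0 < k) :
    q⁻¹ ^ k ≠ 1 := by
  rw [inv_pow, ne_eq, inv_eq_one]
  exact hq k hk

/-- A change of (1 - q^n) t^n in the numerator cancels the denominator of x_n, so n x_n decreases by
t^n. The second hypothesis is the same for inverse variables and inverse base. -/
theorem shiftRel_varPair {q : K} (hq : ∀ k : ℕ, 0 < k → q ^ k ≠ 1) {k l : ℕ} {tI tI' : Fin k → K}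
    {tJ tJ' : Fin l → K} {t : K}
    (h : ∀ n : ℕ, ∑ i, tI' i ^ n - q ^ n * ∑ j, tJ' j ^ n =
      ∑ i, tI i ^ n - q ^ n * ∑ j, tJ j ^ n - (1 - q ^ n) * t ^ n)
    (h' : ∀ n : ℕ, ∑ i, (tI' i)⁻¹ ^ n - q⁻¹ ^ n * ∑ j, (tJ' j)⁻¹ ^ n =
      ∑ i, (tI i)⁻¹ ^ n - q⁻¹ ^ n * ∑ j, (tJ j)⁻¹ ^ n - (1 - q⁻¹ ^ n) * t⁻¹ ^ n) :
    ShiftRel t (varPair q tI tJ) (varPair q tI' tJ') :=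
  ⟨seqShift_eq (powerVar_shift hq h),
    seqShift_eq (powerVar_shift (q := q⁻¹) (inv_pow_ne_one hq)
      (tI := fun i => (tI i)⁻¹) (tI' := fun i => (tI' i)⁻¹) (tJ := fun i => (tJ i)⁻¹)
      (tJ' := fun i => (tJ' i)⁻¹) h')⟩

theorem coreTau_scale (q : K) {c : K} (hc : c ≠ 0) {k l : ℕ} {tI tI' : Fin k → K}
    {tJ tJ' : Fin l → K} (hI : ∀ i, tI' i = c * tI i) (hJ : ∀ j, tJ' j = c * tJ j)
    (m n : ZMod N → ℤ) :
    coreTau (varPair q tI' tJ') m n =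
      c ^ (coreWeight m - coreWeight n) * coreTau (varPair q tI tJ) m n := by
  have key : ∀ (q c : K) (tI tI' : Fin k → K) (tJ tJ' : Fin l → K), (∀ i, tI' i = c * tI i) →
      (∀ j, tJ' j = c * tJ j) → ∀ k : ℤ, elemP (powerVar q tI' tJ') k =
        c ^ k * elemP (powerVar q tI tJ) k := by
    intro q c tI tI' tJ tJ' hI hJ k
    apply elemP_scale
    intro n
    simp only [powerVar, hI, hJ, mul_pow, ← Finset.mul_sum]
    ring
  apply universalCharacter_scale hc
  · exact key q c tI tI' tJ tJ' hI hJ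
  · intro k
    rw [zpow_neg, ← inv_zpow]
    apply key
    · intro i
      rw [hI, mul_inv]
    · intro j
      rw [hJ, mul_inv]

theorem coreTau_map {L : Type*} [Field L] [CharZero L] (φ : K →+* L) (q : K) {k l : ℕ}
    (tI : Fin k → K) (tJ : Fin l → K) (m n : ZMod N → ℤ) :
    φ (coreTau (varPair q tI tJ) m n) =
      coreTau (varPair (φ q) (fun i => φ (tI i)) (fun j => φ (tJ j))) m n := by
  rw [coreTau, universalCharacter_map, coreTau]
  congr 1
  · funext n
    simp [varPair, powerVar]
  · funext n
    simp [varPair, powerVar]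

theorem coreTau_add_period_left (p : (ℕ → K) × (ℕ → K)) (m n : ZMod N → ℤ) (i : ℤ) :
    coreTau p (coreShift m (i + N)) n = coreTau p (coreShift m i) n := by
  rw [coreTau, corePartition_coreShift_add, coreTau]

theorem coreTau_add_period_right (p : (ℕ → K) × (ℕ → K)) (m n : ZMod N → ℤ) (i : ℤ) :
    coreTau p m (coreShift n (i + N)) = coreTau p m (coreShift n i) := by
  rw [coreTau, corePartition_coreShift_add, coreTau]

end CoreTau

end

noncomputable section

/-! ### Values of rational functions -/

section Values

variable {k : ℕ} {K : Type*} [Field K] [Algebra ℂ K] {x : Fin k → K} {F G : RatFun k} {v w : K}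

theorem hasValueAt_rconst (x : Fin k → K) (c : ℂ) :
    HasValueAt (rconst c) x (algebraMap ℂ K c) := by
  refine ⟨MvPolynomial.C c, 1, ?_, by simp, by simp⟩
  rw [map_one, div_one, rconst, IsScalarTower.algebraMap_apply ℂ (MvPolynomial (Fin k) ℂ) (RatFun k)]
  rfl

theorem hasValueAt_rvar (x : Fin k → K) (i : Fin k) : HasValueAt (rvar i) x (x i) :=
  ⟨MvPolynomial.X i, 1, by simp [rvar], by simp, by simp⟩

theorem algebraMap_ne_zero_of_aeval {Q : MvPolynomial (Fin k) ℂ} (h : MvPolynomial.aeval x Q ≠ 0) :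
    algebraMap (MvPolynomial (Fin k) ℂ) (RatFun k) Q ≠ 0 := by
  intro h0
  rw [FaithfulSMul.algebraMap_eq_zero_iff] at h0
  exact h (by rw [h0, map_zero])

theorem HasValueAt.add (hF : HasValueAt F x v) (hG : HasValueAt G x w) :
    HasValueAt (F + G) x (v + w) := by
  obtain ⟨P, Q, rfl, hQ, rfl⟩ := hF
  obtain ⟨P', Q', rfl, hQ', rfl⟩ := hG
  refine ⟨P * Q' + Q * P', Q * Q', ?_, by simp [hQ, hQ'], ?_⟩
  · rw [div_add_div _ _ (algebraMap_ne_zero_of_aeval hQ) (algebraMap_ne_zero_of_aeval hQ')]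
    simp only [map_add, map_mul]
  · rw [div_add_div _ _ hQ hQ']
    simp only [map_add, map_mul]

theorem HasValueAt.mul (hF : HasValueAt F x v) (hG : HasValueAt G x w) :
    HasValueAt (F * G) x (v * w) := by
  obtain ⟨P, Q, rfl, hQ, rfl⟩ := hF
  obtain ⟨P', Q', rfl, hQ', rfl⟩ := hG
  refine ⟨P * P', Q * Q', ?_, by simp [hQ, hQ'], ?_⟩
  · rw [div_mul_div_comm, map_mul, map_mul]
  · rw [div_mul_div_comm, map_mul, map_mul]

/-- The tool for all non-vanishing statements on rational functions: it suffices to exhibit one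
point where the function is regular with nonzero value. -/
theorem HasValueAt.ne_zero (hF : HasValueAt F x v) (hv : v ≠ 0) : F ≠ 0 := by
  obtain ⟨P, Q, rfl, hQ, rfl⟩ := hF
  have hP : MvPolynomial.aeval x P ≠ 0 := fun h => hv (by rw [h, zero_div])
  exact div_ne_zero (algebraMap_ne_zero_of_aeval hP) (algebraMap_ne_zero_of_aeval hQ)

theorem HasValueAt.inv (hF : HasValueAt F x v) (hv : v ≠ 0) : HasValueAt F⁻¹ x v⁻¹ := by
  obtain ⟨P, Q, rfl, hQ, rfl⟩ := hF
  have hP : MvPolynomial.aeval x P ≠ 0 := fun h => hv (by rw [h, zero_div])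
  exact ⟨Q, P, by rw [inv_div], hP, by rw [inv_div]⟩

theorem HasValueAt.div (hF : HasValueAt F x v) (hG : HasValueAt G x w) (hw : w ≠ 0) :
    HasValueAt (F / G) x (v / w) := by
  rw [div_eq_mul_inv, div_eq_mul_inv]
  exact hF.mul (hG.inv hw)

theorem hasValueAt_one (x : Fin k → K) : HasValueAt 1 x 1 := by
  have := hasValueAt_rconst x 1
  simpa [rconst] using this

theorem hasValueAt_zero (x : Fin k → K) : HasValueAt 0 x 0 := by
  have := hasValueAt_rconst x 0
  simpa [rconst] using this

theorem HasValueAt.neg (hF : HasValueAt F x v) : HasValueAt (-F) x (-v) := by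
  have := (hasValueAt_rconst x (-1)).mul hF
  simpa [rconst] using this

theorem HasValueAt.sub (hF : HasValueAt F x v) (hG : HasValueAt G x w) :
    HasValueAt (F - G) x (v - w) := by
  rw [sub_eq_add_neg, sub_eq_add_neg]
  exact hF.add hG.neg

theorem hasValueAt_natCast (x : Fin k → K) (n : ℕ) : HasValueAt (n : RatFun k) x n := by
  have := hasValueAt_rconst x n
  simpa [rconst] using this

theorem HasValueAt.pow (hF : HasValueAt F x v) (n : ℕ) : HasValueAt (F ^ n) x (v ^ n) := by
  induction n with
  | zero => simpa using hasValueAt_one x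
  | succ n ih =>
    rw [pow_succ, pow_succ]
    exact ih.mul hF

theorem HasValueAt.zpow (hF : HasValueAt F x v) (hv : v ≠ 0) (n : ℤ) :
    HasValueAt (F ^ n) x (v ^ n) := by
  rcases n with n | n
  · simpa using hF.pow n
  · rw [zpow_negSucc, zpow_negSucc]
    exact (hF.pow _).inv (pow_ne_zero _ hv)

theorem HasValueAt.sum {ι : Type*} (s : Finset ι) {f : ι → RatFun k} {g : ι → K}
    (h : ∀ i ∈ s, HasValueAt (f i) x (g i)) : HasValueAt (∑ i ∈ s, f i) x (∑ i ∈ s, g i) := by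
  classical
  induction s using Finset.induction_on with
  | empty => simpa using hasValueAt_zero x
  | insert a s ha ih =>
    rw [Finset.sum_insert ha, Finset.sum_insert ha]
    exact (h a (Finset.mem_insert_self a s)).add
      (ih fun i hi => h i (Finset.mem_insert_of_mem hi))

theorem HasValueAt.prod {ι : Type*} (s : Finset ι) {f : ι → RatFun k} {g : ι → K}
    (h : ∀ i ∈ s, HasValueAt (f i) x (g i)) : HasValueAt (∏ i ∈ s, f i) x (∏ i ∈ s, g i) := by
  classical
  induction s using Finset.induction_on with
  | empty => simpa using hasValueAt_one x
  | insert a s ha ih =>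
    rw [Finset.prod_insert ha, Finset.prod_insert ha]
    exact (h a (Finset.mem_insert_self a s)).mul
      (ih fun i hi => h i (Finset.mem_insert_of_mem hi))

theorem HasValueAt.det {ι : Type*} [Fintype ι] [DecidableEq ι] {A : Matrix ι ι (RatFun k)}
    {B : Matrix ι ι K} (h : ∀ i j, HasValueAt (A i j) x (B i j)) :
    HasValueAt A.det x B.det := by
  rw [Matrix.det_apply', Matrix.det_apply']
  refine HasValueAt.sum _ fun σ _ => ?_
  have h1 : HasValueAt (((Equiv.Perm.sign σ : ℤ) : RatFun k)) x ((Equiv.Perm.sign σ : ℤ) : K) := by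
    rcases Int.units_eq_one_or (Equiv.Perm.sign σ) with h | h
    · simpa [h] using hasValueAt_one x
    · simpa [h] using (hasValueAt_one x).neg
  exact h1.mul (HasValueAt.prod _ fun i _ => h _ _)

/-- The defining recursion only divides by positive integers, so regularity passes from the
variables to the elementary polynomials. -/
theorem HasValueAt.elemP [CharZero K] {X : ℕ → RatFun k} {X₀ : ℕ → K}
    (h : ∀ n, HasValueAt (X (n + 1)) x (X₀ (n + 1))) (j : ℤ) :
    HasValueAt (elemP X j) x (elemP X₀ j) := by
  rcases lt_or_ge j 0 with hj | hj
  · rw [elemP_of_neg _ hj, elemP_of_neg _ hj]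
    exact hasValueAt_zero x
  lift j to ℕ using hj
  induction j using Nat.strong_induction_on with
  | _ j ih =>
    rcases j with _ | j
    · simpa [elemP_zero] using hasValueAt_one x
    · have hj : ((j : K) + 1) ≠ 0 := Nat.cast_add_one_ne_zero j
      have hj' : ((j : RatFun k) + 1) ≠ 0 := Nat.cast_add_one_ne_zero j
      rw [eq_div_of_mul_eq hj' ((mul_comm _ _).trans (elemP_succ X j)),
        eq_div_of_mul_eq hj ((mul_comm _ _).trans (elemP_succ X₀ j))]
      refine HasValueAt.div (HasValueAt.sum _ fun p hp => ?_)
        ((hasValueAt_natCast x j).add (hasValueAt_one x)) hj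
      have hp' := Finset.HasAntidiagonal.mem_antidiagonal.1 hp
      exact (ih p.1 (by omega)).mul
        (((hasValueAt_natCast x _).add (hasValueAt_one x)).mul (h _))

end Values

/-! ### Non-vanishing of universal characters -/

section NonVanishing

/-- Since h_{b-j-1} = h_{b-j} c⁻¹ (1 - q^{b-j}), the entry h_{b_i-j} is h_{b_i} times a nonzero
constant of the column times a monic polynomial of degree j in q^{b_i}. The determinant is thus a
nonzero multiple of the Vandermonde determinant of the q^{b_i}, which are distinct because q is not
a root of unity. -/
theorem det_principal_ne_zero {K : Type*} [Field K] {q c : K} (hq0 : q ≠ 0)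
    (hq : ∀ k : ℕ, 0 < k → q ^ k ≠ 1) (hc : c ≠ 0) {h : ℤ → K} (hneg : ∀ k < 0, h k = 0)
    (hnat : ∀ k : ℕ, h k = c ^ k / ∏ s ∈ Finset.range k, (1 - q ^ (s + 1)))
    {l : ℕ} {b : Fin l → ℕ} (hb : Function.Injective b) :
    (Matrix.of fun i j : Fin l => h (b i - (j : ℕ))).det ≠ 0 := by
  have hne : ∀ n : ℕ, (1 : K) - q ^ (n + 1) ≠ 0 := fun n h =>
    hq (n + 1) n.succ_pos (sub_eq_zero.1 h).symm
  have hstep : ∀ b j : ℕ, h (b - (j + 1 : ℕ)) =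
      h (b - j) * (c⁻¹ * (-(q ^ j)⁻¹) * (q ^ b - q ^ j)) := by
    intro b j
    rcases lt_or_ge j b with hjb | hjb
    · obtain ⟨s, rfl⟩ := Nat.exists_eq_add_of_lt hjb
      have e1 : ((j + s + 1 : ℕ) : ℤ) - (j + 1 : ℕ) = (s : ℕ) := by push_cast; ring
      have e2 : ((j + s + 1 : ℕ) : ℤ) - j = (s + 1 : ℕ) := by push_cast; ring
      rw [e1, e2, hnat, hnat, Finset.prod_range_succ]
      have h1 := hne s
      have h2 : ∏ s ∈ Finset.range s, (1 - q ^ (s + 1)) ≠ 0 :=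
        Finset.prod_ne_zero_iff.2 fun s _ => hne s
      field_simp
      ring
    -- Below the diagonal both sides vanish: at b = j because of the factor q^b - q^j, beyond it
    -- because h already vanishes.
    · rw [hneg _ (by push_cast; omega)]
      rcases hjb.eq_or_lt with rfl | hjb
      · ring
      · rw [hneg _ (by omega), zero_mul]
  have hprod : ∀ b j : ℕ, h (b - j) = h b * ((∏ s ∈ Finset.range j, (c⁻¹ * (-(q ^ s)⁻¹))) *
      ∏ s ∈ Finset.range j, (q ^ b - q ^ s)) := by
    intro b j
    induction j with
    | zero => simp
    | succ j ih =>
      rw [hstep, ih, Finset.prod_range_succ, Finset.prod_range_succ]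
      ring
  have hp : ∀ j : Fin l, (∏ s ∈ Finset.range (j : ℕ), (Polynomial.X - Polynomial.C (q ^ s))).natDegree = (j : ℕ)
      ∧ (∏ s ∈ Finset.range (j : ℕ), (Polynomial.X - Polynomial.C (q ^ s))).Monic := by
    intro j
    refine ⟨?_, Polynomial.monic_prod_of_monic _ _ fun s _ => Polynomial.monic_X_sub_C _⟩
    rw [Polynomial.natDegree_prod_of_monic _ _ fun s _ => Polynomial.monic_X_sub_C _,
      Finset.sum_congr rfl fun s _ => Polynomial.natDegree_X_sub_C (q ^ s)]
    simp
  have hv := Matrix.det_eval_matrixOfPolynomials_eq_det_vandermonde (fun i => q ^ b i)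
    (fun j : Fin l => ∏ s ∈ Finset.range (j : ℕ), (Polynomial.X - Polynomial.C (q ^ s)))
    (fun j => (hp j).1) (fun j => (hp j).2)
  have hM : (Matrix.of fun i j : Fin l => h (b i - (j : ℕ))) = Matrix.of fun i j : Fin l =>
      h (b i) * (Matrix.of fun i j : Fin l => (∏ s ∈ Finset.range j, (c⁻¹ * (-(q ^ s)⁻¹))) *
        (Matrix.of fun i j : Fin l => (∏ s ∈ Finset.range j,
          (Polynomial.X - Polynomial.C (q ^ s))).eval (q ^ b i)) i j) i j := by
    ext i j
    simp only [Matrix.of_apply]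
    rw [hprod, Polynomial.eval_prod]
    simp
  rw [hM, Matrix.det_mul_column, Matrix.det_mul_row, ← hv]
  have hinj : Function.Injective fun i => q ^ b i := by
    intro i j hij
    apply hb
    by_contra hcon
    rcases lt_or_gt_of_ne hcon with hlt | hlt
    · obtain ⟨s, hs⟩ := Nat.exists_eq_add_of_lt hlt
      simp only [hs] at hij
      have : q ^ b i * (q ^ (s + 1) - 1) = 0 := by
        linear_combination -hij
      rcases mul_eq_zero.1 this with h | h
      · exact pow_ne_zero _ hq0 h
      · exact hq (s + 1) s.succ_pos (sub_eq_zero.1 h)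
    · obtain ⟨s, hs⟩ := Nat.exists_eq_add_of_lt hlt
      simp only [hs] at hij
      have : q ^ b j * (q ^ (s + 1) - 1) = 0 := by
        linear_combination hij
      rcases mul_eq_zero.1 this with h | h
      · exact pow_ne_zero _ hq0 h
      · exact hq (s + 1) s.succ_pos (sub_eq_zero.1 h)
  refine mul_ne_zero ?_ (mul_ne_zero ?_ (Matrix.det_vandermonde_ne_zero_iff.2 hinj))
  · refine Finset.prod_ne_zero_iff.2 fun i _ => ?_
    rw [hnat]
    exact div_ne_zero (pow_ne_zero _ hc) (Finset.prod_ne_zero_iff.2 fun s _ => hne s)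
  · refine Finset.prod_ne_zero_iff.2 fun j _ => Finset.prod_ne_zero_iff.2 fun s _ => ?_
    exact mul_ne_zero (inv_ne_zero hc) (neg_ne_zero.2 (inv_ne_zero (pow_ne_zero _ hq0)))

theorem det_partition_ne_zero {K : Type*} [Field K] {q c : K} (hq0 : q ≠ 0)
    (hq : ∀ k : ℕ, 0 < k → q ^ k ≠ 1) (hc : c ≠ 0) {h : ℤ → K} (hneg : ∀ k < 0, h k = 0)
    (hnat : ∀ k : ℕ, h k = c ^ k / ∏ s ∈ Finset.range k, (1 - q ^ (s + 1)))
    {lam : List ℕ} (hl : lam.Pairwise (· ≥ ·)) :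
    (Matrix.of fun i j : Fin lam.length =>
      h ((lam.getD (lam.length - 1 - i) 0 : ℕ) + (i : ℕ) - (j : ℕ))).det ≠ 0 := by
  have := det_principal_ne_zero hq0 hq hc hneg hnat
    (b := fun i : Fin lam.length => lam.getD (lam.length - 1 - i) 0 + i) ?_
  · simpa using this
  · apply StrictMono.injective
    intro i j hij
    have hi := i.2
    have hj := j.2
    have hij' : (i : ℕ) < j := hij
    have h1 : lam.getD (lam.length - 1 - i) 0 ≤ lam.getD (lam.length - 1 - j) 0 := by
      rw [List.getD_eq_getElem _ _ (by omega), List.getD_eq_getElem _ _ (by omega)]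
      exact List.pairwise_iff_getElem.1 hl _ _ (by omega) (by omega) (by omega)
    simp only
    omega

/-- Where u vanishes, u^j p_j stays finite for both families of variables. After multiplying rows
and columns by suitable powers of u, the determinant is regular there, and its value is that of a
block triangular matrix with two principally specialised diagonal blocks. -/
theorem universalCharacter_ne_zero {k : ℕ} {x : Fin k → ℂ} {q c c' : ℂ} (hq0 : q ≠ 0)
    (hq : ∀ k : ℕ, 0 < k → q ^ k ≠ 1) (hc : c ≠ 0) (hc' : c' ≠ 0) {u : RatFun k} (hu0 : u ≠ 0)
    (hu : HasValueAt u x 0) {X Y : ℕ → RatFun k}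
    (hX : ∀ n, HasValueAt (u ^ (n + 1) * X (n + 1)) x
      (c ^ (n + 1) / ((n + 1 : ℕ) * (1 - q ^ (n + 1)))))
    (hY : ∀ n, HasValueAt (u ^ (n + 1) * Y (n + 1)) x
      (c' ^ (n + 1) / ((n + 1 : ℕ) * (1 - q⁻¹ ^ (n + 1)))))
    {lam mu : List ℕ} (hlam : lam.Pairwise (· ≥ ·)) (hmu : mu.Pairwise (· ≥ ·)) :
    universalCharacter (lam.map fun c : ℕ => (c : ℤ)) (mu.map fun c : ℕ => (c : ℤ)) X Y ≠ 0 := by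
  set X₀ : ℕ → ℂ := fun n => c ^ n / (n * (1 - q ^ n)) with hX₀
  set Y₀ : ℕ → ℂ := fun n => c' ^ n / (n * (1 - q⁻¹ ^ n)) with hY₀
  have vX : ∀ j : ℤ, HasValueAt (u ^ j * elemP X j) x (elemP X₀ j) := by
    intro j
    rw [← elemP_scale (x := X) (y := fun n => u ^ n * X n) (c := u) (fun n => rfl)]
    exact HasValueAt.elemP hX j
  have vY : ∀ j : ℤ, HasValueAt (u ^ j * elemP Y j) x (elemP Y₀ j) := by
    intro j
    rw [← elemP_scale (x := Y) (y := fun n => u ^ n * Y n) (c := u) (fun n => rfl)]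
    exact HasValueAt.elemP hY j
  have dlam := det_partition_ne_zero hq0 hq hc (h := elemP X₀) (fun k hk => elemP_of_neg _ hk)
    (fun k => elemP_principal hq k) hlam
  have dmu := det_partition_ne_zero (inv_ne_zero hq0) (inv_pow_ne_one hq) hc' (h := elemP Y₀)
    (fun k hk => elemP_of_neg _ hk) (fun k => elemP_principal (inv_pow_ne_one hq) k) hmu
  set L := lam.length with hL
  set L' := mu.length with hL'
  have getmap : ∀ (l : List ℕ) (i : ℕ), (l.map fun c : ℕ => (c : ℤ)).getD i 0 = (l.getD i 0 : ℕ) := by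
    intro l i
    have := List.getD_map (f := fun c : ℕ => (c : ℤ)) (l := l) (d := 0) (n := i)
    simpa using this
  rw [universalCharacter_eq_rowDet _ _ _ _ (n := L' + L) (by simp [hL, hL']), rowDet]
  -- The sum of the row and column exponents equals the index of the entry for y-rows with j ≤ L'
  -- and for x-rows with j ≥ L'. Elsewhere it exceeds the index by 2|j - L'|, and the entry tends to
  -- zero.
  set ρ : ℕ → ℤ := fun i => if i < L' then (mu.getD (L' - 1 - i) 0 : ℕ) + (i : ℤ) - L'
    else (lam.getD (i - L') 0 : ℕ) - (i : ℤ) + L' with hρ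
  set γ : ℕ → ℤ := fun j => |(L' : ℤ) - j| with hγ
  set M : Matrix (Fin (L' + L)) (Fin (L' + L)) (RatFun k) := Matrix.of fun i j =>
    ((List.range (L' + L)).map (ucRow (lam.map fun c : ℕ => (c : ℤ))
      (mu.map fun c : ℕ => (c : ℤ)) X Y)).getD i 0 (0 + ((j : ℕ) : ℤ)) with hM
  set A : Matrix (Fin (L' + L)) (Fin (L' + L)) (RatFun k) := Matrix.of fun i j =>
    u ^ ρ i * (Matrix.of fun i j : Fin (L' + L) => u ^ γ j * M i j) i j with hA
  set B : Matrix (Fin (L' + L)) (Fin (L' + L)) ℂ := Matrix.of fun i j =>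
    if (i : ℕ) < L' then
      elemP Y₀ ((mu.getD (L' - 1 - i) 0 : ℕ) + (i : ℕ) - (j : ℕ)) *
        (if (j : ℕ) ≤ L' then 1 else 0)
    else elemP X₀ ((lam.getD (i - L') 0 : ℕ) - (i : ℕ) + (j : ℕ)) *
        (if L' ≤ (j : ℕ) then 1 else 0) with hB
  have hupow : ∀ s : ℕ, 0 < s → HasValueAt (u ^ s) x 0 := by
    intro s hs
    have := hu.pow s
    rwa [zero_pow hs.ne'] at this
  have hAB : ∀ i j, HasValueAt (A i j) x (B i j) := by
    intro i j
    simp only [hA, hB, hM, Matrix.of_apply]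
    rw [getD_map_range _ _ _ i.2, ucRow, List.length_map, ← hL']
    by_cases hi : (i : ℕ) < L'
    · simp only [hρ, hi, if_true]
      rw [getmap]
      rcases le_or_gt (j : ℕ) L' with hj | hj
      · rw [if_pos hj, mul_one]
        have := vY ((mu.getD (L' - 1 - i) 0 : ℕ) + ((i : ℕ) : ℤ) - ((j : ℕ) : ℤ))
        rw [zero_add, ← mul_assoc, ← zpow_add₀ hu0]
        convert! this using 3
        simp only [hγ]
        rw [abs_of_nonneg (by omega)]
        ring
      · rw [if_neg (by omega)]
        have := (vY ((mu.getD (L' - 1 - i) 0 : ℕ) + ((i : ℕ) : ℤ) - ((j : ℕ) : ℤ))).mul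
          (hupow (2 * (j - L')) (by omega))
        convert! this using 1
        rw [zero_add, ← mul_assoc, ← zpow_add₀ hu0, mul_right_comm, ← zpow_natCast,
          ← zpow_add₀ hu0]
        congr 2
        simp only [hγ]
        rw [abs_of_nonpos (by omega)]
        push_cast [Nat.cast_sub hj.le]
        ring
    · simp only [hρ, hi, if_false]
      rw [getmap]
      rcases le_or_gt L' (j : ℕ) with hj | hj
      · rw [if_pos hj, mul_one]
        have := vX ((lam.getD (i - L') 0 : ℕ) - ((i : ℕ) : ℤ) + ((j : ℕ) : ℤ))
        rw [zero_add, ← mul_assoc, ← zpow_add₀ hu0]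
        convert! this using 3
        simp only [hγ]
        rw [abs_of_nonpos (by omega)]
        ring
      · rw [if_neg (by omega)]
        have := (vX ((lam.getD (i - L') 0 : ℕ) - ((i : ℕ) : ℤ) + ((j : ℕ) : ℤ))).mul
          (hupow (2 * (L' - j)) (by omega))
        convert! this using 1
        rw [zero_add, ← mul_assoc, ← zpow_add₀ hu0, mul_right_comm, ← zpow_natCast,
          ← zpow_add₀ hu0]
        congr 2
        simp only [hγ]
        rw [abs_of_nonneg (by omega)]
        push_cast [Nat.cast_sub hj.le]
        ring
  have hBdet : B.det ≠ 0 := by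
    rw [← Matrix.det_submatrix_equiv_self finSumFinEquiv B]
    -- The lower left block vanishes. The upper right one may keep its first column, j = L', which
    -- does not affect the determinant. Reversing rows and columns brings the x-block into the form
    -- of `det_partition_ne_zero`.
    have hblock : B.submatrix finSumFinEquiv finSumFinEquiv = Matrix.fromBlocks
        (Matrix.of fun i j : Fin L' => elemP Y₀ ((mu.getD (L' - 1 - i) 0 : ℕ) + (i : ℕ) - (j : ℕ)))
        (B.submatrix (finSumFinEquiv ∘ Sum.inl) (finSumFinEquiv ∘ Sum.inr)) 0
        ((Matrix.of fun i j : Fin L => elemP X₀ ((lam.getD (L - 1 - i) 0 : ℕ) + (i : ℕ) -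
          (j : ℕ))).submatrix Fin.revPerm Fin.revPerm) := by
      ext i j
      rcases i with i | i <;> rcases j with j | j
      · have := j.2
        simp [hB, this.le]
      · rfl
      · simp [hB]
      · have hi := i.2
        have hj := j.2
        simp only [hB, Matrix.submatrix_apply, Matrix.of_apply, finSumFinEquiv_apply_right,
          Fin.val_natAdd, Matrix.fromBlocks_apply₂₂, Fin.revPerm_apply, Fin.val_rev]
        rw [if_neg (by omega), if_pos (by omega), mul_one, Nat.add_sub_cancel_left,
          show L - 1 - (L - ((i : ℕ) + 1)) = i by omega]
        congr 1
        push_cast [Nat.cast_sub (show (i : ℕ) + 1 ≤ L from hi),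
          Nat.cast_sub (show (j : ℕ) + 1 ≤ L from hj)]
        ring
    rw [hblock, Matrix.det_fromBlocks_zero₂₁, Matrix.det_submatrix_equiv_self]
    exact mul_ne_zero dmu dlam
  have hAdet := (HasValueAt.det hAB).ne_zero hBdet
  rw [hA, Matrix.det_mul_column, Matrix.det_mul_row] at hAdet
  exact right_ne_zero_of_mul (right_ne_zero_of_mul hAdet)

theorem pairwise_corePartition {N : ℕ} [NeZero N] (n : ZMod N → ℤ) :
    (corePartition n).Pairwise (· ≥ ·) := by
  rw [corePartition_eq]
  apply List.Pairwise.filter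
  rw [List.pairwise_map]
  refine (pairwise_mayaList n _).imp fun h => ?_
  apply Finset.card_le_card
  apply Finset.filter_subset_filter
  exact Finset.Ico_subset_Ico_right (le_of_lt h)

theorem powerVar_hasValueAt {k a b : ℕ} {x : Fin k → ℂ} {q c : ℂ}
    (hq : ∀ k : ℕ, 0 < k → q ^ k ≠ 1) {u : RatFun k} {tI : Fin a → RatFun k}
    {tJ : Fin b → RatFun k} {vI : Fin a → ℂ} {vJ : Fin b → ℂ}
    (hI : ∀ i, HasValueAt (u * tI i) x (vI i)) (hJ : ∀ j, HasValueAt (u * tJ j) x (vJ j))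
    (hsum : ∀ n : ℕ, ∑ i, vI i ^ (n + 1) - q ^ (n + 1) * ∑ j, vJ j ^ (n + 1) = c ^ (n + 1)) (n : ℕ) :
    HasValueAt (u ^ (n + 1) * powerVar (rconst q) tI tJ (n + 1)) x
      (c ^ (n + 1) / ((n + 1 : ℕ) * (1 - q ^ (n + 1)))) := by
  have h1 : (1 : ℂ) - q ^ (n + 1) ≠ 0 := fun h => hq (n + 1) n.succ_pos (sub_eq_zero.1 h).symm
  have h2 : ((n + 1 : ℕ) : ℂ) ≠ 0 := Nat.cast_ne_zero.2 n.succ_ne_zero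
  have e : u ^ (n + 1) * powerVar (rconst q) tI tJ (n + 1) =
      (∑ i, (u * tI i) ^ (n + 1) - rconst q ^ (n + 1) * ∑ j, (u * tJ j) ^ (n + 1)) /
        (((n + 1 : ℕ) : RatFun k) * (1 - rconst q ^ (n + 1))) := by
    simp only [powerVar, mul_pow, ← Finset.mul_sum]
    ring
  rw [e, ← hsum]
  have hqv : HasValueAt (rconst q ^ (n + 1)) x (q ^ (n + 1)) := (hasValueAt_rconst x q).pow (n + 1)
  exact ((HasValueAt.sum _ fun i _ => (hI i).pow (n + 1)).sub
    (hqv.mul (HasValueAt.sum _ fun j _ => (hJ j).pow (n + 1)))).div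
    ((hasValueAt_natCast x (n + 1)).mul ((hasValueAt_one x).sub hqv)) (mul_ne_zero h2 h1)

/-- After rescaling by u, the power sums of the variables and of their inverses must each degenerate
to those of a single nonzero quantity, c and c'. This is the situation of
`universalCharacter_ne_zero`. -/
theorem coreTau_ne_zero {N : ℕ} [NeZero N] {k a b : ℕ} (x : Fin k → ℂ) {q c c' : ℂ} (hq0 : q ≠ 0)
    (hq : ∀ k : ℕ, 0 < k → q ^ k ≠ 1) (hc : c ≠ 0) (hc' : c' ≠ 0) {u : RatFun k} (hu0 : u ≠ 0)
    (hu : HasValueAt u x 0) {tI : Fin a → RatFun k} {tJ : Fin b → RatFun k} {vI vI' : Fin a → ℂ}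
    {vJ vJ' : Fin b → ℂ} (hI : ∀ i, HasValueAt (u * tI i) x (vI i))
    (hJ : ∀ j, HasValueAt (u * tJ j) x (vJ j)) (hI' : ∀ i, HasValueAt (u * (tI i)⁻¹) x (vI' i))
    (hJ' : ∀ j, HasValueAt (u * (tJ j)⁻¹) x (vJ' j))
    (hs : ∀ n : ℕ, ∑ i, vI i ^ (n + 1) - q ^ (n + 1) * ∑ j, vJ j ^ (n + 1) = c ^ (n + 1))
    (hs' : ∀ n : ℕ, ∑ i, vI' i ^ (n + 1) - q⁻¹ ^ (n + 1) * ∑ j, vJ' j ^ (n + 1) = c' ^ (n + 1))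
    (m n : ZMod N → ℤ) : coreTau (varPair (rconst q) tI tJ) m n ≠ 0 := by
  have e : (rconst q : RatFun k)⁻¹ = rconst q⁻¹ := by simp [rconst]
  refine universalCharacter_ne_zero (x := x) hq0 hq hc hc' hu0 hu
    (powerVar_hasValueAt hq hI hJ hs) ?_ (pairwise_corePartition m) (pairwise_corePartition n)
  rw [varPair, e]
  exact powerVar_hasValueAt (inv_pow_ne_one hq) hI' hJ' hs'

end NonVanishing

end

noncomputable section

/-! ### Fields of rational functions -/

section RationalFunctions

variable {k : ℕ}

theorem ratFun_induction {p : RatFun k → Prop} (hc : ∀ c, p (rconst c)) (hv : ∀ i, p (rvar i))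
    (hadd : ∀ a b, p a → p b → p (a + b)) (hmul : ∀ a b, p a → p b → p (a * b))
    (hinv : ∀ a, p a → p a⁻¹) (F : RatFun k) : p F := by
  have hpoly : ∀ P : MvPolynomial (Fin k) ℂ, p (algebraMap _ (RatFun k) P) := by
    intro P
    induction P using MvPolynomial.induction_on with
    | C a =>
      have := hc a
      rwa [rconst, IsScalarTower.algebraMap_apply ℂ (MvPolynomial (Fin k) ℂ) (RatFun k)] at this
    | add P Q hP hQ =>
      rw [map_add]
      exact hadd _ _ hP hQ
    | mul_X P i hP =>
      rw [map_mul]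
      exact hmul _ _ hP (hv i)
  obtain ⟨P, Q, _, rfl⟩ := IsFractionRing.div_surjective (A := MvPolynomial (Fin k) ℂ) F
  rw [div_eq_mul_inv]
  exact hmul _ _ (hpoly P) (hinv _ (hpoly Q))

theorem rconst_injective : Function.Injective (rconst : ℂ → RatFun k) :=
  (algebraMap ℂ (RatFun k)).injective

theorem rconst_ne_zero {c : ℂ} (hc : c ≠ 0) : (rconst c : RatFun k) ≠ 0 := by
  rw [rconst]
  simpa using hc

theorem rconst_pow (c : ℂ) (n : ℕ) : (rconst (c ^ n) : RatFun k) = rconst c ^ n := map_pow _ _ _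

theorem rconst_inv (c : ℂ) : (rconst c⁻¹ : RatFun k) = (rconst c)⁻¹ := map_inv₀ _ _

theorem rconst_zpow (c : ℂ) (n : ℤ) : (rconst (c ^ n) : RatFun k) = rconst c ^ n := map_zpow₀ _ _ _

theorem rconst_pow_ne_one {c : ℂ} (hc : ∀ k : ℕ, 0 < k → c ^ k ≠ 1) (n : ℕ) (hn : 0 < n) :
    (rconst c : RatFun k) ^ n ≠ 1 := by
  rw [← rconst_pow]
  intro h
  apply hc n hn
  apply rconst_injective (k := k)
  rw [h, rconst, map_one]

theorem rvar_ne_zero (i : Fin k) : (rvar i : RatFun k) ≠ 0 := by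
  rw [rvar, ne_eq, FaithfulSMul.algebraMap_eq_zero_iff]
  exact MvPolynomial.X_ne_zero i

/-- Algebraic elements form a field containing ℂ, so only the generators need checking, whatever the
solution looks like. -/
theorem algebraicIn_of_rvar {S : Set (RatFun k)} (h : ∀ i, AlgebraicIn S (rvar i : RatFun k))
    (F : RatFun k) : AlgebraicIn S F := by
  refine ratFun_induction (p := AlgebraicIn S) ?_ h (fun a b => IsAlgebraic.add)
    (fun a b => IsAlgebraic.mul) (fun a => IsAlgebraic.inv) F
  intro c
  have : rconst c = algebraMap (IntermediateField.adjoin ℂ S) (RatFun k)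
      (algebraMap ℂ (IntermediateField.adjoin ℂ S) c) := rfl
  rw [this]
  exact isAlgebraic_algebraMap _

theorem algebraicIn_of_mem {S : Set (RatFun k)} {F : RatFun k} (h : F ∈ S) : AlgebraicIn S F := by
  have : F = algebraMap (IntermediateField.adjoin ℂ S) (RatFun k)
      ⟨F, IntermediateField.subset_adjoin ℂ S h⟩ := rfl
  rw [this]
  exact isAlgebraic_algebraMap _

theorem AlgebraicIn.of_pow {S : Set (RatFun k)} {F : RatFun k} {n : ℕ} (hn : 0 < n)
    (h : AlgebraicIn S (F ^ n)) : AlgebraicIn S F := IsAlgebraic.of_pow hn h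

theorem algebraicIn_rconst (S : Set (RatFun k)) (c : ℂ) : AlgebraicIn S (rconst c) := by
  have : rconst c = algebraMap (IntermediateField.adjoin ℂ S) (RatFun k)
      (algebraMap ℂ (IntermediateField.adjoin ℂ S) c) := rfl
  rw [this]
  exact isAlgebraic_algebraMap _

/-- The automorphism of `ℂ[x_1, …, x_k]` which multiplies the variables by constants. -/
def scalePoly (c : Fin k → ℂ) (hc : ∀ i, c i ≠ 0) :
    MvPolynomial (Fin k) ℂ ≃ₐ[ℂ] MvPolynomial (Fin k) ℂ :=
  AlgEquiv.ofAlgHom (MvPolynomial.aeval fun i => MvPolynomial.C (c i) * MvPolynomial.X i)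
    (MvPolynomial.aeval fun i => MvPolynomial.C (c i)⁻¹ * MvPolynomial.X i)
    (by
      ext i : 1
      simp [← mul_assoc, ← MvPolynomial.C_mul, inv_mul_cancel₀ (hc i), MvPolynomial.algebraMap_eq])
    (by
      ext i : 1
      simp [← mul_assoc, ← MvPolynomial.C_mul, mul_inv_cancel₀ (hc i), MvPolynomial.algebraMap_eq])

theorem exists_scale (c : Fin k → ℂ) (hc : ∀ i, c i ≠ 0) :
    ∃ σ : RatFun k ≃ₐ[ℂ] RatFun k, ∀ i, σ (rvar i) = rconst (c i) * rvar i := by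
  refine ⟨IsFractionRing.fieldEquivOfAlgEquiv ℂ (RatFun k) (RatFun k) (scalePoly c hc), fun i => ?_⟩
  rw [rvar, IsFractionRing.fieldEquivOfAlgEquiv_algebraMap]
  simp only [scalePoly, AlgEquiv.ofAlgHom_apply, MvPolynomial.aeval_X, map_mul]
  rw [rconst, IsScalarTower.algebraMap_apply ℂ (MvPolynomial (Fin k) ℂ) (RatFun k)]
  rfl

theorem algEquiv_rconst (σ : RatFun k ≃ₐ[ℂ] RatFun k) (c : ℂ) : σ (rconst c) = rconst c :=
  σ.commutes c

theorem rvar_algebraicIndependent_pow {i : Fin k} {n : ℕ} (hn : 0 < n) (c : ℂ) :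
    (rvar i : RatFun k) ^ n ≠ rconst c := by
  intro h
  have h1 : HasValueAt ((rvar i : RatFun k) ^ n - rconst c) (fun _ => (0 : ℂ)) (0 ^ n - c) :=
    ((hasValueAt_rvar _ i).pow n).sub (hasValueAt_rconst _ c)
  have h2 : HasValueAt ((rvar i : RatFun k) ^ n - rconst c) (fun _ => (1 : ℂ)) (1 ^ n - c) :=
    ((hasValueAt_rvar _ i).pow n).sub (hasValueAt_rconst _ c)
  rw [zero_pow hn.ne'] at h1
  by_cases hc : c = 0
  · refine h2.ne_zero ?_ (sub_eq_zero.2 h)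
    simp [hc]
  · refine h1.ne_zero ?_ (sub_eq_zero.2 h)
    simpa using hc

end RationalFunctions

/-! ### Type `A_{2g+1}^{(1)}` -/

section TypeA

/-- Replacing P - 1 by a_{i+k} f_{i+k} E_{i+k+1} - E_{i+k} in the k-th summand makes the sum
telescope. -/
theorem cyclicSum_telescope {K : Type*} [Field K] {a f E : ℤ → K} {P : K}
    (hE : ∀ i, a i * f i * E (i + 1) - E i = P - 1) (M : ℕ) (i : ℤ) :
    (P - 1) * cyclicSum M a f i =
      (∏ l ∈ Finset.range M, (a (i + l) * f (i + l))) * E (i + M) - E i := by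
  induction M with
  | zero => simp [cyclicSum]
  | succ M ih =>
    rw [cyclicSum, Finset.sum_range_succ, mul_add, ← cyclicSum, ih, Finset.prod_range_succ,
      ← hE (i + M)]
    push_cast
    rw [← add_assoc i]
    ring

/-- The first order recursion for E has only one periodic solution when the product P over a period
is not 1. This identifies D_i with any product expression that satisfies the recursion. -/
theorem cyclicSum_eq {K : Type*} [Field K] {a f E : ℤ → K} {P : K} (hP : P ≠ 1)
    (hE : ∀ i, a i * f i * E (i + 1) - E i = P - 1) {M : ℕ} (hper : ∀ i, E (i + M) = E i)
    (hprod : ∀ i : ℤ, ∏ l ∈ Finset.range M, (a (i + l) * f (i + l)) = P) (i : ℤ) :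
    cyclicSum M a f i = E i := by
  have h := cyclicSum_telescope hE M i
  rw [hprod, hper] at h
  apply mul_left_cancel₀ (sub_ne_zero.2 hP)
  rw [h]
  ring

/-- Here T, T₁, T₃ stand for τ at r⁻¹z, rz, r³z, so that σ moves T to T₁ to T₃. Dividing the
bilinear relation by T₁(i) T₁(i+1) gives the recursion which determines D_i; with D_i known as a
product, the evolution equation reduces to the identity `hac` between the coefficients. -/
theorem isSolutionA_of_bilinear {g : ℕ} {K : Type*} [Field K] [Algebra ℂ K]
    {σ : K ≃ₐ[ℂ] K} {r₀ : ℂ} {r z : K} (hr₀ : algebraMap ℂ K r₀ = r) (hz : z ≠ 0)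
    (hσz : σ z = r ^ 2 * z) (hP : (r * z) ^ (2 * g + 2) ≠ 1) {a c T T₁ T₃ : ℤ → K}
    (ha : ∀ i, σ (a i) = a i) (haper : ∀ i, a (i + (2 * g + 2)) = a i)
    (hcper : ∀ i, c (i + (2 * g + 2)) = c i) (hTper : ∀ i, T (i + (2 * g + 2)) = T i)
    (hT₁per : ∀ i, T₁ (i + (2 * g + 2)) = T₁ i) (hT₃per : ∀ i, T₃ (i + (2 * g + 2)) = T₃ i)
    (hT : ∀ i, T i ≠ 0) (hT₁ : ∀ i, T₁ i ≠ 0) (hT₃ : ∀ i, T₃ i ≠ 0) (hc : ∀ i, c i ≠ 0)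
    (hσT : ∀ i, σ (T i) = T₁ i) (hσT₁ : ∀ i, σ (T₁ i) = T₃ i)
    (hac : ∀ i, a i * a (i + 1) * c (i + 2) = r ^ 2 * c i)
    (hbil : ∀ i, a i * z * c (i + 1) * T i * T₃ (i + 1) - c i * T₃ i * T (i + 1) =
      ((r * z) ^ (2 * g + 2) - 1) * (T₁ i * T₁ (i + 1))) :
    IsSolutionA g σ (r₀ ^ (2 * g + 2)) (z ^ (g + 1)) a
      (fun j => z * (T₁ (j + 2) * T j) / (T (j + 2) * T₁ j)) := by
  set f : ℤ → K := fun j => z * (T₁ (j + 2) * T j) / (T (j + 2) * T₁ j) with hf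
  -- The candidate for D_j.
  set E : ℤ → K := fun j => c j * T₃ j * T (j + 1) / (T₁ j * T₁ (j + 1)) with hE
  have hper : ∀ {G : ℤ → K}, (∀ i, G (i + (2 * g + 2)) = G i) → ∀ i j : ℤ,
      j = i + (2 * g + 2) → G j = G i := by
    rintro G hG i j rfl
    exact hG i
  have hErel : ∀ i, a i * f i * E (i + 1) - E i = (r * z) ^ (2 * g + 2) - 1 := by
    intro i
    have h := hbil i
    have e : i + 1 + 1 = i + 2 := by ring
    simp only [hf, hE, e]
    have := hT i; have := hT (i + 1); have := hT (i + 2)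
    have := hT₁ i; have := hT₁ (i + 1); have := hT₁ (i + 2)
    field_simp
    linear_combination h
  -- The coefficient identity expresses a_i a_{i+1} as r² times a ratio of c's two steps apart. Over
  -- a full period the ratios cancel; the f's telescope likewise through τ.
  have ha_prod : ∀ (i : ℤ) (s : ℕ), (∏ l ∈ Finset.range (2 * s), a (i + l)) * c (i + 2 * s) =
      r ^ (2 * s) * c i := by
    intro i s
    induction s with
    | zero => simp
    | succ s ih =>
      have h := hac (i + 2 * s)
      rw [show 2 * (s + 1) = 2 * s + 1 + 1 by ring, Finset.prod_range_succ, Finset.prod_range_succ]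
      push_cast
      rw [show i + 2 * ((s : ℤ) + 1) = i + 2 * s + 2 by ring,
        show i + (2 * (s : ℤ) + 1) = i + 2 * s + 1 by ring]
      linear_combination (∏ l ∈ Finset.range (2 * s), a (i + l)) * h + r ^ 2 * ih
  have hf_prod : ∀ (i : ℤ) (s : ℕ), (∏ l ∈ Finset.range s, f (i + 2 * l)) *
      (T (i + 2 * s) * T₁ i) = z ^ s * (T₁ (i + 2 * s) * T i) := by
    intro i s
    induction s with
    | zero => simp [mul_comm]
    | succ s ih =>
      rw [Finset.prod_range_succ]
      push_cast
      rw [show i + 2 * ((s : ℤ) + 1) = i + 2 * s + 2 by ring]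
      have h1 : f (i + 2 * s) * (T (i + 2 * s + 2) * T₁ (i + 2 * s)) =
          z * (T₁ (i + 2 * s + 2) * T (i + 2 * s)) := by
        simp only [hf]
        have := hT (i + 2 * s + 2); have := hT₁ (i + 2 * s)
        field_simp
      apply mul_left_cancel₀ (mul_ne_zero (hT (i + 2 * s)) (hT₁ (i + 2 * s)))
      linear_combination (∏ l ∈ Finset.range s, f (i + 2 * l)) * T (i + 2 * s) * T₁ i * h1 +
        z * T₁ (i + 2 * s + 2) * T (i + 2 * s) * ih
  have ha_full : ∀ i : ℤ, ∏ l ∈ Finset.range (2 * g + 2), a (i + l) = r ^ (2 * g + 2) := by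
    intro i
    have h := ha_prod i (g + 1)
    rw [hper hcper i (i + 2 * (g + 1 : ℕ)) (by push_cast; ring),
      show 2 * (g + 1) = 2 * g + 2 by ring] at h
    exact mul_right_cancel₀ (hc i) h
  have hf_half : ∀ i : ℤ, ∏ l ∈ Finset.range (g + 1), f (i + 2 * l) = z ^ (g + 1) := by
    intro i
    have h := hf_prod i (g + 1)
    rw [hper hTper i (i + 2 * (g + 1 : ℕ)) (by push_cast; ring),
      hper hT₁per i (i + 2 * (g + 1 : ℕ)) (by push_cast; ring), mul_comm (T₁ i)] at h
    exact mul_right_cancel₀ (mul_ne_zero (hT i) (hT₁ i)) h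
  have hsplit : ∀ (s : ℕ) (i : ℤ), ∏ l ∈ Finset.range (2 * s), f (i + l) =
      (∏ l ∈ Finset.range s, f (i + 2 * l)) * ∏ l ∈ Finset.range s, f (i + 1 + 2 * l) := by
    intro s i
    induction s with
    | zero => simp
    | succ s ih =>
      rw [show 2 * (s + 1) = 2 * s + 1 + 1 by ring, Finset.prod_range_succ, Finset.prod_range_succ,
        Finset.prod_range_succ, Finset.prod_range_succ, ih]
      push_cast
      rw [show i + (2 * (s : ℤ) + 1) = i + 1 + 2 * s by ring]
      ring
  have hprod : ∀ i : ℤ, ∏ l ∈ Finset.range (2 * g + 2), (a (i + l) * f (i + l)) =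
      (r * z) ^ (2 * g + 2) := by
    intro i
    rw [Finset.prod_mul_distrib, ha_full, show 2 * g + 2 = 2 * (g + 1) by ring, hsplit, hf_half,
      hf_half]
    ring
  have hEper : ∀ i, E (i + (2 * g + 2 : ℕ)) = E i := by
    intro i
    simp only [hE]
    push_cast
    rw [show i + (2 * (g : ℤ) + 2) + 1 = i + 1 + (2 * g + 2) by ring, hcper, hT₃per, hTper, hT₁per,
      hT₁per]
  have hsum : ∀ i, cyclicSum (2 * g + 2) a f i = E i := cyclicSum_eq hP hErel hEper hprod
  have hE0 : ∀ i, E i ≠ 0 := fun i => div_ne_zero (mul_ne_zero (mul_ne_zero (hc i) (hT₃ i)) (hT _))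
    (mul_ne_zero (hT₁ i) (hT₁ _))
  refine ⟨pow_ne_zero _ hz, ?_, haper, ?_, ha, ?_, ?_, ?_, ?_, ?_⟩
  · rw [map_pow, hσz, map_pow, hr₀]
    ring
  · intro i
    simp only [hf]
    rw [show i + (2 * (g : ℤ) + 2) + 2 = i + 2 + (2 * g + 2) by ring, hTper, hTper, hT₁per, hT₁per]
  · have h := ha_full 0
    simp only [zero_add] at h
    rw [h, map_pow, hr₀]
  · have h := hf_half 0
    simpa using h
  · have h := hf_half 1
    rw [← h]
    exact Finset.prod_congr rfl fun l _ => by rw [add_comm]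
  · intro i
    rw [hsum]
    exact hE0 i
  · intro i
    rw [hsum, hsum]
    have h := hac i
    simp only [hf, hE, map_div₀, map_mul, hσz, hσT, hσT₁]
    rw [show i + 1 + 2 = i + 3 by ring, show i + 2 + 1 = i + 3 by ring]
    have := hT (i + 1); have := hT (i + 3)
    have := hT₁ i; have := hT₁ (i + 1); have := hT₁ (i + 2); have := hT₁ (i + 3)
    have := hT₃ i; have := hT₃ (i + 2); have := hc i
    field_simp
    linear_combination -h

end TypeA

end

noncomputable section

/-! ### Bilinear relations and non-vanishing in type A -/

section TypeA

section Bilinear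

variable {K : Type*} [Field K] [CharZero K] {N : ℕ} [NeZero N]

theorem varPair_swap (q : K) {k : ℕ} (tI : Fin k → K) (a b : K) :
    varPair q tI ![a, b] = varPair q tI ![b, a] := by
  refine Prod.ext (funext fun n => ?_) (funext fun n => ?_) <;>
    simp [varPair, powerVar, Fin.sum_univ_two, add_comm]

/-- The universal characters with even index in type `A`. -/
def tauEven (m n : ZMod N → ℤ) (r κ w : K) : K :=
  coreTau (varPair (r ^ 4) ![w⁻¹, w] ![r⁻¹ ^ 6 * κ, r⁻¹ ^ 4 * κ]) m n

/-- The universal characters with odd index in type `A`. -/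
def tauOdd (m n : ZMod N → ℤ) (r κ w : K) : K :=
  coreTau (varPair (r ^ 4) ![w⁻¹, w] ![r⁻¹ ^ 4 * κ, r⁻¹ ^ 2 * κ]) m n

variable {r κ w : K}

theorem shiftRel_first {q a a' b c d : K} (hq : ∀ k : ℕ, 0 < k → q ^ k ≠ 1)
    (ha : a' = q * a) :
    ShiftRel a (varPair q ![a, b] ![c, d]) (varPair q ![a', b] ![c, d]) := by
  subst ha
  apply shiftRel_varPair hq <;> intro n <;> simp [Fin.sum_univ_two, mul_pow] <;> ring

theorem shiftRel_second {q a b b' c d : K} (hq : ∀ k : ℕ, 0 < k → q ^ k ≠ 1)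
    (hb : b' = q * b) :
    ShiftRel b (varPair q ![a, b] ![c, d]) (varPair q ![a, b'] ![c, d]) := by
  subst hb
  apply shiftRel_varPair hq <;> intro n <;> simp [Fin.sum_univ_two, mul_pow] <;> ring

/-- Variables of J enter with coefficient -q^n, so dividing one of them by q changes the numerator
by -(1 - q^n) c^n, just as multiplication by q does for a variable of I. -/
theorem shiftRel_third {q a b c c' d : K} (hq0 : q ≠ 0) (hq : ∀ k : ℕ, 0 < k → q ^ k ≠ 1)
    (hc : c' = q⁻¹ * c) :
    ShiftRel c (varPair q ![a, b] ![c, d]) (varPair q ![a, b] ![c', d]) := by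
  subst hc
  apply shiftRel_varPair hq <;> intro n <;>
  · have : q ^ n ≠ 0 := pow_ne_zero n hq0
    simp [Fin.sum_univ_two, mul_pow]
    field_simp
    ring

theorem shiftRel_fourth {q a b c d d' : K} (hq0 : q ≠ 0) (hq : ∀ k : ℕ, 0 < k → q ^ k ≠ 1)
    (hd : d' = q⁻¹ * d) :
    ShiftRel d (varPair q ![a, b] ![c, d]) (varPair q ![a, b] ![c, d']) := by
  rw [varPair_swap q _ c d, varPair_swap q _ c d']
  exact shiftRel_third hq0 hq hd

theorem coreTau_scale₄ (q : K) {s a b c d a' b' c' d' : K} (hs : s ≠ 0) (ha : a' = s * a)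
    (hb : b' = s * b) (hc : c' = s * c) (hd : d' = s * d) (m n : ZMod N → ℤ) :
    coreTau (varPair q ![a', b'] ![c', d']) m n =
      s ^ (coreWeight m - coreWeight n) * coreTau (varPair q ![a, b] ![c, d]) m n := by
  apply coreTau_scale q hs
  · simp [Fin.forall_fin_two, ha, hb]
  · simp [Fin.forall_fin_two, hc, hd]

/-- The reference point is (w⁻¹, w | κ, r⁻²κ), shifted in two or one of the variables w⁻¹, w, κ.
Double shifts rescale to even functions at w and r^{∓2}w, single shifts to odd ones. -/
theorem tau_scale_relations (hr : r ≠ 0) (hw : w ≠ 0) (m n : ZMod N → ℤ) :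
    (coreTau (varPair (r ^ 4) ![r ^ 4 * w⁻¹, r ^ 4 * w] ![κ, r⁻¹ ^ 2 * κ]) m n =
      ((r ^ 2) ^ (coreWeight m - coreWeight n)) ^ 2 * tauEven m n r κ w ∧
    coreTau (varPair (r ^ 4) ![r ^ 4 * w⁻¹, w] ![r⁻¹ ^ 4 * κ, r⁻¹ ^ 2 * κ]) m n =
      (r ^ 2) ^ (coreWeight m - coreWeight n) * tauEven m n r κ (r⁻¹ ^ 2 * w) ∧
    coreTau (varPair (r ^ 4) ![w⁻¹, r ^ 4 * w] ![r⁻¹ ^ 4 * κ, r⁻¹ ^ 2 * κ]) m n =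
      (r ^ 2) ^ (coreWeight m - coreWeight n) * tauEven m n r κ (r ^ 2 * w)) ∧
    coreTau (varPair (r ^ 4) ![w⁻¹, w] ![r⁻¹ ^ 4 * κ, r⁻¹ ^ 2 * κ]) m n = tauOdd m n r κ w ∧
    coreTau (varPair (r ^ 4) ![w⁻¹, r ^ 4 * w] ![κ, r⁻¹ ^ 2 * κ]) m n =
      (r ^ 2) ^ (coreWeight m - coreWeight n) * tauOdd m n r κ (r ^ 2 * w) ∧
    coreTau (varPair (r ^ 4) ![r ^ 4 * w⁻¹, w] ![κ, r⁻¹ ^ 2 * κ]) m n =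
      (r ^ 2) ^ (coreWeight m - coreWeight n) * tauOdd m n r κ (r⁻¹ ^ 2 * w) := by
  have h2 : r ^ 2 ≠ 0 := pow_ne_zero 2 hr
  have h4 : r ^ 4 ≠ 0 := pow_ne_zero 4 hr
  have e : ((r ^ 2) ^ (coreWeight m - coreWeight n)) ^ 2 =
      (r ^ 4) ^ (coreWeight m - coreWeight n) := by
    rw [← zpow_natCast, ← zpow_mul, mul_comm, zpow_mul]
    congr 1
    rw [zpow_natCast, ← pow_mul]
  refine ⟨⟨?_, ?_, ?_⟩, rfl, ?_, ?_⟩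
  · rw [varPair_swap, e, tauEven]
    apply coreTau_scale₄ _ h4 rfl rfl <;> field_simp
  · rw [tauEven]
    apply coreTau_scale₄ _ h2 <;> field_simp
  · rw [tauEven]
    apply coreTau_scale₄ _ h2 <;> field_simp
  · rw [varPair_swap, tauOdd]
    apply coreTau_scale₄ _ h2 <;> field_simp
  · rw [varPair_swap, tauOdd]
    apply coreTau_scale₄ _ h2 <;> field_simp

/-- The relation `coreTau_bilinear_right` for t = w⁻¹, w, κ. The homogeneity factors of the three
products agree except for the change ν of the size of the second core, which leaves the power
(r²)^{-ν}. The odd case is the same with the first core. -/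
theorem tau_bilinear_even (hr : r ≠ 0) (hq : ∀ k : ℕ, 0 < k → (r ^ 4) ^ k ≠ 1) (hκ : κ ≠ 0)
    (hw : w ≠ 0) (m n : ZMod N → ℤ) (i : ℤ) {ν : ℤ}
    (hν : ν = N * n ((i + 1 : ℤ) : ZMod N) - vecSum n) :
    (w ^ 2 - 1) * (tauEven m (coreShift n i) r κ w * tauOdd m (coreShift n (i + 1)) r κ w) =
      (r ^ 2) ^ (-ν) * (w * (w - κ⁻¹) * (tauEven m (coreShift n i) r κ (r⁻¹ ^ 2 * w) *
          tauOdd m (coreShift n (i + 1)) r κ (r ^ 2 * w)) -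
        (1 - w * κ⁻¹) * (tauEven m (coreShift n i) r κ (r ^ 2 * w) *
          tauOdd m (coreShift n (i + 1)) r κ (r⁻¹ ^ 2 * w))) := by
  have h4 : r ^ 4 ≠ 0 := pow_ne_zero 4 hr
  have h := coreTau_bilinear_right (inv_ne_zero hw) hw hκ
    (p := varPair (r ^ 4) ![w⁻¹, w] ![κ, r⁻¹ ^ 2 * κ])
    (shiftRel_first hq rfl) (shiftRel_second hq rfl)
    (shiftRel_third (c' := r⁻¹ ^ 4 * κ) h4 hq (by field_simp))
    (shiftRel_second hq rfl)
    (shiftRel_third (c' := r⁻¹ ^ 4 * κ) h4 hq (by field_simp))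
    (shiftRel_third (c' := r⁻¹ ^ 4 * κ) h4 hq (by field_simp)) m n i
  obtain ⟨⟨e1, e2, e3⟩, -⟩ := tau_scale_relations (κ := κ) hr hw m (coreShift n i)
  obtain ⟨-, e4, e5, e6⟩ := tau_scale_relations (κ := κ) hr hw m (coreShift n (i + 1))
  rw [e1, e2, e3, e4, e5, e6, coreWeight_coreShift_succ, ← hν, ← sub_sub, sub_eq_add_neg _ ν,
    zpow_add₀ (pow_ne_zero 2 hr)] at h
  set ρ := (r ^ 2) ^ (coreWeight m - coreWeight (coreShift n i)) with hρ
  have hρ0 : ρ ≠ 0 := zpow_ne_zero _ (pow_ne_zero 2 hr)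
  field_simp at h
  rw [mul_zero] at h
  replace h := (mul_eq_zero.1 h).resolve_left (pow_ne_zero 2 hρ0)
  field_simp
  linear_combination h

theorem tau_bilinear_odd (hr : r ≠ 0) (hq : ∀ k : ℕ, 0 < k → (r ^ 4) ^ k ≠ 1) (hκ : κ ≠ 0)
    (hw : w ≠ 0) (m n : ZMod N → ℤ) (i : ℤ) {μ : ℤ}
    (hμ : μ = N * m ((i + 1 : ℤ) : ZMod N) - vecSum m) :
    (w ^ 2 - 1) * (tauEven (coreShift m i) n r κ w * tauOdd (coreShift m (i + 1)) n r κ w) =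
      (r ^ 2) ^ μ * (w * (w - κ) * (tauEven (coreShift m i) n r κ (r ^ 2 * w) *
          tauOdd (coreShift m (i + 1)) n r κ (r⁻¹ ^ 2 * w)) -
        (1 - κ * w) * (tauEven (coreShift m i) n r κ (r⁻¹ ^ 2 * w) *
          tauOdd (coreShift m (i + 1)) n r κ (r ^ 2 * w))) := by
  have h4 : r ^ 4 ≠ 0 := pow_ne_zero 4 hr
  have h := coreTau_bilinear_left (inv_ne_zero hw) hw hκ
    (p := varPair (r ^ 4) ![w⁻¹, w] ![κ, r⁻¹ ^ 2 * κ])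
    (shiftRel_first hq rfl) (shiftRel_second hq rfl)
    (shiftRel_third (c' := r⁻¹ ^ 4 * κ) h4 hq (by field_simp))
    (shiftRel_second hq rfl)
    (shiftRel_third (c' := r⁻¹ ^ 4 * κ) h4 hq (by field_simp))
    (shiftRel_third (c' := r⁻¹ ^ 4 * κ) h4 hq (by field_simp)) m n i
  obtain ⟨⟨e1, e2, e3⟩, -⟩ := tau_scale_relations (κ := κ) hr hw (coreShift m i) n
  obtain ⟨-, e4, e5, e6⟩ := tau_scale_relations (κ := κ) hr hw (coreShift m (i + 1)) n
  rw [e1, e2, e3, e4, e5, e6, coreWeight_coreShift_succ, ← hμ,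
    show coreWeight (coreShift m i) + μ - coreWeight n =
      coreWeight (coreShift m i) - coreWeight n + μ by ring,
    zpow_add₀ (pow_ne_zero 2 hr)] at h
  set ρ := (r ^ 2) ^ (coreWeight (coreShift m i) - coreWeight n) with hρ
  have hρ0 : ρ ≠ 0 := zpow_ne_zero _ (pow_ne_zero 2 hr)
  field_simp at h
  rw [mul_zero] at h
  replace h := (mul_eq_zero.1 h).resolve_left (pow_ne_zero 2 hρ0)
  field_simp
  linear_combination h

end Bilinear

theorem tauA_even {K : Type*} [Field K] [CharZero K] {g : ℕ} (m n : ZMod (g + 1) → ℤ) (r κ w : K)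
    (i : ℤ) : tauA m n r κ w (2 * i) = tauEven (coreShift m (-i)) (coreShift n i) r κ w := by
  rw [tauA, if_pos (even_two_mul i), coreUC_eq_coreTau, tauEven,
    Int.mul_ediv_cancel_left i two_ne_zero]

theorem tauA_odd {K : Type*} [Field K] [CharZero K] {g : ℕ} (m n : ZMod (g + 1) → ℤ) (r κ w : K)
    (i : ℤ) : tauA m n r κ w (2 * i + 1) =
      tauOdd (coreShift m (-i)) (coreShift n (i + 1)) r κ w := by
  rw [tauA, if_neg (by simp), coreUC_eq_coreTau, tauOdd, show (2 * i + 1) / 2 = i by omega]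

theorem int_cases_parity {p : ℤ → Prop} (h0 : ∀ i, p (2 * i)) (h1 : ∀ i, p (2 * i + 1)) (j : ℤ) :
    p j := by
  rcases Int.even_or_odd' j with ⟨i, rfl | rfl⟩
  · exact h0 i
  · exact h1 i

theorem coreTau_typeA_ne_zero {N : ℕ} [NeZero N] {r c : ℂ} (hr : r ≠ 0) (hc : c ≠ 0)
    (hq : ∀ k : ℕ, 0 < k → r ^ k ≠ 1) (m n : ZMod N → ℤ) :
    tauEven m n (rconst r) (rvar 0) (rconst c * rvar 1 : RatFun 2) ≠ 0 ∧
      tauOdd m n (rconst r) (rvar 0) (rconst c * rvar 1 : RatFun 2) ≠ 0 := by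
  have key : ∀ a b : ℂ, a ≠ 0 → b ≠ 0 → coreTau (varPair (rconst r ^ 4)
      ![(rconst c * rvar 1 : RatFun 2)⁻¹, rconst c * rvar 1]
      ![rconst a * rvar 0, rconst b * rvar 0]) m n ≠ 0 := by
    intro a b ha hb
    rw [← rconst_pow]
    -- The degeneration z → 0 with u = z: among the variables only w⁻¹ has a pole, and among their
    -- inverses only the inverse of w.
    set x : Fin 2 → ℂ := ![1, 0] with hx
    have h1 : HasValueAt (rvar 1 : RatFun 2) x 0 := hasValueAt_rvar x 1
    have h0 : HasValueAt (rvar 0 : RatFun 2) x 1 := hasValueAt_rvar x 0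
    have hv1 := rvar_ne_zero (k := 2) 1
    have hv0 := rvar_ne_zero (k := 2) 0
    have hcc := rconst_ne_zero (k := 2) hc
    have hw : HasValueAt (rvar 1 * (rconst c * rvar 1) : RatFun 2) x 0 := by
      simpa using h1.mul ((hasValueAt_rconst x c).mul h1)
    have hw' : HasValueAt (rvar 1 * (rconst c * rvar 1)⁻¹ : RatFun 2) x c⁻¹ := by
      have := hasValueAt_rconst (k := 2) x c⁻¹
      rw [rconst_inv] at this
      convert! this using 1
      field_simp
    have hJ : ∀ d : ℂ, HasValueAt (rvar 1 * (rconst d * rvar 0) : RatFun 2) x 0 := by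
      intro d
      simpa using h1.mul ((hasValueAt_rconst x d).mul h0)
    have hJ' : ∀ d : ℂ, d ≠ 0 → HasValueAt (rvar 1 * (rconst d * rvar 0)⁻¹ : RatFun 2) x 0 := by
      intro d hd
      simpa using h1.mul (((hasValueAt_rconst x d).mul h0).inv (by simpa using hd))
    refine coreTau_ne_zero x (pow_ne_zero 4 hr) (c := c⁻¹) (c' := c⁻¹) (u := rvar 1)
      (vI := ![c⁻¹, 0]) (vI' := ![0, c⁻¹]) (vJ := ![0, 0]) (vJ' := ![0, 0])
      ?_ (inv_ne_zero hc) (inv_ne_zero hc) hv1 h1 ?_ ?_ ?_ ?_ ?_ ?_ m n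
    · intro k hk
      rw [← pow_mul]
      exact hq _ (by omega)
    · simp only [Fin.forall_fin_two, Matrix.cons_val_zero, Matrix.cons_val_one]
      exact ⟨hw', hw⟩
    · simp only [Fin.forall_fin_two, Matrix.cons_val_zero, Matrix.cons_val_one]
      exact ⟨hJ a, hJ b⟩
    · simp only [Fin.forall_fin_two, Matrix.cons_val_zero, Matrix.cons_val_one, inv_inv]
      exact ⟨hw, hw'⟩
    · simp only [Fin.forall_fin_two, Matrix.cons_val_zero, Matrix.cons_val_one]
      exact ⟨hJ' a ha, hJ' b hb⟩
    · intro n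
      simp [Fin.sum_univ_two]
    · intro n
      simp [Fin.sum_univ_two]
  have hp : ∀ k : ℕ, (rconst r : RatFun 2)⁻¹ ^ k = rconst (r⁻¹ ^ k) := by
    intro k
    rw [rconst_pow, rconst_inv]
  rw [tauEven, tauOdd, hp, hp, hp]
  have hk : ∀ k : ℕ, r⁻¹ ^ k ≠ 0 := fun k => pow_ne_zero k (inv_ne_zero hr)
  exact ⟨key _ _ (hk 6) (hk 4), key _ _ (hk 4) (hk 2)⟩

end TypeA

end

noncomputable section

/-! ### Parameters and the solution of type A -/

section TypeA

section Parameters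

variable {K : Type*} [Field K] {g : ℕ}

/-- `(g+1) m_{-i} - |m|`. -/
def leftExpA (m : ZMod (g + 1) → ℤ) (i : ℤ) : ℤ :=
  (g + 1) * m ((-i : ℤ) : ZMod (g + 1)) - vecSum m

/-- `(g+1) n_{i+1} - |n|`. -/
def rightExpA (n : ZMod (g + 1) → ℤ) (i : ℤ) : ℤ :=
  (g + 1) * n ((i + 1 : ℤ) : ZMod (g + 1)) - vecSum n

theorem leftExpA_add_period (m : ZMod (g + 1) → ℤ) (i : ℤ) :
    leftExpA m (i + (g + 1)) = leftExpA m i := by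
  have h : ((-(i + (g + 1)) : ℤ) : ZMod (g + 1)) = ((-i : ℤ) : ZMod (g + 1)) := by
    have := ZMod.natCast_self (g + 1)
    push_cast at this ⊢
    rw [this, add_zero]
  rw [leftExpA, h, leftExpA]

theorem rightExpA_add_period (n : ZMod (g + 1) → ℤ) (i : ℤ) :
    rightExpA n (i + (g + 1)) = rightExpA n i := by
  have h : ((i + (g + 1) + 1 : ℤ) : ZMod (g + 1)) = ((i + 1 : ℤ) : ZMod (g + 1)) := by
    have := ZMod.natCast_self (g + 1)
    push_cast at this ⊢
    rw [this, add_zero]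
  rw [rightExpA, h, rightExpA]

theorem paramA_even (m n : ZMod (g + 1) → ℤ) (r κ : K) (i : ℤ) :
    paramA m n r κ (2 * i) = -r * κ⁻¹ * (r ^ 2) ^ (-(leftExpA m i + rightExpA n i)) := by
  rw [paramA, if_pos (even_two_mul i), Int.mul_ediv_cancel_left i two_ne_zero, ← zpow_natCast,
    ← zpow_mul, leftExpA, rightExpA]
  congr 2
  push_cast
  ring

theorem paramA_odd (m n : ZMod (g + 1) → ℤ) (r κ : K) (i : ℤ) :
    paramA m n r κ (2 * i + 1) =
      -r * κ * (r ^ 2) ^ (leftExpA m i + rightExpA n (i + 1)) := by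
  rw [paramA, if_neg (by simp), show (2 * i + 1) / 2 = i by omega, ← zpow_natCast,
    ← zpow_mul, leftExpA, rightExpA, show i + 1 + 1 = i + 2 by ring]
  congr 2
  push_cast
  ring

/-- The coefficients of the sums `D_i` of type `A`. -/
def denomCoeffA (m n : ZMod (g + 1) → ℤ) (r κ w : K) (j : ℤ) : K :=
  if Even j then (r ^ 2) ^ (-rightExpA n (j / 2)) * (1 - w * κ⁻¹)
  else (r ^ 2) ^ leftExpA m (j / 2) * (1 - κ * w)

theorem denomCoeffA_even (m n : ZMod (g + 1) → ℤ) (r κ w : K) (i : ℤ) :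
    denomCoeffA m n r κ w (2 * i) = (r ^ 2) ^ (-rightExpA n i) * (1 - w * κ⁻¹) := by
  rw [denomCoeffA, if_pos (even_two_mul i), Int.mul_ediv_cancel_left i two_ne_zero]

theorem denomCoeffA_odd (m n : ZMod (g + 1) → ℤ) (r κ w : K) (i : ℤ) :
    denomCoeffA m n r κ w (2 * i + 1) = (r ^ 2) ^ leftExpA m i * (1 - κ * w) := by
  rw [denomCoeffA, if_neg (by simp), show (2 * i + 1) / 2 = i by omega]

theorem denomCoeffA_add_period (m n : ZMod (g + 1) → ℤ) (r κ w : K) (j : ℤ) :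
    denomCoeffA m n r κ w (j + (2 * g + 2)) = denomCoeffA m n r κ w j := by
  induction j using int_cases_parity with
  | h0 i =>
    rw [show 2 * i + (2 * (g : ℤ) + 2) = 2 * (i + (g + 1)) by ring, denomCoeffA_even,
      denomCoeffA_even, rightExpA_add_period]
  | h1 i =>
    rw [show 2 * i + 1 + (2 * (g : ℤ) + 2) = 2 * (i + (g + 1)) + 1 by ring, denomCoeffA_odd,
      denomCoeffA_odd, leftExpA_add_period]

theorem paramA_add_period (m n : ZMod (g + 1) → ℤ) (r κ : K) (j : ℤ) :
    paramA m n r κ (j + (2 * g + 2)) = paramA m n r κ j := by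
  induction j using int_cases_parity with
  | h0 i =>
    rw [show 2 * i + (2 * (g : ℤ) + 2) = 2 * (i + (g + 1)) by ring, paramA_even, paramA_even,
      rightExpA_add_period, leftExpA_add_period]
  | h1 i =>
    rw [show 2 * i + 1 + (2 * (g : ℤ) + 2) = 2 * (i + (g + 1)) + 1 by ring, paramA_odd, paramA_odd,
      leftExpA_add_period, show i + ((g : ℤ) + 1) + 1 = i + 1 + (g + 1) by ring,
      rightExpA_add_period]

theorem paramA_mul_paramA (m n : ZMod (g + 1) → ℤ) {r κ : K} (hr : r ≠ 0) (hκ : κ ≠ 0) (w : K)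
    (j : ℤ) : paramA m n r κ j * paramA m n r κ (j + 1) * denomCoeffA m n r κ w (j + 2) =
      r ^ 2 * denomCoeffA m n r κ w j := by
  have h2 : r ^ 2 ≠ 0 := pow_ne_zero 2 hr
  induction j using int_cases_parity with
  | h0 i =>
    rw [show 2 * i + 2 = 2 * (i + 1) by ring, paramA_even, paramA_odd, denomCoeffA_even,
      denomCoeffA_even, neg_add, zpow_add₀ h2, zpow_add₀ h2, zpow_neg, zpow_neg, zpow_neg]
    field_simp
  | h1 i =>
    rw [show 2 * i + 1 + 2 = 2 * (i + 1) + 1 by ring, show 2 * i + 1 + 1 = 2 * (i + 1) by ring,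
      paramA_even, paramA_odd, denomCoeffA_odd, denomCoeffA_odd, neg_add, zpow_add₀ h2,
      zpow_add₀ h2, zpow_neg, zpow_neg]
    field_simp

variable [CharZero K]

theorem tauA_add_period (m n : ZMod (g + 1) → ℤ) (r κ w : K) (j : ℤ) :
    tauA m n r κ w (j + (2 * g + 2)) = tauA m n r κ w j := by
  have hl : ∀ (p : (ℕ → K) × (ℕ → K)) (n' : ZMod (g + 1) → ℤ) (i : ℤ),
      coreTau p (coreShift m (-(i + (g + 1)))) n' = coreTau p (coreShift m (-i)) n' := by
    intro p n' i
    rw [← coreTau_add_period_left]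
    congr 2
    push_cast
    ring
  have hr : ∀ (p : (ℕ → K) × (ℕ → K)) (m' : ZMod (g + 1) → ℤ) (i : ℤ),
      coreTau p m' (coreShift n (i + (g + 1))) = coreTau p m' (coreShift n i) := by
    intro p m' i
    rw [← coreTau_add_period_right p m' n i]
    push_cast
    rfl
  induction j using int_cases_parity with
  | h0 i =>
    rw [show 2 * i + (2 * (g : ℤ) + 2) = 2 * (i + (g + 1)) by ring, tauA_even, tauA_even, tauEven,
      tauEven, hl, hr]
  | h1 i =>
    rw [show 2 * i + 1 + (2 * (g : ℤ) + 2) = 2 * (i + (g + 1)) + 1 by ring, tauA_odd, tauA_odd,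
      tauOdd, tauOdd, hl, show i + ((g : ℤ) + 1) + 1 = i + 1 + (g + 1) by ring, hr]

/-- From index 2i to 2i+1 the second core takes one step up, from 2i+1 to 2i+2 the first core takes
one step down. Hence the even and odd relations alternate around the cycle. -/
theorem tauA_bilinear (m n : ZMod (g + 1) → ℤ) {r κ z : K} (hr : r ≠ 0)
    (hq : ∀ k : ℕ, 0 < k → (r ^ 4) ^ k ≠ 1) (hκ : κ ≠ 0) (hz : z ≠ 0) (j : ℤ) :
    paramA m n r κ j * z * denomCoeffA m n r κ (r * z) (j + 1) * tauA m n r κ (r⁻¹ * z) j *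
        tauA m n r κ (r ^ 3 * z) (j + 1) -
      denomCoeffA m n r κ (r * z) j * tauA m n r κ (r ^ 3 * z) j *
        tauA m n r κ (r⁻¹ * z) (j + 1) =
      ((r * z) ^ 2 - 1) * (tauA m n r κ (r * z) j * tauA m n r κ (r * z) (j + 1)) := by
  have h2 : r ^ 2 ≠ 0 := pow_ne_zero 2 hr
  have e1 : r⁻¹ ^ 2 * (r * z) = r⁻¹ * z := by field_simp
  have e3 : r ^ 2 * (r * z) = r ^ 3 * z := by ring
  induction j using int_cases_parity with
  | h0 i =>
    have h := tau_bilinear_even hr hq hκ (mul_ne_zero hr hz) (coreShift m (-i)) n i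
      (ν := rightExpA n i) (by rw [rightExpA]; push_cast; ring)
    rw [e1, e3] at h
    simp only [tauA_even, tauA_odd]
    rw [h, paramA_even, denomCoeffA_even, denomCoeffA_odd, neg_add, zpow_add₀ h2, zpow_neg,
      zpow_neg]
    field_simp
    ring
  | h1 i =>
    have h := tau_bilinear_odd hr hq hκ (mul_ne_zero hr hz) m (coreShift n (i + 1)) (-(i + 1))
      (μ := leftExpA m i) (by
        rw [leftExpA, show -(i + 1) + 1 = -i by ring]
        push_cast
        ring)
    rw [e1, e3, show -(i + 1) + 1 = -i by ring] at h
    simp only [show 2 * i + 1 + 1 = 2 * (i + 1) by ring, tauA_even, tauA_odd]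
    rw [mul_comm (tauOdd _ _ _ _ _), h, paramA_odd, denomCoeffA_even, denomCoeffA_odd,
      zpow_add₀ h2, zpow_neg]
    field_simp
    ring

end Parameters

variable {g : ℕ} (m n : ZMod (g + 1) → ℤ)

theorem tauA_ne_zero {r c : ℂ} (hr : r ≠ 0) (hc : c ≠ 0) (hq : ∀ k : ℕ, 0 < k → r ^ k ≠ 1)
    (j : ℤ) : tauA m n (rconst r) (rvar 0) (rconst c * rvar 1 : RatFun 2) j ≠ 0 := by
  induction j using int_cases_parity with
  | h0 i =>
    rw [tauA_even]
    exact (coreTau_typeA_ne_zero hr hc hq _ _).1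
  | h1 i =>
    rw [tauA_odd]
    exact (coreTau_typeA_ne_zero hr hc hq _ _).2

theorem map_tauA {K : Type*} [Field K] [CharZero K] (φ : K →+* K) (r κ w : K) (j : ℤ) :
    φ (tauA m n r κ w j) = tauA m n (φ r) (φ κ) (φ w) j := by
  have h : ∀ (a b c d : K) (i j : ℤ), φ (coreUC (r ^ 4) ![a, b] ![c, d] m n i j) =
      coreUC (φ r ^ 4) ![φ a, φ b] ![φ c, φ d] m n i j := by
    intro a b c d i j
    rw [coreUC_eq_coreTau, coreUC_eq_coreTau, coreTau_map, map_pow]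
    congr 2 <;> funext i <;> fin_cases i <;> rfl
  rw [tauA, tauA]
  split_ifs <;> rw [h] <;> simp only [map_mul, map_inv₀, map_pow]

theorem exists_isSolutionA {r : ℂ} (hr : r ≠ 0) (hq : ∀ k : ℕ, 0 < k → r ^ k ≠ 1) :
    ∃ σ : RatFun 2 ≃ₐ[ℂ] RatFun 2, σ (rvar 0) = rvar 0 ∧ σ (rvar 1) = rconst (r ^ 2) * rvar 1 ∧
      IsSolutionA g σ (r ^ (2 * g + 2)) (rvar 1 ^ (g + 1)) (paramA m n (rconst r) (rvar 0))
        (solA m n (rconst r) (rvar 0) (rvar 1)) := by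
  obtain ⟨σ, hσ⟩ := exists_scale ![1, r ^ 2] (by simp [Fin.forall_fin_two, hr])
  have hσ0 : σ (rvar 0) = rvar 0 := by
    have := hσ 0
    simpa [rconst] using this
  have hσ1 : σ (rvar 1) = rconst (r ^ 2) * rvar 1 := by simpa using hσ 1
  have hr' : (rconst r : RatFun 2) ≠ 0 := rconst_ne_zero hr
  have hκ : (rvar 0 : RatFun 2) ≠ 0 := rvar_ne_zero 0
  have hz : (rvar 1 : RatFun 2) ≠ 0 := rvar_ne_zero 1
  have hpow : ∀ k : ℕ, 0 < k → (rconst r * rvar 1 : RatFun 2) ^ k ≠ 1 := by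
    intro k hk h
    apply rvar_algebraicIndependent_pow (i := (1 : Fin 2)) hk (r⁻¹ ^ k)
    rw [rconst_pow, rconst_inv, inv_pow]
    apply eq_inv_of_mul_eq_one_right
    rw [← mul_pow, h]
  have hT : ∀ c : ℂ, c ≠ 0 → ∀ j,
      tauA m n (rconst r) (rvar 0) (rconst c * rvar 1 : RatFun 2) j ≠ 0 :=
    fun c hc j => tauA_ne_zero m n hr hc hq j
  have hσT : ∀ c d : RatFun 2, σ c = c → d = c * rconst r ^ 2 → ∀ j,
      σ (tauA m n (rconst r) (rvar 0) (c * rvar 1) j) =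
        tauA m n (rconst r) (rvar 0) (d * rvar 1) j := by
    intro c d hc hd j
    have := map_tauA m n (σ : RatFun 2 →+* RatFun 2) (rconst r) (rvar 0) (c * rvar 1) j
    simp only [RingHom.coe_coe, map_mul, hc, hσ0, hσ1, algEquiv_rconst] at this
    rw [this, hd, rconst_pow, mul_assoc]
  set w : RatFun 2 := rconst r * rvar 1 with hw
  have hw2 : w ^ 2 - 1 ≠ 0 := sub_ne_zero.2 (hpow 2 two_pos)
  -- The bilinear relations carry w² - 1 where the recursion for D_i requires w^{2g+2} - 1. The
  -- quotient is absorbed into the coefficients c.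
  set G : RatFun 2 := (w ^ (2 * g + 2) - 1) / (w ^ 2 - 1) with hG
  have hP : w ^ (2 * g + 2) ≠ 1 := hpow _ (by omega)
  have hG0 : G ≠ 0 := div_ne_zero (sub_ne_zero.2 hP) hw2
  have hwval : HasValueAt w ![(1 : ℂ), 0] (r * 0) :=
    (hasValueAt_rconst _ r).mul (hasValueAt_rvar _ 1)
  have hκval : HasValueAt (rvar 0 : RatFun 2) ![(1 : ℂ), 0] 1 := hasValueAt_rvar _ 0
  have hone : HasValueAt (1 : RatFun 2) ![(1 : ℂ), 0] 1 := hasValueAt_one _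
  have hr2 : (rconst r ^ 2 : RatFun 2) ≠ 0 := pow_ne_zero 2 hr'
  refine ⟨σ, hσ0, hσ1, ?_⟩
  have hsol : solA m n (rconst r) (rvar 0) (rvar 1 : RatFun 2) = fun j =>
      rvar 1 * (tauA m n (rconst r) (rvar 0) w (j + 2) *
        tauA m n (rconst r) (rvar 0) ((rconst r)⁻¹ * rvar 1) j) /
      (tauA m n (rconst r) (rvar 0) ((rconst r)⁻¹ * rvar 1) (j + 2) *
        tauA m n (rconst r) (rvar 0) w j) := by
    funext j
    rw [solA]
  have hr₀ : algebraMap ℂ (RatFun 2) r = rconst r := by rw [rconst]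
  have hTper := fun w => tauA_add_period m n (rconst r) (rvar 0 : RatFun 2) w
  have hT₁ := hT r hr
  have hT₃ := hT _ (pow_ne_zero 3 hr)
  have hT₀ := hT _ (inv_ne_zero hr)
  rw [rconst_pow] at hT₃
  rw [rconst_inv] at hT₀
  rw [hsol]
  refine isSolutionA_of_bilinear (r := rconst r)
    (c := fun j => G * denomCoeffA m n (rconst r) (rvar 0) w j)
    (T := tauA m n (rconst r) (rvar 0) ((rconst r)⁻¹ * rvar 1))
    (T₁ := tauA m n (rconst r) (rvar 0) w)
    (T₃ := tauA m n (rconst r) (rvar 0) (rconst r ^ 3 * rvar 1))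
    hr₀ hz ?_ hP ?_ (paramA_add_period m n _ _) ?_ (hTper _) (hTper _) (hTper _) hT₀ hT₁ hT₃ ?_
    ?_ ?_ ?_ ?_
  · rw [hσ1, rconst_pow]
  · intro j
    rw [paramA]
    split_ifs <;> simp only [map_mul, map_neg, map_inv₀, map_zpow₀, hσ0, algEquiv_rconst]
  · intro j
    simp only [denomCoeffA_add_period]
  · intro j
    refine mul_ne_zero hG0 ?_
    rw [denomCoeffA]
    split_ifs
    · refine mul_ne_zero (zpow_ne_zero _ hr2) ?_
      exact (hone.sub (hwval.mul (hκval.inv one_ne_zero))).ne_zero (by simp)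
    · refine mul_ne_zero (zpow_ne_zero _ hr2) ?_
      exact (hone.sub (hκval.mul hwval)).ne_zero (by simp)
  · apply hσT
    · rw [map_inv₀, algEquiv_rconst]
    · field_simp
  · apply hσT
    · rw [algEquiv_rconst]
    · ring
  · intro j
    have := paramA_mul_paramA m n hr' hκ w j
    linear_combination G * this
  · intro j
    have h := tauA_bilinear m n hr' (fun k hk => by
      rw [← pow_mul]
      exact rconst_pow_ne_one hq _ (by omega)) hκ hz j
    have e : w ^ (2 * g + 2) - 1 = G * (w ^ 2 - 1) := by rw [hG, div_mul_cancel₀ _ hw2]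
    rw [e]
    linear_combination G * h

theorem algebraicIn_paramA {r : ℂ} (hr : r ≠ 0) (F : RatFun 2) :
    AlgebraicIn (insert (rvar 1 ^ (g + 1)) (Set.range (paramA m n (rconst r) (rvar 0)))) F := by
  refine algebraicIn_of_rvar ?_ F
  rw [Fin.forall_fin_two]
  refine ⟨?_, AlgebraicIn.of_pow g.succ_pos (algebraicIn_of_mem (Set.mem_insert _ _))⟩
  set S : Set (RatFun 2) :=
    insert (rvar 1 ^ (g + 1)) (Set.range (paramA m n (rconst r) (rvar 0)))
  have h1 : AlgebraicIn S (paramA m n (rconst r) (rvar 0) (2 * 0 + 1)) :=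
    algebraicIn_of_mem (Set.mem_insert_of_mem _ (Set.mem_range_self _))
  -- The constant for which a_1 = cκ; thus κ is recovered from a_1, and z from t = z^{g+1}.
  set c : ℂ := -r * (r ^ 2) ^ (leftExpA m 0 + rightExpA n (0 + 1)) with hc
  have hc0 : c ≠ 0 := mul_ne_zero (neg_ne_zero.2 hr) (zpow_ne_zero _ (pow_ne_zero 2 hr))
  have h2 : (rvar 0 : RatFun 2) = rconst c⁻¹ * paramA m n (rconst r) (rvar 0) (2 * 0 + 1) := by
    have e : (rconst c : RatFun 2) =
        -rconst r * (rconst r ^ 2) ^ (leftExpA m 0 + rightExpA n (0 + 1)) := by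
      rw [hc, rconst, map_mul, map_neg, map_zpow₀, map_pow]
      rfl
    rw [rconst_inv, eq_inv_mul_iff_mul_eq₀ (rconst_ne_zero hc0), e, paramA_odd]
    ring
  rw [h2]
  exact IsAlgebraic.mul (algebraicIn_rconst S _) h1

end TypeA

end

noncomputable section

/-! ### Type `D_5^{(1)}` -/

section TypeD

section Bilinear

variable {K : Type*} [Field K]

/-- A solution of one half of the q-Painlevé VI equation from four bilinear relations. -/
theorem quotient_of_bilinear {A B u v u' v' e₁₁ e₁₂ e₂₁ e₂₂ y₁ y₁' y₂ y₂' N₁ N₂ D₁ D₂ : K}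
    (hA : A ≠ 0) (hB : B ≠ 0) (he₁₁ : e₁₁ ≠ 0) (he₁₂ : e₁₂ ≠ 0) (he₂₁ : e₂₁ ≠ 0) (he₂₂ : e₂₂ ≠ 0)
    (hy₁' : y₁' ≠ 0) (hy₂ : y₂ ≠ 0) (hD₁ : D₁ ≠ 0) (hD₂ : D₂ ≠ 0)
    (h₁ : A * e₁₁ * N₁ = u * e₂₁ * (y₂ * y₁') + v * e₁₂ * (y₂' * y₁))
    (h₂ : A * e₂₂ * D₂ = u * e₁₂ * (y₁ * y₂') + v * e₂₁ * (y₁' * y₂))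
    (h₃ : B * e₂₂ * N₂ = u' * e₁₂ * (y₁' * y₂) + v' * e₂₁ * (y₁ * y₂'))
    (h₄ : B * e₁₁ * D₁ = u' * e₂₁ * (y₂' * y₁) + v' * e₁₂ * (y₂ * y₁')) {c g : K}
    (hc : c = e₂₁ / e₁₂) (hg : g = y₁ * y₂' / (y₁' * y₂)) :
    u * g + v * c ≠ 0 ∧ u' * g + v' * c⁻¹ ≠ 0 ∧
      N₁ * N₂ / (D₁ * D₂) =
        (v * g + u * c) * (v' * g + u' * c⁻¹) / ((u * g + v * c) * (u' * g + v' * c⁻¹)) := by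
  have k₁ : A * e₁₁ * N₁ = y₁' * y₂ * e₁₂ * (v * g + u * c) := by
    rw [h₁, hc, hg]
    field_simp
    ring
  have k₂ : A * e₂₂ * D₂ = y₁' * y₂ * e₁₂ * (u * g + v * c) := by
    rw [h₂, hc, hg]
    field_simp
  have k₃ : B * e₂₂ * N₂ = y₁' * y₂ * e₂₁ * (v' * g + u' * c⁻¹) := by
    rw [h₃, hc, hg]
    field_simp
    ring
  have k₄ : B * e₁₁ * D₁ = y₁' * y₂ * e₂₁ * (u' * g + v' * c⁻¹) := by
    rw [h₄, hc, hg]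
    field_simp
  -- The denominators of the equation do not vanish because they are proportional to products of
  -- nonvanishing τ-functions.
  have n₂ : u * g + v * c ≠ 0 := by
    intro h
    rw [h, mul_zero] at k₂
    exact mul_ne_zero (mul_ne_zero hA he₂₂) hD₂ k₂
  have n₄ : u' * g + v' * c⁻¹ ≠ 0 := by
    intro h
    rw [h, mul_zero] at k₄
    exact mul_ne_zero (mul_ne_zero hB he₁₁) hD₁ k₄
  refine ⟨n₂, n₄, ?_⟩
  rw [div_eq_div_iff (mul_ne_zero hD₁ hD₂) (mul_ne_zero n₂ n₄)]
  apply mul_left_cancel₀ (mul_ne_zero (mul_ne_zero (mul_ne_zero hA hB) (mul_ne_zero he₁₁ he₂₂))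
    (mul_ne_zero (pow_ne_zero 2 (mul_ne_zero hy₁' hy₂)) (mul_ne_zero he₁₂ he₂₁)))
  have k₁₃ := congrArg₂ (· * ·) k₁ k₃
  have k₂₄ := congrArg₂ (· * ·) k₂ k₄
  linear_combination ((y₁' * y₂) ^ 2 * (e₁₂ * e₂₁)) *
    ((u * g + v * c) * (u' * g + v' * c⁻¹) * k₁₃ - (v * g + u * c) * (v' * g + u' * c⁻¹) * k₂₄)

theorem div_mul_div_exchange (a b c d a' b' c' d' : K) :
    a * b / (c * d) * (a' * b' / (c' * d')) = a' * b * (b' * a) / (c' * d * (d' * c)) := by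
  rw [div_mul_div_comm]
  congr 1 <;> ring

/-- The bilinear relations give both equations up to constant factors, the second one a time step
later, as a formula for g σ(g) in terms of F = σ(f). Only normalisation remains. -/
theorem isSolutionD5_of_relations [Algebra ℂ K] {σ : K ≃ₐ[ℂ] K} {q₀ : ℂ} {p x α β γ δ f g F : K}
    (hp : p ≠ 0) (hx : x ≠ 0) (hα : α ≠ 0) (hβ : β ≠ 0) (hγ : γ ≠ 0) (hδ : δ ≠ 0)
    (hq₀ : algebraMap ℂ K q₀ = p ^ 2) (hσx : σ x = p ^ 2 * x) (hσα : σ α = α) (hσβ : σ β = β)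
    (hσγ : σ γ = γ) (hσδ : σ δ = δ) (hF : σ f = F)
    (nf₁ : β⁻¹ * x * g + α * (γ * δ) ≠ 0) (nf₂ : p * β * x * g + p⁻¹ * α⁻¹ * (γ * δ)⁻¹ ≠ 0)
    (hf : σ f * f = (α * g + β⁻¹ * x * (γ * δ)) * (p⁻¹ * α⁻¹ * g + p * β * x * (γ * δ)⁻¹) /
      ((β⁻¹ * x * g + α * (γ * δ)) * (p * β * x * g + p⁻¹ * α⁻¹ * (γ * δ)⁻¹)))
    (ng₁ : p ^ 2 * β * x * F + α * (δ / γ) ≠ 0)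
    (ng₂ : p * β⁻¹ * x * F + p⁻¹ * α⁻¹ * (δ / γ)⁻¹ ≠ 0)
    (hg : g * σ g = (α * F + p ^ 2 * β * x * (δ / γ)) *
        (p⁻¹ * α⁻¹ * F + p * β⁻¹ * x * (δ / γ)⁻¹) /
      ((p ^ 2 * β * x * F + α * (δ / γ)) * (p * β⁻¹ * x * F + p⁻¹ * α⁻¹ * (δ / γ)⁻¹))) :
    IsSolutionD5 σ q₀ x α β γ δ f g := by
  have hq0 : σ (algebraMap ℂ K q₀) = algebraMap ℂ K q₀ := σ.commutes q₀
  have d₁ : x * g + α * β * γ * δ = β * (β⁻¹ * x * g + α * (γ * δ)) := by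
    field_simp
  have d₂ : p ^ 2 * x * g + α⁻¹ * β⁻¹ * γ⁻¹ * δ⁻¹ =
      p * β⁻¹ * (p * β * x * g + p⁻¹ * α⁻¹ * (γ * δ)⁻¹) := by
    field_simp
  have d₃ : σ (x * f + α * β⁻¹ * γ⁻¹ * δ) = β⁻¹ * (p ^ 2 * β * x * F + α * (δ / γ)) := by
    simp only [map_add, map_mul, map_inv₀, hσx, hσα, hσβ, hσγ, hσδ, hF]
    field_simp
  have d₄ : σ (x * f + α⁻¹ * β * γ * δ⁻¹) =
      p * β * (p * β⁻¹ * x * F + p⁻¹ * α⁻¹ * (δ / γ)⁻¹) := by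
    simp only [map_add, map_mul, map_inv₀, hσx, hσα, hσβ, hσγ, hσδ, hF]
    field_simp
  refine ⟨hx, hα, hβ, hγ, hδ, ?_, hσα, hσβ, hσγ, hσδ, ?_, ?_, ?_, ?_, ?_, ?_⟩
  · rw [hq₀, hσx]
  · rw [d₁]
    exact mul_ne_zero hβ nf₁
  · rw [hq₀, d₂]
    exact mul_ne_zero (mul_ne_zero hp (inv_ne_zero hβ)) nf₂
  · intro h
    rw [h, map_zero] at d₃
    exact mul_ne_zero (inv_ne_zero hβ) ng₁ d₃.symm
  · intro h
    rw [h, map_zero] at d₄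
    exact mul_ne_zero (mul_ne_zero hp hβ) ng₂ d₄.symm
  · rw [hf, hq₀, d₁, d₂]
    generalize β⁻¹ * x * g + α * (γ * δ) = X at *
    generalize p * β * x * g + p⁻¹ * α⁻¹ * (γ * δ)⁻¹ = Y at *
    field_simp
  -- Applying σ turns the equation for σ⁻¹(g) g into the known one for g σ(g).
  · apply σ.injective
    rw [map_mul, σ.apply_symm_apply, hg, map_div₀, map_mul, map_mul, d₃, d₄]
    generalize p ^ 2 * β * x * F + α * (δ / γ) = X at *
    generalize p * β⁻¹ * x * F + p⁻¹ * α⁻¹ * (δ / γ)⁻¹ = Y at *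
    simp only [map_add, map_mul, map_inv₀, hσx, hσα, hσβ, hσγ, hσδ, hF]
    field_simp

variable [CharZero K]

theorem rhoD5_eq (m n : ZMod 2 → ℤ) (p α β x : K) (i j : ℤ) :
    rhoD5 m n p α β x i j = coreTau (varPair (p ^ 2) ![α, α⁻¹]
      ![-(p⁻¹ ^ 2 * β * x), -(p⁻¹ ^ 2 * β⁻¹ * x)]) (coreShift m i) (coreShift n j) := by
  rw [rhoD5, coreUC_eq_coreTau]

theorem rhoD5_add_two_left (m n : ZMod 2 → ℤ) (p α β x : K) (i j : ℤ) :
    rhoD5 m n p α β x (i + 2) j = rhoD5 m n p α β x i j := by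
  rw [rhoD5_eq, rhoD5_eq]
  exact coreTau_add_period_left _ _ _ _

theorem rhoD5_add_two_right (m n : ZMod 2 → ℤ) (p α β x : K) (i j : ℤ) :
    rhoD5 m n p α β x i (j + 2) = rhoD5 m n p α β x i j := by
  rw [rhoD5_eq, rhoD5_eq]
  exact coreTau_add_period_right _ _ _ _

/-- The scaling exponent of `ρ_{i,j}`. -/
def weightD5 (m n : ZMod 2 → ℤ) (i j : ℤ) : ℤ :=
  coreWeight (coreShift m i) - coreWeight (coreShift n j)

theorem scale_rhoD5 (m n : ZMod 2 → ℤ) {p α β x a b c d s : K} (hs : s ≠ 0)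
    (ha : a = s * α) (hb : b = s * α⁻¹) (hc : c = s * -(p⁻¹ ^ 2 * β * x))
    (hd : d = s * -(p⁻¹ ^ 2 * β⁻¹ * x)) (i j : ℤ) :
    coreTau (varPair (p ^ 2) ![a, b] ![c, d]) (coreShift m i) (coreShift n j) =
      s ^ weightD5 m n i j * rhoD5 m n p α β x i j := by
  rw [rhoD5_eq, weightD5]
  exact coreTau_scale₄ _ hs ha hb hc hd _ _

theorem eq_rhoD5 (m n : ZMod 2 → ℤ) {p α β x a b c d : K}
    (ha : a = α) (hb : b = α⁻¹) (hc : c = -(p⁻¹ ^ 2 * β * x))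
    (hd : d = -(p⁻¹ ^ 2 * β⁻¹ * x)) (i j : ℤ) :
    coreTau (varPair (p ^ 2) ![a, b] ![c, d]) (coreShift m i) (coreShift n j) =
      rhoD5 m n p α β x i j := by
  rw [rhoD5_eq, ha, hb, hc, hd]

/-- Each of the four relations shifts one variable of I and one of J, here α and -β⁻¹x. The
unshifted point, the two single shifts and the double shift rescale to Φ^{(-)} at p²x, Ψ^{(+)},
Ψ^{(-)} and Φ^{(+)} at x. The other three arise from the other choices of variables. -/
theorem phi_bilinear_first (m n : ZMod 2 → ℤ) {p α β x : K} (hp : p ≠ 0) (hq : ∀ k : ℕ, 0 < k → (p ^ 2) ^ k ≠ 1)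
    (hα : α ≠ 0) (hβ : β ≠ 0) (hx : x ≠ 0) (i : ℤ) :
    (β⁻¹ * x + α) * p ^ weightD5 m n i i *
        (phiPlus m n p α β x i * phiMinus m n p α β (p ^ 2 * x) (i + 1)) =
      β⁻¹ * x * p ^ weightD5 m n (i + 1) i *
        (psiPlus m n p α β x (i + 1) * psiMinus m n p α β x i) +
      α * p ^ weightD5 m n i (i + 1) *
        (psiMinus m n p α β x (i + 1) * psiPlus m n p α β x i) := by
  have h2 : p ^ 2 ≠ 0 := pow_ne_zero 2 hp
  have h := coreTau_bilinear hα (neg_ne_zero.2 (mul_ne_zero (inv_ne_zero hβ) hx))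
    (p := varPair (p ^ 2) ![α, α⁻¹] ![-(β * x), -(β⁻¹ * x)])
    (shiftRel_first hq rfl)
    (shiftRel_fourth (d' := -(p⁻¹ ^ 2 * β⁻¹ * x)) h2 hq (by field_simp))
    (shiftRel_fourth (d' := -(p⁻¹ ^ 2 * β⁻¹ * x)) h2 hq (by field_simp)) m n i i
  have e₀ := eq_rhoD5 m n (p := p) (α := α) (β := β) (x := p ^ 2 * x) (a := α) (b := α⁻¹)
    (c := -(β * x)) (d := -(β⁻¹ * x)) rfl rfl (by field_simp) (by field_simp)
  have e₁ := scale_rhoD5 m n (p := p) (α := p * α) (β := β) (x := p * x) (a := p ^ 2 * α)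
    (b := α⁻¹) (c := -(β * x)) (d := -(β⁻¹ * x)) hp (by ring) (by field_simp) (by field_simp)
    (by field_simp)
  have e₂ := eq_rhoD5 m n (p := p) (α := α) (β := p * β) (x := p * x) (a := α) (b := α⁻¹)
    (c := -(β * x)) (d := -(p⁻¹ ^ 2 * β⁻¹ * x)) rfl rfl (by field_simp) (by field_simp)
  have e₁₂ := scale_rhoD5 m n (p := p) (α := p * α) (β := p * β) (x := x) (a := p ^ 2 * α)
    (b := α⁻¹) (c := -(β * x)) (d := -(p⁻¹ ^ 2 * β⁻¹ * x)) hp (by ring) (by field_simp)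
    (by field_simp) (by field_simp)
  rw [e₀, e₁, e₁, e₂, e₂, e₁₂] at h
  rw [phiPlus, phiMinus, psiPlus, psiMinus, psiPlus, psiMinus, show i + 1 + 1 = i + 2 by ring,
    rhoD5_add_two_right, rhoD5_add_two_right]
  linear_combination -h

theorem phi_bilinear_second (m n : ZMod 2 → ℤ) {p α β x : K} (hp : p ≠ 0) (hq : ∀ k : ℕ, 0 < k → (p ^ 2) ^ k ≠ 1)
    (hα : α ≠ 0) (hβ : β ≠ 0) (hx : x ≠ 0) (i : ℤ) :
    (p * β * x + p⁻¹ * α⁻¹) * p ^ weightD5 m n i i *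
        (phiMinus m n p α β x i * phiPlus m n p α β (p ^ 2 * x) (i + 1)) =
      p * β * x * p ^ weightD5 m n (i + 1) i *
        (psiMinus m n p α β x (i + 1) * psiPlus m n p α β x i) +
      p⁻¹ * α⁻¹ * p ^ weightD5 m n i (i + 1) *
        (psiPlus m n p α β x (i + 1) * psiMinus m n p α β x i) := by
  have h2 : p ^ 2 ≠ 0 := pow_ne_zero 2 hp
  have h := coreTau_bilinear (mul_ne_zero (inv_ne_zero hp) (inv_ne_zero hα))
    (neg_ne_zero.2 (mul_ne_zero (mul_ne_zero hp hβ) hx))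
    (p := varPair (p ^ 2) ![p * α, p⁻¹ * α⁻¹] ![-(p * β * x), -(p⁻¹ * β⁻¹ * x)])
    (shiftRel_second (b' := p * α⁻¹) hq (by field_simp))
    (shiftRel_third (c' := -(p⁻¹ * β * x)) h2 hq (by field_simp))
    (shiftRel_third (c' := -(p⁻¹ * β * x)) h2 hq (by field_simp)) m n i i
  have e₀ := eq_rhoD5 m n (p := p) (α := p * α) (β := p * β) (x := p ^ 2 * x) (a := p * α)
    (b := p⁻¹ * α⁻¹) (c := -(p * β * x)) (d := -(p⁻¹ * β⁻¹ * x)) rfl (by field_simp)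
    (by field_simp) (by field_simp)
  have e₁ := scale_rhoD5 m n (p := p) (α := α) (β := p * β) (x := p * x) (a := p * α)
    (b := p * α⁻¹) (c := -(p * β * x)) (d := -(p⁻¹ * β⁻¹ * x)) hp rfl rfl (by field_simp)
    (by field_simp)
  have e₂ := eq_rhoD5 m n (p := p) (α := p * α) (β := β) (x := p * x) (a := p * α)
    (b := p⁻¹ * α⁻¹) (c := -(p⁻¹ * β * x)) (d := -(p⁻¹ * β⁻¹ * x)) rfl (by field_simp)
    (by field_simp) (by field_simp)
  have e₁₂ := scale_rhoD5 m n (p := p) (α := α) (β := β) (x := x) (a := p * α)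
    (b := p * α⁻¹) (c := -(p⁻¹ * β * x)) (d := -(p⁻¹ * β⁻¹ * x)) hp rfl rfl
    (by field_simp) (by field_simp)
  rw [e₀, e₁, e₁, e₂, e₂, e₁₂] at h
  rw [phiPlus, phiMinus, psiPlus, psiMinus, psiPlus, psiMinus, show i + 1 + 1 = i + 2 by ring,
    rhoD5_add_two_right, rhoD5_add_two_right]
  linear_combination -h

theorem psi_bilinear_first (m n : ZMod 2 → ℤ) {p α β x : K} (hp : p ≠ 0) (hq : ∀ k : ℕ, 0 < k → (p ^ 2) ^ k ≠ 1)
    (hα : α ≠ 0) (hβ : β ≠ 0) (hx : x ≠ 0) (i : ℤ) :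
    (p ^ 2 * β * x + α) * p ^ weightD5 m n i (i + 1) *
        (psiPlus m n p α β x i * psiMinus m n p α β (p ^ 2 * x) (i + 1)) =
      p ^ 2 * β * x * p ^ weightD5 m n (i + 1) (i + 1) *
        (phiPlus m n p α β (p ^ 2 * x) (i + 1) * phiMinus m n p α β (p ^ 2 * x) i) +
      α * p ^ weightD5 m n i (i + 2) *
        (phiMinus m n p α β (p ^ 2 * x) (i + 1) * phiPlus m n p α β (p ^ 2 * x) i) := by
  have h2 : p ^ 2 ≠ 0 := pow_ne_zero 2 hp
  have h := coreTau_bilinear hα (neg_ne_zero.2 (mul_ne_zero (mul_ne_zero h2 hβ) hx))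
    (p := varPair (p ^ 2) ![α, α⁻¹] ![-(p ^ 2 * β * x), -(β⁻¹ * x)])
    (shiftRel_first hq rfl)
    (shiftRel_third (c' := -(β * x)) h2 hq (by field_simp))
    (shiftRel_third (c' := -(β * x)) h2 hq (by field_simp)) m n i (i + 1)
  have e₀ := eq_rhoD5 m n (p := p) (α := α) (β := p * β) (x := p * (p ^ 2 * x)) (a := α)
    (b := α⁻¹) (c := -(p ^ 2 * β * x)) (d := -(β⁻¹ * x)) rfl rfl (by field_simp) (by field_simp)
  have e₁ := scale_rhoD5 m n (p := p) (α := p * α) (β := p * β) (x := p ^ 2 * x) (a := p ^ 2 * α)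
    (b := α⁻¹) (c := -(p ^ 2 * β * x)) (d := -(β⁻¹ * x)) hp (by ring) (by field_simp)
    (by field_simp) (by field_simp)
  have e₂ := eq_rhoD5 m n (p := p) (α := α) (β := β) (x := p ^ 2 * x) (a := α) (b := α⁻¹)
    (c := -(β * x)) (d := -(β⁻¹ * x)) rfl rfl (by field_simp) (by field_simp)
  have e₁₂ := scale_rhoD5 m n (p := p) (α := p * α) (β := β) (x := p * x) (a := p ^ 2 * α)
    (b := α⁻¹) (c := -(β * x)) (d := -(β⁻¹ * x)) hp (by ring) (by field_simp)
    (by field_simp) (by field_simp)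
  rw [e₀, e₁, e₁, e₂, e₂, e₁₂, show i + 1 + 1 = i + 2 by ring, rhoD5_add_two_right,
    rhoD5_add_two_right, rhoD5_add_two_right] at h
  rw [phiPlus, phiMinus, phiPlus, phiMinus, psiPlus, psiMinus, show i + 1 + 1 = i + 2 by ring]
  rw [rhoD5_add_two_right]
  linear_combination -h

theorem psi_bilinear_second (m n : ZMod 2 → ℤ) {p α β x : K} (hp : p ≠ 0) (hq : ∀ k : ℕ, 0 < k → (p ^ 2) ^ k ≠ 1)
    (hα : α ≠ 0) (hβ : β ≠ 0) (hx : x ≠ 0) (i : ℤ) :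
    (p * β⁻¹ * x + p⁻¹ * α⁻¹) * p ^ weightD5 m n i (i + 1) *
        (psiMinus m n p α β x i * psiPlus m n p α β (p ^ 2 * x) (i + 1)) =
      p * β⁻¹ * x * p ^ weightD5 m n (i + 1) (i + 1) *
        (phiMinus m n p α β (p ^ 2 * x) (i + 1) * phiPlus m n p α β (p ^ 2 * x) i) +
      p⁻¹ * α⁻¹ * p ^ weightD5 m n i (i + 2) *
        (phiPlus m n p α β (p ^ 2 * x) (i + 1) * phiMinus m n p α β (p ^ 2 * x) i) := by
  have h2 : p ^ 2 ≠ 0 := pow_ne_zero 2 hp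
  have h := coreTau_bilinear (mul_ne_zero (inv_ne_zero hp) (inv_ne_zero hα))
    (neg_ne_zero.2 (mul_ne_zero (mul_ne_zero hp (inv_ne_zero hβ)) hx))
    (p := varPair (p ^ 2) ![p * α, p⁻¹ * α⁻¹] ![-(p * β * x), -(p * β⁻¹ * x)])
    (shiftRel_second (b' := p * α⁻¹) hq (by field_simp))
    (shiftRel_fourth (d' := -(p⁻¹ * β⁻¹ * x)) h2 hq (by field_simp))
    (shiftRel_fourth (d' := -(p⁻¹ * β⁻¹ * x)) h2 hq (by field_simp)) m n i (i + 1)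
  have e₀ := eq_rhoD5 m n (p := p) (α := p * α) (β := β) (x := p * (p ^ 2 * x)) (a := p * α)
    (b := p⁻¹ * α⁻¹) (c := -(p * β * x)) (d := -(p * β⁻¹ * x)) rfl (by field_simp)
    (by field_simp) (by field_simp)
  have e₁ := scale_rhoD5 m n (p := p) (α := α) (β := β) (x := p ^ 2 * x) (a := p * α)
    (b := p * α⁻¹) (c := -(p * β * x)) (d := -(p * β⁻¹ * x)) hp rfl rfl (by field_simp)
    (by field_simp)
  have e₂ := eq_rhoD5 m n (p := p) (α := p * α) (β := p * β) (x := p ^ 2 * x) (a := p * α)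
    (b := p⁻¹ * α⁻¹) (c := -(p * β * x)) (d := -(p⁻¹ * β⁻¹ * x)) rfl (by field_simp)
    (by field_simp) (by field_simp)
  have e₁₂ := scale_rhoD5 m n (p := p) (α := α) (β := p * β) (x := p * x) (a := p * α)
    (b := p * α⁻¹) (c := -(p * β * x)) (d := -(p⁻¹ * β⁻¹ * x)) hp rfl rfl
    (by field_simp) (by field_simp)
  rw [e₀, e₁, e₁, e₂, e₂, e₁₂, show i + 1 + 1 = i + 2 by ring, rhoD5_add_two_right,
    rhoD5_add_two_right, rhoD5_add_two_right] at h
  rw [phiPlus, phiMinus, phiPlus, phiMinus, psiPlus, psiMinus, show i + 1 + 1 = i + 2 by ring]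
  rw [rhoD5_add_two_right]
  linear_combination -h

end Bilinear

/-- Two consecutive increments 2n_{j+1} - |n| and 2n_{j+2} - |n| cancel. -/
theorem weightD5_add_two_right (m n : ZMod 2 → ℤ) (i j : ℤ) :
    weightD5 m n i (j + 2) = weightD5 m n i j := by
  have h : vecSum n = n ((j + 1 : ℤ) : ZMod 2) + n ((j + 1 + 1 : ℤ) : ZMod 2) := by
    have : vecSum n = n 0 + n 1 := Fin.sum_univ_two n
    rcases Int.even_or_odd' j with ⟨k, rfl | rfl⟩ <;> push_cast <;>
      simp [this, show (2 : ZMod 2) = 0 from rfl, show (1 + 1 : ZMod 2) = 0 from rfl,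
        add_comm]
  rw [weightD5, weightD5, show j + 2 = j + 1 + 1 by ring, coreWeight_coreShift_succ,
    coreWeight_coreShift_succ, h]
  push_cast
  ring

theorem weightD5_add_two_left (m n : ZMod 2 → ℤ) (i j : ℤ) :
    weightD5 m n (i + 2) j = weightD5 m n i j := by
  have h := weightD5_add_two_right n m j i
  rw [weightD5, weightD5] at h ⊢
  linarith

/-- These differences are the exponents of p in γδ and δ/γ; this is how the two constants get their
values. -/
theorem weightD5_one_two (m n : ZMod 2 → ℤ) :
    weightD5 m n 2 1 - weightD5 m n 1 2 = (2 * n 2 - vecSum n) + (2 * m 2 - vecSum m) ∧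
      weightD5 m n 2 2 - weightD5 m n 1 1 = (2 * m 2 - vecSum m) - (2 * n 2 - vecSum n) := by
  have hm := coreWeight_coreShift_succ m 1
  have hn := coreWeight_coreShift_succ n 1
  norm_num at hm hn
  rw [weightD5, weightD5, weightD5, weightD5, hm, hn]
  constructor <;> ring

theorem rhoD5_ne_zero (m n : ZMod 2 → ℤ) {p a b c : ℂ} (hp : p ≠ 0)
    (hq : ∀ k : ℕ, 0 < k → p ^ k ≠ 1) (ha : a ≠ 0) (hb : b ≠ 0) (hc : c ≠ 0) (i j : ℤ) :
    rhoD5 m n (rconst p) (rconst a * rvar 0) (rconst b * rvar 1) (rconst c * rvar 2 : RatFun 3)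
      i j ≠ 0 := by
  rw [rhoD5_eq, ← rconst_pow]
  -- The degeneration α → 0 with u = α: the variable α⁻¹ dominates in the x-part and the inverse of
  -- α in the y-part.
  set x : Fin 3 → ℂ := ![0, 1, 1] with hx
  have h0 : HasValueAt (rvar 0 : RatFun 3) x 0 := hasValueAt_rvar x 0
  have h1 : HasValueAt (rvar 1 : RatFun 3) x 1 := hasValueAt_rvar x 1
  have h2 : HasValueAt (rvar 2 : RatFun 3) x 1 := hasValueAt_rvar x 2
  have hv0 := rvar_ne_zero (k := 3) 0
  have haa := rconst_ne_zero (k := 3) ha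
  have hpv : HasValueAt ((rconst p)⁻¹ ^ 2 : RatFun 3) x (p⁻¹ ^ 2) :=
    ((hasValueAt_rconst x p).inv hp).pow 2
  have hI : HasValueAt (rvar 0 * (rconst a * rvar 0) : RatFun 3) x 0 := by
    simpa using h0.mul ((hasValueAt_rconst x a).mul h0)
  have hI' : HasValueAt (rvar 0 * (rconst a * rvar 0)⁻¹ : RatFun 3) x a⁻¹ := by
    have := hasValueAt_rconst (k := 3) x a⁻¹
    rw [rconst_inv] at this
    convert! this using 1
    field_simp
  have hb1 := (hasValueAt_rconst x b).mul h1
  have hc2 := (hasValueAt_rconst x c).mul h2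
  have hb1' := hb1.inv (by simpa using hb)
  have hJ : ∀ {F : RatFun 3} {v : ℂ}, HasValueAt F x v → HasValueAt (rvar 0 * F) x 0 := by
    intro F v hF
    simpa using h0.mul hF
  have hp2 : p⁻¹ ^ 2 ≠ 0 := pow_ne_zero 2 (inv_ne_zero hp)
  refine coreTau_ne_zero x (pow_ne_zero 2 hp) (c := a⁻¹) (c' := a⁻¹) (u := rvar 0)
    (vI := ![0, a⁻¹]) (vI' := ![a⁻¹, 0]) (vJ := ![0, 0]) (vJ' := ![0, 0])
    ?_ (inv_ne_zero ha) (inv_ne_zero ha) hv0 h0 ?_ ?_ ?_ ?_ ?_ ?_ _ _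
  · intro k hk
    rw [← pow_mul]
    exact hq _ (by omega)
  · simp only [Fin.forall_fin_two, Matrix.cons_val_zero, Matrix.cons_val_one]
    exact ⟨hI, hI'⟩
  · simp only [Fin.forall_fin_two, Matrix.cons_val_zero, Matrix.cons_val_one]
    exact ⟨hJ ((hpv.mul hb1).mul hc2).neg, hJ ((hpv.mul hb1').mul hc2).neg⟩
  · simp only [Fin.forall_fin_two, Matrix.cons_val_zero, Matrix.cons_val_one, inv_inv]
    exact ⟨hI', hI⟩
  · simp only [Fin.forall_fin_two, Matrix.cons_val_zero, Matrix.cons_val_one]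
    exact ⟨hJ (((hpv.mul hb1).mul hc2).neg.inv (by simp [hp, hb, hc])),
      hJ (((hpv.mul hb1').mul hc2).neg.inv (by simp [hp, hb, hc]))⟩
  · intro n
    simp [Fin.sum_univ_two]
  · intro n
    simp [Fin.sum_univ_two]

theorem map_rhoD5 {K : Type*} [Field K] [CharZero K] (φ : K →+* K) (m n : ZMod 2 → ℤ)
    (p α β x : K) (i j : ℤ) :
    φ (rhoD5 m n p α β x i j) = rhoD5 m n (φ p) (φ α) (φ β) (φ x) i j := by
  rw [rhoD5_eq, rhoD5_eq, coreTau_map, map_pow]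
  congr 2 <;> funext i <;> fin_cases i <;> simp

/-! ### The solution of type D -/

section Solution

variable (m n : ZMod 2 → ℤ) {p : ℂ}

theorem rhoD5_family_ne_zero (hp : p ≠ 0) (hq : ∀ k : ℕ, 0 < k → p ^ k ≠ 1) {c : ℂ} (hc : c ≠ 0)
    (i : ℤ) :
    phiPlus m n (rconst p) (rvar 0) (rvar 1) (rconst c * rvar 2 : RatFun 3) i ≠ 0 ∧
      phiMinus m n (rconst p) (rvar 0) (rvar 1) (rconst c * rvar 2 : RatFun 3) i ≠ 0 ∧
      psiPlus m n (rconst p) (rvar 0) (rvar 1) (rconst c * rvar 2 : RatFun 3) i ≠ 0 ∧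
      psiMinus m n (rconst p) (rvar 0) (rvar 1) (rconst c * rvar 2 : RatFun 3) i ≠ 0 := by
  have e : ∀ i : Fin 3, (rvar i : RatFun 3) = rconst 1 * rvar i := by
    intro i
    rw [rconst, map_one, one_mul]
  have e' : (rconst p * (rconst c * rvar 2) : RatFun 3) = rconst (p * c) * rvar 2 := by
    rw [rconst, rconst, rconst, map_mul, mul_assoc]
  have hpc := mul_ne_zero hp hc
  rw [phiPlus, phiMinus, psiPlus, psiMinus, e']
  refine ⟨rhoD5_ne_zero m n hp hq hp hp hc _ _, ?_, ?_, ?_⟩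
  · rw [e 0, e 1]
    exact rhoD5_ne_zero m n hp hq one_ne_zero one_ne_zero hc _ _
  · rw [e 1]
    exact rhoD5_ne_zero m n hp hq hp one_ne_zero hpc _ _
  · rw [e 0]
    exact rhoD5_ne_zero m n hp hq one_ne_zero hp hpc _ _

theorem isSolutionD5_of_ne_zero {K : Type*} [Field K] [CharZero K] [Algebra ℂ K] {σ : K ≃ₐ[ℂ] K}
    {p₀ : ℂ} {p α β x : K} (hp₀ : algebraMap ℂ K p₀ = p) (hP : p ≠ 0)
    (hq : ∀ k : ℕ, 0 < k → (p ^ 2) ^ k ≠ 1) (hα : α ≠ 0) (hβ : β ≠ 0) (hx : x ≠ 0)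
    (hσ0 : σ α = α) (hσ1 : σ β = β) (hσx : σ x = p ^ 2 * x)
    (nz₁ : ∀ i, phiPlus m n p α β x i ≠ 0 ∧ phiMinus m n p α β x i ≠ 0 ∧
      psiPlus m n p α β x i ≠ 0 ∧ psiMinus m n p α β x i ≠ 0)
    (nz₂ : ∀ i, phiPlus m n p α β (p ^ 2 * x) i ≠ 0 ∧ phiMinus m n p α β (p ^ 2 * x) i ≠ 0 ∧
      psiPlus m n p α β (p ^ 2 * x) i ≠ 0 ∧ psiMinus m n p α β (p ^ 2 * x) i ≠ 0)
    (hA₁ : β⁻¹ * x + α ≠ 0) (hA₂ : p * β * x + p⁻¹ * α⁻¹ ≠ 0)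
    (hA₃ : p ^ 2 * β * x + α ≠ 0) (hA₄ : p * β⁻¹ * x + p⁻¹ * α⁻¹ ≠ 0) :
    IsSolutionD5 σ (p₀ ^ 2) x α β (p ^ (2 * n 2 - vecSum n)) (p ^ (2 * m 2 - vecSum m))
      (solD5f m n p α β x) (solD5g m n p α β x) := by
  have hσp : σ p = p := by
    rw [← hp₀]
    exact σ.commutes p₀
  have hσρ : ∀ a b c : K, ∀ i j, σ (rhoD5 m n p a b c i j) =
      rhoD5 m n p (σ a) (σ b) (σ c) i j := by
    intro a b c i j
    have := map_rhoD5 (σ : K →+* K) m n p a b c i j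
    simpa only [RingHom.coe_coe, hσp] using this
  have hq0 : algebraMap ℂ K (p₀ ^ 2) = p ^ 2 := by rw [map_pow, hp₀]
  have hw := weightD5_one_two m n
  have f₁ := fun i => phi_bilinear_first m n hP hq hα hβ hx i
  have f₂ := fun i => phi_bilinear_second m n hP hq hα hβ hx i
  have g₁ := fun i => psi_bilinear_first m n hP hq hα hβ hx i
  have g₂ := fun i => psi_bilinear_second m n hP hq hα hβ hx i
  simp only [weightD5_add_two_right] at g₁ g₂
  have per : ∀ x : K,
      phiPlus m n p α β x 3 = phiPlus m n p α β x 1 ∧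
      phiMinus m n p α β x 3 =
        phiMinus m n p α β x 1 ∧
      psiPlus m n p α β x 3 = psiPlus m n p α β x 1 ∧
      psiMinus m n p α β x 3 =
        psiMinus m n p α β x 1 := by
    intro x
    have h : ∀ (a b c : K) (j : ℤ), rhoD5 m n p a b c 3 (j + 2) =
        rhoD5 m n p a b c 1 j := by
      intro a b c j
      rw [rhoD5_add_two_right]
      exact rhoD5_add_two_left m n _ _ _ _ 1 j
    exact ⟨h _ _ _ 1, h _ _ _ 1, h _ _ _ 2, h _ _ _ 2⟩
  have wper : weightD5 m n 3 2 = weightD5 m n 1 2 ∧ weightD5 m n 2 3 = weightD5 m n 2 1 ∧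
      weightD5 m n 3 3 = weightD5 m n 1 1 :=
    ⟨weightD5_add_two_left m n 1 2, weightD5_add_two_right m n 2 1,
      (weightD5_add_two_left m n 1 3).trans (weightD5_add_two_right m n 1 1)⟩
  -- Only i = 1, 2 are needed; the index 3 arising from i = 2 is brought back to 1 by periodicity.
  have f₁₁ := f₁ 1
  have f₁₂ := f₁ 2
  have f₂₁ := f₂ 1
  have f₂₂ := f₂ 2
  have g₁₁ := g₁ 1
  have g₁₂ := g₁ 2
  have g₂₁ := g₂ 1
  have g₂₂ := g₂ 2
  norm_num only at f₁₁ f₁₂ f₂₁ f₂₂ g₁₁ g₁₂ g₂₁ g₂₂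
  simp only [per, wper] at f₁₁ f₁₂ f₂₁ f₂₂ g₁₁ g₁₂ g₂₁ g₂₂
  have hz : ∀ k : ℤ, (p : K) ^ k ≠ 0 := fun k => zpow_ne_zero k hP
  -- In σ(f) f the numerator is regrouped into the left sides of the first relation at 1 and the
  -- second at 2, the denominator into those of the second at 1 and the first at 2.
  have main_f := quotient_of_bilinear hA₁ hA₂ (hz _) (hz _) (hz _) (hz _)
    (nz₁ 1).2.2.2 (nz₁ 2).2.2.1
    (mul_ne_zero (nz₁ 1).2.1 (nz₂ 2).1) (mul_ne_zero (nz₁ 2).1 (nz₂ 1).2.1)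
    f₁₁ f₁₂ f₂₂ f₂₁ rfl rfl
  have main_g := quotient_of_bilinear hA₃ hA₄ (hz _) (hz _) (hz _) (hz _)
    (nz₂ 1).2.1 (nz₂ 2).1
    (mul_ne_zero (nz₁ 1).2.2.2 (nz₂ 2).2.2.1) (mul_ne_zero (nz₁ 2).2.2.1 (nz₂ 1).2.2.2)
    g₁₁ g₁₂ g₂₂ g₂₁ rfl rfl
  set f := solD5f m n p α β x with hf
  set g := solD5g m n p α β x with hg
  set F := phiPlus m n p α β (p ^ 2 * x) 1 *
    phiMinus m n p α β (p ^ 2 * x) 2 /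
    (phiMinus m n p α β (p ^ 2 * x) 1 *
      phiPlus m n p α β (p ^ 2 * x) 2) with hF
  have hσf : σ f = F := by
    rw [hf, solD5f, hF]
    simp only [phiPlus, phiMinus, map_div₀, map_mul, hσρ, hσ0, hσ1, hσx, hσp]
  have hσg : σ g = psiPlus m n p α β (p ^ 2 * x) 1 *
      psiMinus m n p α β (p ^ 2 * x) 2 /
      (psiMinus m n p α β (p ^ 2 * x) 1 *
        psiPlus m n p α β (p ^ 2 * x) 2) := by
    rw [hg, solD5g]
    simp only [psiPlus, psiMinus, map_div₀, map_mul, hσρ, hσ0, hσ1, hσx, hσp]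
  rw [show psiPlus m n p α β x 1 *
    psiMinus m n p α β x 2 /
    (psiMinus m n p α β x 1 *
      psiPlus m n p α β x 2) = g from rfl] at main_f
  have hcf : (p : K) ^ weightD5 m n 2 1 / p ^ weightD5 m n 1 2 =
      p ^ (2 * n 2 - vecSum n) * p ^ (2 * m 2 - vecSum m) := by
    rw [← zpow_sub₀ hP, hw.1, zpow_add₀ hP]
  have hcg : (p : K) ^ weightD5 m n 2 2 / p ^ weightD5 m n 1 1 =
      p ^ (2 * m 2 - vecSum m) / p ^ (2 * n 2 - vecSum n) := by
    rw [← zpow_sub₀ hP, hw.2, zpow_sub₀ hP]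
  rw [hcf] at main_f
  rw [hcg] at main_g
  have hγ : p ^ (2 * n 2 - vecSum n) ≠ 0 := hz _
  have hδ : p ^ (2 * m 2 - vecSum m) ≠ 0 := hz _
  have hσz : ∀ k : ℤ, σ (p ^ k) = p ^ k := fun k => by rw [map_zpow₀, hσp]
  have hff : σ f * f = _ := Eq.trans (by
    rw [hσf, hF, hf, solD5f, div_mul_div_exchange]) main_f.2.2
  have hgg : g * σ g = _ := Eq.trans (by
    rw [mul_comm, hσg, hg, solD5g, div_mul_div_exchange]) main_g.2.2
  obtain ⟨nf₁, nf₂, -⟩ := main_f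
  obtain ⟨ng₁, ng₂, -⟩ := main_g
  exact isSolutionD5_of_relations hP hx hα hβ hγ hδ hq0 hσx hσ0 hσ1 (hσz _) (hσz _) hσf
    nf₁ nf₂ hff ng₁ ng₂ hgg

theorem exists_isSolutionD5 (hp : p ≠ 0) (hq : ∀ k : ℕ, 0 < k → p ^ k ≠ 1) :
    ∃ σ : RatFun 3 ≃ₐ[ℂ] RatFun 3, σ (rvar 0) = rvar 0 ∧ σ (rvar 1) = rvar 1 ∧
      σ (rvar 2) = rconst (p ^ 2) * rvar 2 ∧
      IsSolutionD5 σ (p ^ 2) (rvar 2) (rvar 0) (rvar 1) (rconst (p ^ (2 * n 2 - vecSum n)))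
        (rconst (p ^ (2 * m 2 - vecSum m))) (solD5f m n (rconst p) (rvar 0) (rvar 1) (rvar 2))
        (solD5g m n (rconst p) (rvar 0) (rvar 1) (rvar 2)) := by
  obtain ⟨σ, hσ⟩ := exists_scale ![1, 1, p ^ 2] (by simp [Fin.forall_fin_succ, hp])
  have hσ0 : σ (rvar 0) = rvar 0 := by simpa [rconst] using hσ 0
  have hσ1 : σ (rvar 1) = rvar 1 := by simpa [rconst] using hσ 1
  have hσ2 : σ (rvar 2) = rconst (p ^ 2) * rvar 2 := hσ 2
  have nz := fun c hc => rhoD5_family_ne_zero m n (c := c) hp hq hc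
  have nz₁ := nz 1 one_ne_zero
  have nz₂ := nz _ (pow_ne_zero 2 hp)
  -- At α = β = 1, x = 0 the linear factors in front of the bilinear relations have nonzero constant
  -- values.
  have hval : ∀ {u v : RatFun 3} {a b : ℂ}, HasValueAt u ![(1 : ℂ), 1, 0] a →
      HasValueAt v ![(1 : ℂ), 1, 0] b → a + b ≠ 0 → u + v ≠ 0 :=
    fun hu hv h => (hu.add hv).ne_zero h
  have v0 : HasValueAt (rvar 0 : RatFun 3) ![(1 : ℂ), 1, 0] 1 := hasValueAt_rvar _ 0
  have v1 : HasValueAt (rvar 1 : RatFun 3) ![(1 : ℂ), 1, 0] 1 := hasValueAt_rvar _ 1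
  have v2 : HasValueAt (rvar 2 : RatFun 3) ![(1 : ℂ), 1, 0] 0 := hasValueAt_rvar _ 2
  have vp : HasValueAt (rconst p : RatFun 3) ![(1 : ℂ), 1, 0] p := hasValueAt_rconst _ p
  have w0 := v0.inv one_ne_zero
  have w1 := v1.inv one_ne_zero
  have wp := vp.inv hp
  have hA₁ := hval (w1.mul v2) v0 (by simp)
  have hA₂ := hval ((vp.mul v1).mul v2) (wp.mul w0) (by simpa using hp)
  have hA₃ := hval (((vp.pow 2).mul v1).mul v2) v0 (by simp)
  have hA₄ := hval ((vp.mul w1).mul v2) (wp.mul w0) (by simpa using hp)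
  have hα := rvar_ne_zero (k := 3) 0
  have hβ := rvar_ne_zero (k := 3) 1
  have hx := rvar_ne_zero (k := 3) 2
  have hP := rconst_ne_zero (k := 3) hp
  have hq' : ∀ k : ℕ, 0 < k → (rconst p ^ 2 : RatFun 3) ^ k ≠ 1 := by
    intro k hk
    rw [← pow_mul]
    exact rconst_pow_ne_one hq _ (by omega)
  have hσx : σ (rvar 2) = rconst p ^ 2 * rvar 2 := by rw [hσ2, rconst_pow]
  have hone : (rconst 1 : RatFun 3) = 1 := map_one _
  simp only [hone, one_mul, rconst_pow] at nz₁ nz₂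
  have hp₀ : algebraMap ℂ (RatFun 3) p = rconst p := by rw [rconst]
  rw [rconst_zpow, rconst_zpow]
  exact ⟨σ, hσ0, hσ1, hσ2, isSolutionD5_of_ne_zero m n hp₀ hP hq' hα hβ hx hσ0 hσ1 hσx nz₁ nz₂
    hA₁ hA₂ hA₃ hA₄⟩

end Solution

end TypeD

end

noncomputable section

/-! ### Type `E_6^{(1)}` -/

section TypeE

section Reflections

variable {K : Type*} [Field K]

/-- The denominator of `s_3(f)` and `s_3(g)`. -/
def reflDenomE6 (X : E6Point K) : K :=
  (X.α 3 ^ 3)⁻¹ * (X.α 1 * X.α 2 ^ 2 / (X.α 4 ^ 2 * X.α 5)) * X.f +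
    X.α 3 ^ 3 * (X.α 5 * X.α 4 ^ 2 / (X.α 6 ^ 2 * X.α 0)) * X.g +
    X.α 0 * X.α 6 ^ 2 / (X.α 2 ^ 2 * X.α 1)

theorem reflE6_α_ne_zero {X : E6Point K} (h : ∀ j, X.α j ≠ 0) (i j : Fin 7) :
    (reflE6 i X).α j ≠ 0 :=
  mul_ne_zero (h j) (zpow_ne_zero _ (h i))

/-- All coordinates of a point over the rational functions have values at `x`. -/
def HasValueE6 [Algebra ℂ K] {k : ℕ} (Y : E6Point (RatFun k)) (x : Fin k → K) (y : E6Point K) :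
    Prop :=
  (∀ j, HasValueAt (Y.α j) x (y.α j)) ∧ HasValueAt Y.f x y.f ∧ HasValueAt Y.g x y.g

/-- The only denominator besides the parameters is that of s_3. Regularity of the translation at the
solution thus amounts to four non-vanishing conditions, one for each s_3 in the word. -/
theorem HasValueE6.reflE6 [Algebra ℂ K] {k : ℕ} {Y : E6Point (RatFun k)} {x : Fin k → K}
    {y : E6Point K} (h : HasValueE6 Y x y) (hα : ∀ j, y.α j ≠ 0) (i : Fin 7)
    (hd : i = 3 → reflDenomE6 y ≠ 0) : HasValueE6 (reflE6 i Y) x (reflE6 i y) := by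
  obtain ⟨ha, hf, hg⟩ := h
  have h3 := (ha 3).pow 3
  have h3' := h3.inv (pow_ne_zero 3 (hα 3))
  have hx := ((ha 1).mul ((ha 2).pow 2)).div (((ha 4).pow 2).mul (ha 5))
    (mul_ne_zero (pow_ne_zero 2 (hα 4)) (hα 5))
  have hy := ((ha 5).mul ((ha 4).pow 2)).div (((ha 6).pow 2).mul (ha 0))
    (mul_ne_zero (pow_ne_zero 2 (hα 6)) (hα 0))
  have hz := ((ha 0).mul ((ha 6).pow 2)).div (((ha 2).pow 2).mul (ha 1))
    (mul_ne_zero (pow_ne_zero 2 (hα 2)) (hα 1))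
  refine ⟨fun j => (ha j).mul ((ha i).zpow (hα i) _), ?_, ?_⟩
  · by_cases hi : i = 3
    · simp only [_root_.reflE6, if_pos hi]
      exact hf.mul ((((hx.mul hf).add ((h3'.mul hy).mul hg)).add (h3.mul hz)).div
        ((((h3'.mul hx).mul hf).add ((h3.mul hy).mul hg)).add hz) (hd hi))
    · simp only [_root_.reflE6, if_neg hi]
      exact hf
  · by_cases hi : i = 3
    · simp only [_root_.reflE6, if_pos hi]
      exact hg.mul (((((h3.mul hx).mul hf).add (hy.mul hg)).add (h3'.mul hz)).div
        ((((h3'.mul hx).mul hf).add ((h3.mul hy).mul hg)).add hz) (hd hi))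
    · simp only [_root_.reflE6, if_neg hi]
      exact hg

/-- The composition of the commuting reflections `s_2`, `s_4`, `s_6`. -/
def reflInner (X : E6Point K) : E6Point K := reflE6 2 (reflE6 4 (reflE6 6 X))

/-- The composition of the commuting reflections `s_0`, `s_1`, `s_5`. -/
def reflOuter (X : E6Point K) : E6Point K := reflE6 0 (reflE6 1 (reflE6 5 X))

theorem reflE6_three_α (X : E6Point K) (h : ∀ j, X.α j ≠ 0) : (reflE6 3 X).α =
    ![X.α 0, X.α 1, X.α 2 * X.α 3, (X.α 3)⁻¹, X.α 4 * X.α 3, X.α 5, X.α 6 * X.α 3] := by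
  have h3 := h 3
  funext j
  fin_cases j <;> simp [reflE6, cartanE6]
  field_simp

theorem reflInner_α (X : E6Point K) (h : ∀ j, X.α j ≠ 0) : (reflInner X).α =
    ![X.α 0 * X.α 6, X.α 1 * X.α 2, (X.α 2)⁻¹, X.α 3 * X.α 2 * X.α 4 * X.α 6, (X.α 4)⁻¹,
      X.α 5 * X.α 4, (X.α 6)⁻¹] := by
  have h2 := h 2
  have h4 := h 4
  have h6 := h 6
  funext j
  fin_cases j <;> simp [reflInner, reflE6, cartanE6] <;> field_simp

theorem reflOuter_α (X : E6Point K) (h : ∀ j, X.α j ≠ 0) : (reflOuter X).α =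
    ![(X.α 0)⁻¹, (X.α 1)⁻¹, X.α 2 * X.α 1, X.α 3, X.α 4 * X.α 5, (X.α 5)⁻¹, X.α 6 * X.α 0] := by
  have h0 := h 0
  have h1 := h 1
  have h5 := h 5
  funext j
  fin_cases j <;> simp [reflOuter, reflE6, cartanE6] <;> field_simp

theorem reflInner_f (X : E6Point K) : (reflInner X).f = X.f := rfl
theorem reflInner_g (X : E6Point K) : (reflInner X).g = X.g := rfl

theorem reflInner_α_ne_zero {X : E6Point K} (h : ∀ j, X.α j ≠ 0) (j : Fin 7) :
    (reflInner X).α j ≠ 0 :=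
  reflE6_α_ne_zero (reflE6_α_ne_zero (reflE6_α_ne_zero h 6) 4) 2 j

theorem reflOuter_α_ne_zero {X : E6Point K} (h : ∀ j, X.α j ≠ 0) (j : Fin 7) :
    (reflOuter X).α j ≠ 0 :=
  reflE6_α_ne_zero (reflE6_α_ne_zero (reflE6_α_ne_zero h 5) 1) 0 j

theorem HasValueE6.reflInner [Algebra ℂ K] {k : ℕ} {Y : E6Point (RatFun k)} {x : Fin k → K}
    {y : E6Point K} (h : HasValueE6 Y x y) (hα : ∀ j, y.α j ≠ 0) :
    HasValueE6 (reflInner Y) x (reflInner y) :=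
  ((h.reflE6 hα 6 (by simp)).reflE6 (reflE6_α_ne_zero hα 6) 4 (by simp)).reflE6
    (reflE6_α_ne_zero (reflE6_α_ne_zero hα 6) 4) 2 (by simp)

theorem HasValueE6.reflOuter [Algebra ℂ K] {k : ℕ} {Y : E6Point (RatFun k)} {x : Fin k → K}
    {y : E6Point K} (h : HasValueE6 Y x y) (hα : ∀ j, y.α j ≠ 0) :
    HasValueE6 (reflOuter Y) x (reflOuter y) :=
  ((h.reflE6 hα 5 (by simp)).reflE6 (reflE6_α_ne_zero hα 5) 1 (by simp)).reflE6
    (reflE6_α_ne_zero (reflE6_α_ne_zero hα 5) 1) 0 (by simp)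

/-- Three bilinear relations for triples `P`, `P'`, `Q`, `R`, by which `s_3` exchanges `P` and
`P'`. -/
def BilinearE6 (a κ : K) (e P P' Q R : Fin 3 → K) : Prop :=
  ∀ j, κ * e j * (Q j * R j) = P' (j - 1) * P (j + 1) - a * (P (j - 1) * P' (j + 1))

/-- With f and g written as products over the triples, the three cubic forms in s_3(f), s_3(g) are
combinations of the three bilinear relations and collapse to single monomials. The ratios then just
exchange P for P'. -/
theorem reflE6_three_of_bilinear {X : E6Point K} {a κ : K} {e P P' Q R : Fin 3 → K}
    (hX : ∀ j, X.α j ≠ 0) (ha : X.α 3 ^ 3 = a) (ha3 : a ^ 3 ≠ 1) (h : BilinearE6 a κ e P P' Q R)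
    (hx : X.α 1 * X.α 2 ^ 2 / (X.α 4 ^ 2 * X.α 5) = e 0)
    (hy : X.α 5 * X.α 4 ^ 2 / (X.α 6 ^ 2 * X.α 0) = e 1)
    (hz : X.α 0 * X.α 6 ^ 2 / (X.α 2 ^ 2 * X.α 1) = e 2)
    (hP : ∀ j, P j ≠ 0) (hP' : ∀ j, P' j ≠ 0) (hQ : ∀ j, Q j ≠ 0) (hR : ∀ j, R j ≠ 0)
    (hf : X.f = P 0 * Q 0 * R 0 / (P 2 * Q 2 * R 2))
    (hg : X.g = P 1 * Q 1 * R 1 / (P 2 * Q 2 * R 2)) :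
    reflDenomE6 X ≠ 0 ∧ (reflE6 3 X).f = P' 0 * Q 0 * R 0 / (P' 2 * Q 2 * R 2) ∧
      (reflE6 3 X).g = P' 1 * Q 1 * R 1 / (P' 2 * Q 2 * R 2) := by
  have ha0 : a ≠ 0 := by
    rw [← ha]
    exact pow_ne_zero 3 (hX 3)
  have h0 : κ * e 0 * (Q 0 * R 0) = P' 2 * P 1 - a * (P 2 * P' 1) := h 0
  have h1 : κ * e 1 * (Q 1 * R 1) = P' 0 * P 2 - a * (P 0 * P' 2) := h 1
  have h2 : κ * e 2 * (Q 2 * R 2) = P' 1 * P 0 - a * (P 1 * P' 0) := h 2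
  have p0 := hP 0; have p1 := hP 1; have p2 := hP 2
  have p0' := hP' 0; have p1' := hP' 1; have p2' := hP' 2
  have q2 := hQ 2; have r2 := hR 2
  -- Weights 1, a², a make the mixed terms cancel in pairs around the cycle and leave the factor 1 -
  -- a³. The two numerators are obtained by permuting these weights cyclically.
  have hd : κ * reflDenomE6 X * (a * (P 2 * Q 2 * R 2)) = (1 - a ^ 3) * (P' 2 * P 0 * P 1) := by
    rw [reflDenomE6, hx, hy, hz, ha, hf, hg]
    field_simp
    linear_combination P 0 * h0 + a ^ 2 * P 1 * h1 + a * P 2 * h2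
  have hnf : κ * (e 0 * X.f + a⁻¹ * e 1 * X.g + a * e 2) * (a * (P 2 * Q 2 * R 2)) =
      (1 - a ^ 3) * (P' 0 * P 1 * P 2) := by
    rw [hf, hg]
    field_simp
    linear_combination a * P 0 * h0 + P 1 * h1 + a ^ 2 * P 2 * h2
  have hng : κ * (a * e 0 * X.f + e 1 * X.g + a⁻¹ * e 2) * (a * (P 2 * Q 2 * R 2)) =
      (1 - a ^ 3) * (P' 1 * P 0 * P 2) := by
    rw [hf, hg]
    field_simp
    linear_combination a ^ 2 * P 0 * h0 + a * P 1 * h1 + P 2 * h2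
  have ha3' : 1 - a ^ 3 ≠ 0 := sub_ne_zero.2 (Ne.symm ha3)
  -- The identity for the denominator yields κ ≠ 0 at the same time, so it need not be assumed.
  have hD : κ * reflDenomE6 X ≠ 0 := by
    intro h
    rw [h, zero_mul] at hd
    exact mul_ne_zero ha3' (mul_ne_zero (mul_ne_zero p2' p0) p1) hd.symm
  have hκ := left_ne_zero_of_mul hD
  have hD' := right_ne_zero_of_mul hD
  have hM : a * (P 2 * Q 2 * R 2) ≠ 0 := mul_ne_zero ha0 (mul_ne_zero (mul_ne_zero p2 q2) r2)
  refine ⟨hD', ?_, ?_⟩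
  · have e1 : (reflE6 3 X).f =
        X.f * ((e 0 * X.f + a⁻¹ * e 1 * X.g + a * e 2) / reflDenomE6 X) := by
      simp only [reflE6, if_pos, reflDenomE6, hx, hy, hz, ha]
    have e2 : (e 0 * X.f + a⁻¹ * e 1 * X.g + a * e 2) / reflDenomE6 X =
        P' 0 * P 2 / (P' 2 * P 0) := by
      rw [div_eq_div_iff hD' (mul_ne_zero p2' p0)]
      apply mul_left_cancel₀ (mul_ne_zero (mul_ne_zero hκ hM) p1)
      linear_combination (P' 2 * P 0 * P 1) * hnf - (P' 0 * P 1 * P 2) * hd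
    rw [e1, e2, hf]
    field_simp
  · have e1 : (reflE6 3 X).g =
        X.g * ((a * e 0 * X.f + e 1 * X.g + a⁻¹ * e 2) / reflDenomE6 X) := by
      simp only [reflE6, if_pos, reflDenomE6, hx, hy, hz, ha]
    have e2 : (a * e 0 * X.f + e 1 * X.g + a⁻¹ * e 2) / reflDenomE6 X =
        P' 1 * P 2 / (P' 2 * P 1) := by
      rw [div_eq_div_iff hD' (mul_ne_zero p2' p1)]
      apply mul_left_cancel₀ (mul_ne_zero (mul_ne_zero hκ hM) p0)
      linear_combination (P' 2 * P 0 * P 1) * hng - (P' 1 * P 0 * P 2) * hd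
    rw [e1, e2, hg]
    field_simp

/-- The translation `ℓ`, by reflections of points. -/
def translE6 (X : E6Point K) : E6Point K :=
  reflInner (reflOuter (reflE6 3 (reflInner (reflE6 3
    (reflInner (reflOuter (reflE6 3 (reflInner (reflE6 3 X)))))))))

theorem ellE6_eq : ellE6 = translE6 genericE6 := by
  simp only [ellE6, ellWord, List.foldr, translE6, reflInner, reflOuter]

variable {X : E6Point K}

theorem translE6_second_α (hX : ∀ j, X.α j ≠ 0) :
    (reflInner (reflE6 3 X)).α =
      ![X.α 0 * X.α 6 * X.α 3, X.α 1 * X.α 2 * X.α 3, (X.α 2 * X.α 3)⁻¹,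
        X.α 2 * X.α 4 * X.α 6 * X.α 3 ^ 2, (X.α 4 * X.α 3)⁻¹, X.α 5 * X.α 4 * X.α 3,
        (X.α 6 * X.α 3)⁻¹] := by
  have h3 := hX 3
  rw [reflInner_α _ (reflE6_α_ne_zero hX 3), reflE6_three_α X hX]
  funext j
  fin_cases j <;> simp <;> field_simp

theorem translE6_third_α (hX : ∀ j, X.α j ≠ 0) :
    (reflInner (reflOuter (reflE6 3 (reflInner (reflE6 3 X))))).α =
      ![X.α 2 * X.α 4 * X.α 3, X.α 4 * X.α 6 * X.α 3,
        (X.α 1 * (X.α 2 * X.α 4 * X.α 6 * X.α 3 ^ 2))⁻¹,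
        X.α 0 * X.α 1 * X.α 5 * (X.α 2 * X.α 4 * X.α 6) ^ 2 * X.α 3 ^ 4,
        (X.α 5 * (X.α 2 * X.α 4 * X.α 6 * X.α 3 ^ 2))⁻¹, X.α 2 * X.α 6 * X.α 3,
        (X.α 0 * (X.α 2 * X.α 4 * X.α 6 * X.α 3 ^ 2))⁻¹] := by
  have h1 := reflInner_α_ne_zero (reflE6_α_ne_zero hX 3)
  have h2 := reflE6_α_ne_zero h1 3
  have h0 := hX 0; have h01 := hX 1; have h02 := hX 2; have h03 := hX 3
  have h04 := hX 4; have h05 := hX 5; have h06 := hX 6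
  rw [reflInner_α _ (reflOuter_α_ne_zero h2), reflOuter_α _ h2, reflE6_three_α _ h1,
    translE6_second_α hX]
  funext j
  fin_cases j <;> simp <;> field_simp

theorem translE6_fourth_α (hX : ∀ j, X.α j ≠ 0) :
    (reflInner (reflE6 3 (reflInner (reflOuter (reflE6 3 (reflInner (reflE6 3 X))))))).α =
      ![X.α 2 * X.α 4 * X.α 3 * (X.α 1 * X.α 5 * (X.α 2 * X.α 4 * X.α 6 * X.α 3 ^ 2)),
        X.α 4 * X.α 6 * X.α 3 * (X.α 0 * X.α 5 * (X.α 2 * X.α 4 * X.α 6 * X.α 3 ^ 2)),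
        (X.α 0 * X.α 5 * (X.α 2 * X.α 4 * X.α 6 * X.α 3 ^ 2))⁻¹,
        X.α 0 * X.α 1 * X.α 5 * (X.α 2 * X.α 4 * X.α 6) * X.α 3 ^ 2,
        (X.α 0 * X.α 1 * (X.α 2 * X.α 4 * X.α 6 * X.α 3 ^ 2))⁻¹,
        X.α 2 * X.α 6 * X.α 3 * (X.α 0 * X.α 1 * (X.α 2 * X.α 4 * X.α 6 * X.α 3 ^ 2)),
        (X.α 1 * X.α 5 * (X.α 2 * X.α 4 * X.α 6 * X.α 3 ^ 2))⁻¹] := by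
  have h1 := reflInner_α_ne_zero
    (reflOuter_α_ne_zero (reflE6_α_ne_zero (reflInner_α_ne_zero (reflE6_α_ne_zero hX 3)) 3))
  have h0 := hX 0; have h01 := hX 1; have h02 := hX 2; have h03 := hX 3
  have h04 := hX 4; have h05 := hX 5; have h06 := hX 6
  rw [reflInner_α _ (reflE6_α_ne_zero h1 3), reflE6_three_α _ h1, translE6_third_α hX]
  funext j
  fin_cases j <;> simp <;> field_simp <;> simp

/-- The four occurrences of s_3, from the right end of the word, replace U by U', V by V', W by W'
and V' by V''. The reflections in between change only the parameters. The second and fourth s_3 see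
the same coefficients c_x, c_y, c_z, hence share e₁. -/
theorem translE6_of_bilinear [Algebra ℂ K] {a₁ a₂ a₃ a₄ κ₁ κ₂ κ₃ κ₄ : K}
    {e₀ e₁ e₂ U V W U' V' W' V'' : Fin 3 → K} (hX : ∀ j, X.α j ≠ 0)
    (hU : ∀ j, U j ≠ 0) (hV : ∀ j, V j ≠ 0) (hW : ∀ j, W j ≠ 0) (hU' : ∀ j, U' j ≠ 0)
    (hV' : ∀ j, V' j ≠ 0) (hW' : ∀ j, W' j ≠ 0) (hV'' : ∀ j, V'' j ≠ 0)
    (b₁ : BilinearE6 a₁ κ₁ e₀ U U' V W) (b₂ : BilinearE6 a₂ κ₂ e₁ V V' W U')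
    (b₃ : BilinearE6 a₃ κ₃ e₂ W W' U' V') (b₄ : BilinearE6 a₄ κ₄ e₁ V' V'' W' U')
    (ha₁ : X.α 3 ^ 3 = a₁) (ha₂ : (X.α 2 * X.α 4 * X.α 6 * X.α 3 ^ 2) ^ 3 = a₂)
    (ha₃ : (X.α 0 * X.α 1 * X.α 5 * (X.α 2 * X.α 4 * X.α 6) ^ 2 * X.α 3 ^ 4) ^ 3 = a₃)
    (ha₄ : (X.α 0 * X.α 1 * X.α 5 * (X.α 2 * X.α 4 * X.α 6) * X.α 3 ^ 2) ^ 3 = a₄)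
    (n₁ : a₁ ^ 3 ≠ 1) (n₂ : a₂ ^ 3 ≠ 1) (n₃ : a₃ ^ 3 ≠ 1) (n₄ : a₄ ^ 3 ≠ 1)
    (hx₀ : X.α 1 * X.α 2 ^ 2 / (X.α 4 ^ 2 * X.α 5) = e₀ 0)
    (hy₀ : X.α 5 * X.α 4 ^ 2 / (X.α 6 ^ 2 * X.α 0) = e₀ 1)
    (hz₀ : X.α 0 * X.α 6 ^ 2 / (X.α 2 ^ 2 * X.α 1) = e₀ 2)
    (hx₁ : X.α 1 * X.α 4 / (X.α 2 * X.α 5) = e₁ 0)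
    (hy₁ : X.α 5 * X.α 6 / (X.α 4 * X.α 0) = e₁ 1)
    (hz₁ : X.α 0 * X.α 2 / (X.α 6 * X.α 1) = e₁ 2)
    (hx₂ : X.α 4 * X.α 5 ^ 2 / (X.α 2 * X.α 1 ^ 2) = e₂ 0)
    (hy₂ : X.α 6 * X.α 0 ^ 2 / (X.α 4 * X.α 5 ^ 2) = e₂ 1)
    (hz₂ : X.α 2 * X.α 1 ^ 2 / (X.α 6 * X.α 0 ^ 2) = e₂ 2)
    (hf : X.f = U 0 * V 0 * W 0 / (U 2 * V 2 * W 2))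
    (hg : X.g = U 1 * V 1 * W 1 / (U 2 * V 2 * W 2))
    {k : ℕ} {Y : E6Point (RatFun k)} {x : Fin k → K} (hY : HasValueE6 Y x X) :
    HasValueAt (translE6 Y).f x (U' 0 * V'' 0 * W' 0 / (U' 2 * V'' 2 * W' 2)) ∧
      HasValueAt (translE6 Y).g x (U' 1 * V'' 1 * W' 1 / (U' 2 * V'' 2 * W' 2)) := by
  have i0 := hX 0; have i1 := hX 1; have i2 := hX 2; have i3 := hX 3
  have i4 := hX 4; have i5 := hX 5; have i6 := hX 6
  obtain ⟨d₁, f₁, g₁⟩ := reflE6_three_of_bilinear hX ha₁ n₁ b₁ hx₀ hy₀ hz₀ hU hU' hV hW hf hg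
  have hY₁ := hY.reflE6 hX 3 fun _ => d₁
  have hX₁ := reflE6_α_ne_zero hX 3
  have hY₂ := hY₁.reflInner hX₁
  have hX₂ := reflInner_α_ne_zero hX₁
  have α₂ := translE6_second_α hX
  have α₃ := translE6_third_α hX
  have α₄ := translE6_fourth_α hX
  have F₂ := reflInner_f (reflE6 3 X)
  have G₂ := reflInner_g (reflE6 3 X)
  rw [f₁] at F₂
  rw [g₁] at G₂
  -- From here on the intermediate point matters only through its parameters and the product
  -- formulas for f and g.
  generalize reflInner (reflE6 3 X) = X₂ at *
  obtain ⟨d₂, f₂, g₂⟩ := reflE6_three_of_bilinear (X := X₂) hX₂ (by rw [α₂]; exact ha₂) n₂ b₂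
    (by rw [α₂, ← hx₁]; simp; field_simp) (by rw [α₂, ← hy₁]; simp; field_simp)
    (by rw [α₂, ← hz₁]; simp; field_simp) hV hV' hW hU'
    (by rw [F₂]; ring) (by rw [G₂]; ring)
  have hY₃ := hY₂.reflE6 hX₂ 3 fun _ => d₂
  have hX₃ := reflE6_α_ne_zero hX₂ 3
  have hY₄ := (hY₃.reflOuter hX₃).reflInner (reflOuter_α_ne_zero hX₃)
  have hX₄ := reflInner_α_ne_zero (reflOuter_α_ne_zero hX₃)
  have F₄ : (reflInner (reflOuter (reflE6 3 X₂))).f = _ := f₂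
  have G₄ : (reflInner (reflOuter (reflE6 3 X₂))).g = _ := g₂
  generalize reflInner (reflOuter (reflE6 3 X₂)) = X₄ at *
  obtain ⟨d₃, f₃, g₃⟩ := reflE6_three_of_bilinear (X := X₄) hX₄ (by rw [α₃]; exact ha₃) n₃ b₃
    (by rw [α₃, ← hx₂]; simp; field_simp) (by rw [α₃, ← hy₂]; simp; field_simp)
    (by rw [α₃, ← hz₂]; simp; field_simp) hW hW' hU' hV'
    (by rw [F₄]; ring) (by rw [G₄]; ring)
  have hY₅ := hY₄.reflE6 hX₄ 3 fun _ => d₃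
  have hX₅ := reflE6_α_ne_zero hX₄ 3
  have hY₆ := hY₅.reflInner hX₅
  have hX₆ := reflInner_α_ne_zero hX₅
  have F₆ : (reflInner (reflE6 3 X₄)).f = _ := f₃
  have G₆ : (reflInner (reflE6 3 X₄)).g = _ := g₃
  generalize reflInner (reflE6 3 X₄) = X₆ at *
  obtain ⟨d₄, f₄, g₄⟩ := reflE6_three_of_bilinear (X := X₆) hX₆ (by rw [α₄]; exact ha₄) n₄ b₄
    (by rw [α₄, ← hx₁]; simp; field_simp) (by rw [α₄, ← hy₁]; simp; field_simp)
    (by rw [α₄, ← hz₁]; simp; field_simp) hV' hV'' hW' hU'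
    (by rw [F₆]; ring) (by rw [G₆]; ring)
  have hY₇ := hY₆.reflE6 hX₆ 3 fun _ => d₄
  have hX₇ := reflE6_α_ne_zero hX₆ 3
  have hY₈ := (hY₇.reflOuter hX₇).reflInner (reflOuter_α_ne_zero hX₇)
  have hF : (reflInner (reflOuter (reflE6 3 X₆))).f = _ := f₄
  have hG : (reflInner (reflOuter (reflE6 3 X₆))).g = _ := g₄
  obtain ⟨-, hF', hG'⟩ := hY₈
  rw [hF] at hF'
  rw [hG] at hG'
  refine ⟨?_, ?_⟩
  · convert! hF' using 1
    ring
  · convert! hG' using 1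
    ring

end Reflections

end TypeE

end

noncomputable section

/-! ### Bilinear relations in type E -/

section TypeE

section Bilinear

variable {K : Type*} [Field K] [CharZero K]

/-- The universal characters in three variables, attached to the pair `λ(m(j+c))`, `λ(n(-j+c))` of
`3`-cores. -/
def tauE (m n : ZMod 3 → ℤ) (q : K) (c j : ℤ) (x y z : K) : K :=
  coreTau (varPair q ![x, y, z] ![]) (coreShift m (j + c)) (coreShift n (-j + c))

theorem coreTau_add_three_left (p : (ℕ → K) × (ℕ → K)) (m n : ZMod 3 → ℤ) {i i' : ℤ}
    (h : i' = i + 3) : coreTau p (coreShift m i') n = coreTau p (coreShift m i) n := by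
  rw [h]
  exact coreTau_add_period_left p m n i

theorem coreTau_add_three_right (p : (ℕ → K) × (ℕ → K)) (m n : ZMod 3 → ℤ) {i i' : ℤ}
    (h : i' = i + 3) : coreTau p m (coreShift n i') = coreTau p m (coreShift n i) := by
  rw [h]
  exact coreTau_add_period_right p m n i

theorem tauE_add_three_class (m n : ZMod 3 → ℤ) (q : K) (c j : ℤ) (x y z : K) :
    tauE m n q (c + 3) j x y z = tauE m n q c j x y z := by
  rw [tauE, tauE, coreTau_add_three_left _ _ _ (i := j + c) (by ring),
    coreTau_add_three_right _ _ _ (i := -j + c) (by ring)]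

theorem tauE_add_three (m n : ZMod 3 → ℤ) (q : K) (c j : ℤ) (x y z : K) :
    tauE m n q c (j + 3) x y z = tauE m n q c j x y z := by
  rw [tauE, tauE, coreTau_add_three_left _ _ _ (i := j + c) (by ring),
    ← coreTau_add_three_right _ _ _ (i := -(j + 3) + c) (i' := -j + c) (by ring)]

theorem varPair_three_swap (q x y z : K) {l : ℕ} (tJ : Fin l → K) :
    varPair q ![x, y, z] tJ = varPair q ![y, x, z] tJ := by
  refine Prod.ext (funext fun n => ?_) (funext fun n => ?_) <;>
    simp [varPair, powerVar, Fin.sum_univ_three, add_comm]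

theorem varPair_three_rotate (q x y z : K) {l : ℕ} (tJ : Fin l → K) :
    varPair q ![x, y, z] tJ = varPair q ![y, z, x] tJ := by
  refine Prod.ext (funext fun n => ?_) (funext fun n => ?_) <;>
    simp only [varPair, powerVar, Fin.sum_univ_three, Matrix.cons_val_zero, Matrix.cons_val_one,
      Matrix.cons_val] <;> ring

theorem tauE_swap (m n : ZMod 3 → ℤ) (q : K) (c j : ℤ) (x y z : K) :
    tauE m n q c j x y z = tauE m n q c j y x z := by
  rw [tauE, varPair_three_swap, tauE]

theorem tauE_rotate (m n : ZMod 3 → ℤ) (q : K) (c j : ℤ) (x y z : K) :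
    tauE m n q c j x y z = tauE m n q c j y z x := by
  rw [tauE, varPair_three_rotate, tauE]

theorem shiftRel_three {q x y z : K} (hq : ∀ k : ℕ, 0 < k → q ^ k ≠ 1) :
    ShiftRel x (varPair q ![x, y, z] ![]) (varPair q ![q * x, y, z] ![]) := by
  apply shiftRel_varPair hq <;> intro n <;> simp [Fin.sum_univ_three, mul_pow] <;> ring

theorem shiftRel_three' {q x y z : K} (hq : ∀ k : ℕ, 0 < k → q ^ k ≠ 1) :
    ShiftRel y (varPair q ![x, y, z] ![]) (varPair q ![x, q * y, z] ![]) := by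
  rw [varPair_three_swap q x y, varPair_three_swap q x (q * y)]
  exact shiftRel_three hq

/-- The exponents of the bilinear relations of type `E`. -/
def expE6 (m n : ZMod 3 → ℤ) (c j : ℤ) : ℤ :=
  3 * (n ((c + 2 - j : ℤ) : ZMod 3) - m ((c + 2 + j : ℤ) : ZMod 3)) + vecSum m - vecSum n

theorem expE6_eq (m n : ZMod 3 → ℤ) (c j : ℤ) : expE6 m n c j =
    coreWeight (coreShift m (j + c + 1)) - coreWeight (coreShift n (-j + c + 1)) -
      (coreWeight (coreShift m (j + c + 1 + 1)) - coreWeight (coreShift n (-j + c + 1 + 1))) := by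
  have hm := coreWeight_coreShift_succ m (j + c + 1)
  have hn := coreWeight_coreShift_succ n (-j + c + 1)
  rw [show j + c + 1 + 1 = c + 2 + j by ring] at hm ⊢
  rw [show -j + c + 1 + 1 = c + 2 - j by ring] at hn ⊢
  rw [hm, hn, expE6]
  generalize coreWeight (coreShift m _) = w
  generalize coreWeight (coreShift n _) = w'
  generalize n _ = a
  generalize m _ = b
  push_cast
  ring

theorem zpow_expE6 (m n : ZMod 3 → ℤ) {s : K} (hs : s ≠ 0) (c j : ℤ) : s ^ expE6 m n c j =
    s ^ (coreWeight (coreShift m (j + c + 1)) - coreWeight (coreShift n (-j + c + 1))) *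
      s⁻¹ ^ (coreWeight (coreShift m (j + c + 1 + 1)) -
        coreWeight (coreShift n (-j + c + 1 + 1))) := by
  rw [inv_zpow', ← zpow_add₀ hs, expE6_eq, sub_eq_add_neg]

/-- The singly shifted variables have product qxyz. The doubly shifted and the unshifted triple are
rescaled by s = q^{1/3} so that their products become qxyz too; then all six functions can be
matched with the normal form of product 1. -/
theorem tauE_bilinear (m n : ZMod 3 → ℤ) {q s : K} (hs : s ≠ 0) (hsq : s ^ 3 = q)
    (hq : ∀ k : ℕ, 0 < k → q ^ k ≠ 1) {x y z : K} (hx : x ≠ 0) (hy : y ≠ 0) (c j : ℤ) :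
    (y - x) * s ^ expE6 m n c j *
        (tauE m n q (c + 1) j (s ^ 2 * x) (s ^ 2 * y) (s⁻¹ * z) *
          tauE m n q (c + 2) j (s * x) (s * y) (s * z)) =
      y * (tauE m n q c (j - 1) (q * x) y z * tauE m n q c (j + 1) x (q * y) z) -
      x * (tauE m n q c (j - 1) x (q * y) z * tauE m n q c (j + 1) (q * x) y z) := by
  -- The index of the first core is started at j + c - 2 ≡ j + c + 1 mod 3, so that the mixed terms
  -- fall into class c with j - 1 and j + 1, and the outer ones into classes c + 1 and c + 2 with j.
  have h := coreTau_bilinear hx hy (p := varPair q ![x, y, z] ![]) (shiftRel_three hq)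
    (shiftRel_three' hq) (shiftRel_three' (z := z) hq) m n (j + c - 2) (-j + c + 1)
  rw [← coreTau_add_three_left (varPair q ![q * x, q * y, z] ![]) m _ (i := j + c - 2)
      (i' := j + c + 1) (by ring),
    ← coreTau_add_three_left (varPair q ![x, y, z] ![]) m _ (i := j + c - 2 + 1)
      (i' := j + c + 1 + 1) (by ring),
    ← coreTau_add_three_left (varPair q ![x, q * y, z] ![]) m _ (i := j + c - 2)
      (i' := j + 1 + c) (by ring),
    ← coreTau_add_three_left (varPair q ![q * x, y, z] ![]) m _ (i := j + c - 2)
      (i' := j + 1 + c) (by ring),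
    coreTau_add_three_right (varPair q ![x, q * y, z] ![]) _ n (i := -(j + 1) + c)
      (i' := -j + c + 1 + 1) (by ring),
    coreTau_add_three_right (varPair q ![q * x, y, z] ![]) _ n (i := -(j + 1) + c)
      (i' := -j + c + 1 + 1) (by ring)] at h
  have e₁ := coreTau_scale q hs (tI := ![s ^ 2 * x, s ^ 2 * y, s⁻¹ * z])
    (tI' := ![q * x, q * y, z]) (tJ := ![]) (tJ' := ![])
    (by
      rw [← hsq]
      simp only [Fin.forall_fin_succ, Matrix.cons_val_zero, Matrix.cons_val_succ]
      exact ⟨by ring, by ring, by field_simp, fun i => i.elim0⟩)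
    (fun i => i.elim0) (coreShift m (j + c + 1)) (coreShift n (-j + c + 1))
  have e₂ := coreTau_scale q (inv_ne_zero hs) (tI := ![s * x, s * y, s * z])
    (tI' := ![x, y, z]) (tJ := ![]) (tJ' := ![])
    (by
      simp only [Fin.forall_fin_succ, Matrix.cons_val_zero, Matrix.cons_val_succ]
      exact ⟨by field_simp, by field_simp, by field_simp, fun i => i.elim0⟩)
    (fun i => i.elim0) (coreShift m (j + c + 1 + 1)) (coreShift n (-j + c + 1 + 1))
  have he := zpow_expE6 m n hs c j
  rw [e₁, e₂, show j + c - 2 + 1 = j - 1 + c by ring, show -j + c + 1 = -(j - 1) + c by ring] at h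
  rw [he, tauE, tauE, tauE, tauE, tauE, tauE, show j + (c + 1) = j + c + 1 by ring,
    show j + (c + 2) = j + c + 1 + 1 by ring, show -j + (c + 1) = -(j - 1) + c by ring,
    show -j + (c + 2) = -(j - 1) + c + 1 by ring, show -j + c + 1 = -(j - 1) + c by ring]
  linear_combination h

/-- The triples of universal characters of type `E`. -/
def triE (m n : ZMod 3 → ℤ) (q : K) (c : ℤ) (x y z : K) (j : Fin 3) : K :=
  tauE m n q c ((j : ℕ) + 1 : ℤ) x y z

theorem triE_add_three (m n : ZMod 3 → ℤ) (q : K) (c : ℤ) (x y z : K) :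
    triE m n q (c + 3) x y z = triE m n q c x y z := by
  funext j
  rw [triE, triE, tauE_add_three_class]

theorem triE_swap (m n : ZMod 3 → ℤ) (q : K) (c : ℤ) (x y z : K) :
    triE m n q c x y z = triE m n q c y x z := by
  funext j
  rw [triE, triE, tauE_swap]

theorem triE_rotate (m n : ZMod 3 → ℤ) (q : K) (c : ℤ) (x y z : K) :
    triE m n q c x y z = triE m n q c y z x := by
  funext j
  rw [triE, triE, tauE_rotate]

theorem bilinearE6_triE (m n : ZMod 3 → ℤ) {q s : K} (hs : s ≠ 0) (hsq : s ^ 3 = q)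
    (hq : ∀ k : ℕ, 0 < k → q ^ k ≠ 1) {x y z : K} (hx : x ≠ 0) (hy : y ≠ 0) {c : ℤ}
    {P P' Q R : Fin 3 → K} (hP : P = triE m n q c x (q * y) z) (hP' : P' = triE m n q c (q * x) y z)
    (hQ : Q = triE m n q (c + 1) (s ^ 2 * x) (s ^ 2 * y) (s⁻¹ * z))
    (hR : R = triE m n q (c + 2) (s * x) (s * y) (s * z)) {r : K} (hr : r = x / y) :
    ∃ κ, BilinearE6 r κ (fun j => s ^ expE6 m n c ((j : ℕ) + 1 : ℤ)) P P' Q R := by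
  have key : ∀ j : ℤ, ∀ k k' k'' : Fin 3, ((k : ℕ) + 1 : ℤ) = j →
      (tauE m n q c (j - 1) (q * x) y z = P' k' ∧ tauE m n q c (j - 1) x (q * y) z = P k') →
      (tauE m n q c (j + 1) (q * x) y z = P' k'' ∧ tauE m n q c (j + 1) x (q * y) z = P k'') →
      (y - x) / y * s ^ expE6 m n c j * (Q k * R k) = P' k' * P k'' - x / y * (P k' * P' k'') := by
    rintro j k k' k'' rfl ⟨h1, h2⟩ ⟨h3, h4⟩
    have h := tauE_bilinear m n hs hsq hq (z := z) hx hy c ((k : ℕ) + 1)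
    rw [h1, h2, h3, h4] at h
    rw [hQ, hR, triE, triE]
    generalize tauE m n q (c + 1) _ _ _ _ = Q₀ at *
    generalize tauE m n q (c + 2) _ _ _ _ = R₀ at *
    field_simp
    linear_combination h
  -- The triple lists the indices 1, 2, 3; the neighbours 0 of 1 and 4 of 3 wrap around.
  have h0 : ∀ x y z : K, tauE m n q c 0 x y z = tauE m n q c 3 x y z :=
    fun x y z => (tauE_add_three m n q c 0 x y z).symm
  have h4 : ∀ x y z : K, tauE m n q c 4 x y z = tauE m n q c 1 x y z :=
    fun x y z => tauE_add_three m n q c 1 x y z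
  refine ⟨(y - x) / y, fun j => ?_⟩
  subst hP hP' hr
  fin_cases j
  · exact key 1 0 2 1 rfl ⟨h0 _ _ _, h0 _ _ _⟩ ⟨rfl, rfl⟩
  · exact key 2 1 0 2 rfl ⟨rfl, rfl⟩ ⟨rfl, rfl⟩
  · exact key 3 2 1 0 rfl ⟨rfl, rfl⟩ ⟨h4 _ _ _, h4 _ _ _⟩

end Bilinear

end TypeE

end

noncomputable section

/-! ### The solution of type E -/

section TypeE

theorem expE6_values (m n : ZMod 3 → ℤ) :
    (expE6 m n 0 1 = 3 * (n 1 - m 3) + vecSum m - vecSum n ∧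
      expE6 m n 0 2 = 3 * (n 3 - m 1) + vecSum m - vecSum n ∧
      expE6 m n 0 3 = 3 * (n 2 - m 2) + vecSum m - vecSum n) ∧
    (expE6 m n 1 1 = 3 * (n 2 - m 1) + vecSum m - vecSum n ∧
      expE6 m n 1 2 = 3 * (n 1 - m 2) + vecSum m - vecSum n ∧
      expE6 m n 1 3 = 3 * (n 3 - m 3) + vecSum m - vecSum n) ∧
    (expE6 m n 2 1 = 3 * (n 3 - m 2) + vecSum m - vecSum n ∧
      expE6 m n 2 2 = 3 * (n 2 - m 3) + vecSum m - vecSum n ∧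
      expE6 m n 2 3 = 3 * (n 1 - m 1) + vecSum m - vecSum n) := by
  refine ⟨⟨?_, ?_, ?_⟩, ⟨?_, ?_, ?_⟩, ⟨?_, ?_, ?_⟩⟩ <;> rfl

theorem vecSum_three (m : ZMod 3 → ℤ) : vecSum m = m 1 + m 2 + m 3 := by
  have : vecSum m = m 0 + m 1 + m 2 := Fin.sum_univ_three m
  rw [this, show (3 : ZMod 3) = 0 from rfl]
  ring

section Solution

variable {K : Type*} [Field K] [CharZero K] (m n : ZMod 3 → ℤ) {ζ A B : K}

theorem zpow_ratio_first (hζ : ζ ≠ 0) (hA : A ≠ 0) (hB : B ≠ 0) (i j k l e : ℤ)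
    (h : i + 2 * j - 2 * k - l = 3 * e) :
    A * ζ ^ i * (B * ζ ^ j) ^ 2 / ((B * ζ ^ k) ^ 2 * (A * ζ ^ l)) = (ζ ^ 3) ^ e := by
  rw [← zpow_natCast ζ 3, ← zpow_mul, Nat.cast_ofNat, ← h, zpow_sub₀ hζ, zpow_sub₀ hζ, zpow_add₀ hζ,
    two_mul, two_mul, zpow_add₀ hζ, zpow_add₀ hζ]
  field_simp

theorem zpow_ratio_second (hζ : ζ ≠ 0) (hA : A ≠ 0) (hB : B ≠ 0) (i j k l e : ℤ)
    (h : i + j - k - l = 3 * e) :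
    A * ζ ^ i * (B * ζ ^ j) / ((B * ζ ^ k) * (A * ζ ^ l)) = (ζ ^ 3) ^ e := by
  rw [← zpow_natCast ζ 3, ← zpow_mul, Nat.cast_ofNat, ← h, zpow_sub₀ hζ, zpow_sub₀ hζ, zpow_add₀ hζ]
  field_simp

theorem zpow_ratio_third (hζ : ζ ≠ 0) (hA : A ≠ 0) (hB : B ≠ 0) (i j k l e : ℤ)
    (h : i + 2 * j - k - 2 * l = 3 * e) :
    B * ζ ^ i * (A * ζ ^ j) ^ 2 / ((B * ζ ^ k) * (A * ζ ^ l) ^ 2) = (ζ ^ 3) ^ e := by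
  rw [← zpow_natCast ζ 3, ← zpow_mul, Nat.cast_ofNat, ← h, zpow_sub₀ hζ, zpow_sub₀ hζ, zpow_add₀ hζ,
    two_mul, two_mul, zpow_add₀ hζ, zpow_add₀ hζ]
  field_simp

theorem paramE6_prod (hζ : ζ ≠ 0) :
    paramE6 m n ζ A B 2 * paramE6 m n ζ A B 4 * paramE6 m n ζ A B 6 = B ^ 3 * ζ⁻¹ ^ 3 ∧
      paramE6 m n ζ A B 0 * paramE6 m n ζ A B 1 * paramE6 m n ζ A B 5 = A ^ 3 := by
  simp only [paramE6, Matrix.cons_val, vecSum_three]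
  constructor
  · rw [inv_pow, ← zpow_natCast ζ 3, ← zpow_neg]
    trans B ^ 3 * (ζ ^ (m 1 + m 2 + m 3 + (n 1 + n 2 + n 3) - 1 - 3 * (m 3 + n 2)) *
      ζ ^ (m 1 + m 2 + m 3 + (n 1 + n 2 + n 3) - 1 - 3 * (m 1 + n 1)) *
      ζ ^ (m 1 + m 2 + m 3 + (n 1 + n 2 + n 3) - 1 - 3 * (m 2 + n 3)))
    · ring
    · rw [← zpow_add₀ hζ, ← zpow_add₀ hζ]
      congr 2
      push_cast
      ring
  · trans A ^ 3 * (ζ ^ (m 1 + m 2 + m 3 + (n 1 + n 2 + n 3) - 3 * (m 3 + n 1)) *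
      ζ ^ (m 1 + m 2 + m 3 + (n 1 + n 2 + n 3) - 3 * (m 1 + n 3)) *
      ζ ^ (m 1 + m 2 + m 3 + (n 1 + n 2 + n 3) - 3 * (m 2 + n 2)))
    · ring
    · rw [← zpow_add₀ hζ, ← zpow_add₀ hζ]
      convert! mul_one (A ^ 3)
      convert! zpow_zero ζ
      ring

theorem solU_eq_tauE (a b : K) (i : ℤ) :
    solU m n ζ a b i = tauE m n (ζ ^ 9) 0 i a⁻¹ b⁻¹ (a * b) := by
  rw [solU, coreR, coreUC_eq_coreTau, tauE, add_zero, add_zero]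

theorem solV_eq_tauE (a b : K) (i : ℤ) : solV m n ζ a b i =
    tauE m n (ζ ^ 9) 1 i (ζ ^ 3 * a)⁻¹ (ζ⁻¹ ^ 6 * b)⁻¹ (ζ ^ 3 * a * (ζ⁻¹ ^ 6 * b)) := by
  rw [solV, coreR, coreUC_eq_coreTau, tauE]

theorem solW_eq_tauE (a b : K) (i : ℤ) : solW m n ζ a b i =
    tauE m n (ζ ^ 9) 2 i (ζ⁻¹ ^ 3 * a)⁻¹ (ζ⁻¹ ^ 3 * b)⁻¹ (ζ⁻¹ ^ 3 * a * (ζ⁻¹ ^ 3 * b)) := by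
  rw [solW, coreR, coreUC_eq_coreTau, tauE]

theorem solU_eq (a b : K) (j : Fin 3) : solU m n ζ a b ((j : ℕ) + 1 : ℤ) =
    triE m n (ζ ^ 9) 0 a⁻¹ b⁻¹ (a * b) j := by
  rw [solU_eq_tauE, triE]

theorem solV_eq (a b : K) (j : Fin 3) : solV m n ζ a b ((j : ℕ) + 1 : ℤ) =
    triE m n (ζ ^ 9) 1 (ζ ^ 3 * a)⁻¹ (ζ⁻¹ ^ 6 * b)⁻¹ (ζ ^ 3 * a * (ζ⁻¹ ^ 6 * b)) j := by
  rw [solV_eq_tauE, triE]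

theorem solW_eq (a b : K) (j : Fin 3) : solW m n ζ a b ((j : ℕ) + 1 : ℤ) =
    triE m n (ζ ^ 9) 2 (ζ⁻¹ ^ 3 * a)⁻¹ (ζ⁻¹ ^ 3 * b)⁻¹ (ζ⁻¹ ^ 3 * a * (ζ⁻¹ ^ 3 * b)) j := by
  rw [solW_eq_tauE, triE]

variable {m n} in
-- In each case x, y, z are chosen with xyz = q⁻¹, and moving the factor q from y to x takes the
-- triple to be replaced to its partner. Symmetry in the three variables and periodicity of the
-- class identify the other functions.
theorem bilinearE6_solution (hζ : ζ ≠ 0) (hq : ∀ k : ℕ, 0 < k → (ζ ^ 9) ^ k ≠ 1) {a b : K}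
    (ha : a ≠ 0) (hb : b ≠ 0) {U V W U' V' W' V'' : Fin 3 → K}
    (hU : U = triE m n (ζ ^ 9) 0 a⁻¹ b⁻¹ (a * b))
    (hV : V = triE m n (ζ ^ 9) 1 (ζ ^ 3 * a)⁻¹ (ζ⁻¹ ^ 6 * b)⁻¹ (ζ ^ 3 * a * (ζ⁻¹ ^ 6 * b)))
    (hW : W = triE m n (ζ ^ 9) 2 (ζ⁻¹ ^ 3 * a)⁻¹ (ζ⁻¹ ^ 3 * b)⁻¹ (ζ⁻¹ ^ 3 * a * (ζ⁻¹ ^ 3 * b)))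
    (hU' : U' = triE m n (ζ ^ 9) 0 a⁻¹ (ζ⁻¹ ^ 9 * b)⁻¹ (a * (ζ⁻¹ ^ 9 * b)))
    (hV' : V' = triE m n (ζ ^ 9) 1 (ζ⁻¹ ^ 6 * a)⁻¹ (ζ⁻¹ ^ 6 * b)⁻¹ (ζ⁻¹ ^ 6 * a * (ζ⁻¹ ^ 6 * b)))
    (hW' : W' = triE m n (ζ ^ 9) 2 (ζ⁻¹ ^ 3 * a)⁻¹ (ζ⁻¹ ^ 12 * b)⁻¹
      (ζ⁻¹ ^ 3 * a * (ζ⁻¹ ^ 12 * b)))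
    (hV'' : V'' = triE m n (ζ ^ 9) 1 (ζ ^ 3 * a)⁻¹ (ζ⁻¹ ^ 15 * b)⁻¹
      (ζ ^ 3 * a * (ζ⁻¹ ^ 15 * b))) :
    (∃ κ, BilinearE6 (ζ ^ 9 / (a * b ^ 2)) κ
      (fun j => (ζ ^ 3) ^ expE6 m n 0 ((j : ℕ) + 1 : ℤ)) U U' V W) ∧
    (∃ κ, BilinearE6 (ζ ^ 9 / (a ^ 2 * b)) κ
      (fun j => (ζ ^ 3) ^ expE6 m n 1 ((j : ℕ) + 1 : ℤ)) V V' W U') ∧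
    (∃ κ, BilinearE6 (ζ ^ 18 / (a * b ^ 2)) κ
      (fun j => (ζ ^ 3) ^ expE6 m n 2 ((j : ℕ) + 1 : ℤ)) W W' U' V') ∧
    (∃ κ, BilinearE6 (ζ ^ 9 * a / b) κ
      (fun j => (ζ ^ 3) ^ expE6 m n 1 ((j : ℕ) + 1 : ℤ)) V' V'' W' U') := by
  have hs : ζ ^ 3 ≠ 0 := pow_ne_zero 3 hζ
  have hsq : (ζ ^ 3) ^ 3 = ζ ^ 9 := by ring
  have tri : ∀ {c : ℤ} {x y z x' y' z' : K}, x = x' → y = y' → z = z' →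
      triE m n (ζ ^ 9) c x y z = triE m n (ζ ^ 9) c x' y' z' := by
    rintro c x y z x' y' z' rfl rfl rfl
    rfl
  have tri₃ : ∀ {c c' : ℤ} {x y z x' y' z' : K}, c' = c + 3 → x = x' → y = y' → z = z' →
      triE m n (ζ ^ 9) c x y z = triE m n (ζ ^ 9) c' x' y' z' := by
    rintro c c' x y z x' y' z' rfl rfl rfl rfl
    rw [triE_add_three]
  have swap := triE_swap m n (ζ ^ 9)
  have rot := triE_rotate m n (ζ ^ 9)
  subst hU hV hW hU' hV' hW' hV''
  refine ⟨?_, ?_, ?_, ?_⟩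
  -- Here (x, qy, z) = (b⁻¹, ab, a⁻¹) belongs to U, while (qx, y, z) is the same with b replaced by
  -- b/q and belongs to U'.
  · exact bilinearE6_triE m n hs hsq hq (x := b⁻¹) (y := a * b * ζ⁻¹ ^ 9) (z := a⁻¹) (c := 0)
      (by simp [hζ, ha, hb]) (by simp [hζ, ha, hb])
      ((rot _ _ _ _).trans (tri rfl (by field_simp) (by field_simp)))
      ((rot _ _ _ _).trans (tri (by field_simp) (by field_simp) (by field_simp)))
      ((rot _ _ _ _).trans (tri (by field_simp) (by field_simp) (by field_simp)))
      ((rot _ _ _ _).trans (tri (by field_simp) (by field_simp) (by field_simp))) (by field_simp)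
  · exact bilinearE6_triE m n hs hsq hq (x := ζ⁻¹ ^ 3 * a⁻¹) (y := a * b * ζ⁻¹ ^ 12)
      (z := ζ ^ 6 * b⁻¹) (c := 1) (by simp [hζ, ha, hb]) (by simp [hζ, ha, hb])
      ((rot _ _ _ _).trans ((swap _ _ _ _).trans ((rot _ _ _ _).trans ((rot _ _ _ _).trans
        (tri (by field_simp) (by field_simp) (by field_simp))))))
      ((rot _ _ _ _).trans ((swap _ _ _ _).trans ((rot _ _ _ _).trans ((rot _ _ _ _).trans
        (tri (by field_simp) (by field_simp) (by field_simp))))))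
      ((rot _ _ _ _).trans ((swap _ _ _ _).trans ((rot _ _ _ _).trans ((rot _ _ _ _).trans
        (tri (by field_simp) (by field_simp) (by field_simp))))))
      ((rot _ _ _ _).trans ((swap _ _ _ _).trans ((rot _ _ _ _).trans ((rot _ _ _ _).trans
        (tri₃ (by norm_num) (by field_simp) (by field_simp) (by field_simp)))))) (by field_simp)
  · exact bilinearE6_triE m n hs hsq hq (x := ζ ^ 3 * b⁻¹) (y := a * b * ζ⁻¹ ^ 15)
      (z := ζ ^ 3 * a⁻¹) (c := 2) (by simp [hζ, ha, hb]) (by simp [hζ, ha, hb])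
      ((rot _ _ _ _).trans (tri (by field_simp) (by field_simp) (by field_simp)))
      ((rot _ _ _ _).trans (tri (by field_simp) (by field_simp) (by field_simp)))
      ((rot _ _ _ _).trans (tri₃ (by norm_num) (by field_simp) (by field_simp) (by field_simp)))
      ((rot _ _ _ _).trans (tri₃ (by norm_num) (by field_simp) (by field_simp) (by field_simp))) (by field_simp)
  · exact bilinearE6_triE m n hs hsq hq (x := ζ ^ 6 * b⁻¹) (y := ζ⁻¹ ^ 3 * a⁻¹)
      (z := ζ⁻¹ ^ 12 * a * b) (c := 1) (by simp [hζ, ha, hb]) (by simp [hζ, ha, hb])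
      ((swap _ _ _ _).trans (tri (by field_simp) (by field_simp) (by field_simp)))
      ((swap _ _ _ _).trans (tri (by field_simp) (by field_simp) (by field_simp)))
      ((swap _ _ _ _).trans (tri (by field_simp) (by field_simp) (by field_simp)))
      ((swap _ _ _ _).trans (tri₃ (by norm_num) (by field_simp) (by field_simp) (by field_simp))) (by field_simp)

theorem paramE6_three_eq : paramE6 m n ζ A B 3 = ζ ^ 3 * A⁻¹ * B⁻¹ ^ 2 := rfl

theorem paramE6_ne_zero (hζ : ζ ≠ 0) (hA : A ≠ 0) (hB : B ≠ 0) (j : Fin 7) :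
    paramE6 m n ζ A B j ≠ 0 := by
  have h : ∀ k : ℤ, ζ ^ k ≠ 0 := fun k => zpow_ne_zero k hζ
  fin_cases j
  · exact mul_ne_zero hA (h _)
  · exact mul_ne_zero hA (h _)
  · exact mul_ne_zero hB (h _)
  · exact mul_ne_zero (mul_ne_zero (pow_ne_zero 3 hζ) (inv_ne_zero hA))
      (pow_ne_zero 2 (inv_ne_zero hB))
  · exact mul_ne_zero hB (h _)
  · exact mul_ne_zero hA (h _)
  · exact mul_ne_zero hB (h _)

theorem paramE6_center (hζ : ζ ≠ 0) (hA : A ≠ 0) (hB : B ≠ 0) {α : Fin 7 → K}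
    (hα : α = paramE6 m n ζ A B) :
    α 3 ^ 3 = ζ ^ 9 / (A ^ 3 * (B ^ 3) ^ 2) ∧
      (α 2 * α 4 * α 6 * α 3 ^ 2) ^ 3 = ζ ^ 9 / ((A ^ 3) ^ 2 * B ^ 3) ∧
      (α 0 * α 1 * α 5 * (α 2 * α 4 * α 6) ^ 2 * α 3 ^ 4) ^ 3 =
        ζ ^ 18 / (A ^ 3 * (B ^ 3) ^ 2) ∧
      (α 0 * α 1 * α 5 * (α 2 * α 4 * α 6) * α 3 ^ 2) ^ 3 = ζ ^ 9 * A ^ 3 / B ^ 3 := by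
  obtain ⟨h1, h2⟩ := paramE6_prod m n (A := A) (B := B) hζ
  rw [← hα] at h1 h2
  have h3 : α 3 = ζ ^ 3 * A⁻¹ * B⁻¹ ^ 2 := by rw [hα, paramE6_three_eq]
  rw [h1, h2, h3]
  refine ⟨?_, ?_, ?_, ?_⟩ <;> field_simp

/-- A and B cancel from c_x, c_y, c_z at each stage, which become powers of q^{1/3}. Their exponents
agree with those of the bilinear relations because |n| = n_1 + n_2 + n_3. -/
theorem paramE6_ratios (hζ : ζ ≠ 0) (hA : A ≠ 0) (hB : B ≠ 0) {α : Fin 7 → K}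
    (hα : α = paramE6 m n ζ A B) :
    (α 1 * α 2 ^ 2 / (α 4 ^ 2 * α 5) = (ζ ^ 3) ^ expE6 m n 0 1 ∧
      α 5 * α 4 ^ 2 / (α 6 ^ 2 * α 0) = (ζ ^ 3) ^ expE6 m n 0 2 ∧
      α 0 * α 6 ^ 2 / (α 2 ^ 2 * α 1) = (ζ ^ 3) ^ expE6 m n 0 3) ∧
    (α 1 * α 4 / (α 2 * α 5) = (ζ ^ 3) ^ expE6 m n 1 1 ∧
      α 5 * α 6 / (α 4 * α 0) = (ζ ^ 3) ^ expE6 m n 1 2 ∧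
      α 0 * α 2 / (α 6 * α 1) = (ζ ^ 3) ^ expE6 m n 1 3) ∧
    (α 4 * α 5 ^ 2 / (α 2 * α 1 ^ 2) = (ζ ^ 3) ^ expE6 m n 2 1 ∧
      α 6 * α 0 ^ 2 / (α 4 * α 5 ^ 2) = (ζ ^ 3) ^ expE6 m n 2 2 ∧
      α 2 * α 1 ^ 2 / (α 6 * α 0 ^ 2) = (ζ ^ 3) ^ expE6 m n 2 3) := by
  obtain ⟨⟨a1, a2, a3⟩, ⟨b1, b2, b3⟩, ⟨c1, c2, c3⟩⟩ := expE6_values m n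
  have hm := vecSum_three m
  have hn := vecSum_three n
  subst hα
  simp only [paramE6, Matrix.cons_val]
  refine ⟨⟨?_, ?_, ?_⟩, ⟨?_, ?_, ?_⟩, ⟨?_, ?_, ?_⟩⟩
  · exact zpow_ratio_first hζ hA hB _ _ _ _ _ (by rw [a1]; linarith)
  · exact zpow_ratio_first hζ hA hB _ _ _ _ _ (by rw [a2]; linarith)
  · exact zpow_ratio_first hζ hA hB _ _ _ _ _ (by rw [a3]; linarith)
  · exact zpow_ratio_second hζ hA hB _ _ _ _ _ (by rw [b1]; linarith)
  · exact zpow_ratio_second hζ hA hB _ _ _ _ _ (by rw [b2]; linarith)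
  · exact zpow_ratio_second hζ hA hB _ _ _ _ _ (by rw [b3]; linarith)
  · exact zpow_ratio_third hζ hA hB _ _ _ _ _ (by rw [c1]; linarith)
  · exact zpow_ratio_third hζ hA hB _ _ _ _ _ (by rw [c2]; linarith)
  · exact zpow_ratio_third hζ hA hB _ _ _ _ _ (by rw [c3]; linarith)

theorem map_coreR (φ : K →+* K) (a b : K) (i j : ℤ) :
    φ (coreR m n ζ a b i j) = coreR m n (φ ζ) (φ a) (φ b) i j := by
  rw [coreR, coreR, coreUC_eq_coreTau, coreUC_eq_coreTau, coreTau_map, map_pow]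
  congr 2
  · funext i
    fin_cases i <;> simp
  · funext i
    exact i.elim0

theorem hasValueE6_generic [Algebra ℂ K] (X : E6Point K) : HasValueE6 genericE6
    ![X.α 0, X.α 1, X.α 2, X.α 3, X.α 4, X.α 5, X.α 6, X.f, X.g] X := by
  refine ⟨fun j => ?_, hasValueAt_rvar _ 7, hasValueAt_rvar _ 8⟩
  have h := hasValueAt_rvar ![X.α 0, X.α 1, X.α 2, X.α 3, X.α 4, X.α 5, X.α 6, X.f, X.g]
    (Fin.castLE (by norm_num) j)
  fin_cases j <;> exact h

theorem shift_paramE6 [Algebra ℂ K] {σ : K ≃ₐ[ℂ] K} {ζ₀ : ℂ} (hζ₀ : algebraMap ℂ K ζ₀ = ζ)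
    (hσA : σ A = A) (hσB : σ B = ζ⁻¹ ^ 3 * B) (j : Fin 7) : σ (paramE6 m n ζ A B j) =
      algebraMap ℂ K ((ζ₀ ^ 3) ^ ((![0, 0, -1, 2, -1, 0, -1] : Fin 7 → ℤ) j)) *
        paramE6 m n ζ A B j := by
  have hσζ : σ ζ = ζ := by
    rw [← hζ₀]
    exact σ.commutes ζ₀
  have hA' : ∀ k : ℤ, σ (A * ζ ^ k) =
      algebraMap ℂ K ((ζ₀ ^ 3) ^ (0 : ℤ)) * (A * ζ ^ k) := by
    intro k
    rw [map_mul, map_zpow₀, hσζ, hσA, zpow_zero, map_one, one_mul]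
  have hB' : ∀ k : ℤ, σ (B * ζ ^ k) =
      algebraMap ℂ K ((ζ₀ ^ 3) ^ (-1 : ℤ)) * (B * ζ ^ k) := by
    intro k
    rw [map_mul, map_zpow₀, hσζ, hσB, zpow_neg_one, map_inv₀, map_pow, hζ₀]
    ring
  fin_cases j
  · exact hA' _
  · exact hA' _
  · exact hB' _
  · have h : σ (ζ ^ 3 * A⁻¹ * B⁻¹ ^ 2) =
        algebraMap ℂ K ((ζ₀ ^ 3) ^ (2 : ℤ)) * (ζ ^ 3 * A⁻¹ * B⁻¹ ^ 2) := by
      simp only [map_mul, map_pow, map_zpow₀, map_inv₀, hσζ, hσA, hσB, hζ₀, mul_inv, inv_pow,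
        mul_pow, inv_inv]
      rw [zpow_ofNat]
      ring
    exact h
  · exact hB' _
  · exact hA' _
  · exact hB' _

theorem isSolutionE6_of_ne_zero [Algebra ℂ K] {σ : K ≃ₐ[ℂ] K} {ζ₀ : ℂ}
    (hζ₀ : algebraMap ℂ K ζ₀ = ζ) (hζ : ζ ≠ 0) (hq : ∀ k : ℕ, 0 < k → (ζ ^ 9) ^ k ≠ 1)
    (hA : A ≠ 0) (hB : B ≠ 0) (hσA : σ A = A) (hσB : σ B = ζ⁻¹ ^ 3 * B)
    (hnz : ∀ (c k l : ℤ) (j : Fin 3), triE m n (ζ ^ 9) c (ζ ^ k * A ^ 3)⁻¹ (ζ ^ l * B ^ 3)⁻¹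
      (ζ ^ k * A ^ 3 * (ζ ^ l * B ^ 3)) j ≠ 0)
    (n₁ : (ζ ^ 9 / (A ^ 3 * (B ^ 3) ^ 2)) ^ 3 ≠ 1) (n₂ : (ζ ^ 9 / ((A ^ 3) ^ 2 * B ^ 3)) ^ 3 ≠ 1)
    (n₃ : (ζ ^ 18 / (A ^ 3 * (B ^ 3) ^ 2)) ^ 3 ≠ 1) (n₄ : (ζ ^ 9 * A ^ 3 / B ^ 3) ^ 3 ≠ 1) :
    IsSolutionE6 σ (ζ₀ ^ 3) (paramE6 m n ζ A B) (solE6f m n ζ (A ^ 3) (B ^ 3))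
      (solE6g m n ζ (A ^ 3) (B ^ 3)) := by
  have hσζ : σ ζ = ζ := by
    rw [← hζ₀]
    exact σ.commutes ζ₀
  have ha : A ^ 3 ≠ 0 := pow_ne_zero 3 hA
  have hb : B ^ 3 ≠ 0 := pow_ne_zero 3 hB
  have hσb : σ (B ^ 3) = ζ⁻¹ ^ 9 * B ^ 3 := by
    rw [map_pow, hσB]
    ring
  have hσa : σ (A ^ 3) = A ^ 3 := by rw [map_pow, hσA]
  have hσR : ∀ a b : K, ∀ i j, σ (coreR m n ζ a b i j) = coreR m n ζ (σ a) (σ b) i j := by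
    intro a b i j
    have := map_coreR m n (σ : K →+* K) (ζ := ζ) a b i j
    simpa only [RingHom.coe_coe, hσζ] using this
  have hσm₁ : ∀ (k : ℕ) (x : K), σ (ζ ^ k * x) = ζ ^ k * σ x := by
    intro k x
    rw [map_mul, map_pow, hσζ]
  have hσm₂ : ∀ (k : ℕ) (x : K), σ (ζ⁻¹ ^ k * x) = ζ⁻¹ ^ k * σ x := by
    intro k x
    rw [map_mul, map_pow, map_inv₀, hσζ]
  obtain ⟨a₁, a₂, a₃, a₄⟩ := paramE6_center m n hζ hA hB rfl
  obtain ⟨⟨x₀, y₀, z₀⟩, ⟨x₁, y₁, z₁⟩, ⟨x₂, y₂, z₂⟩⟩ := paramE6_ratios m n hζ hA hB rfl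
  have hα := paramE6_ne_zero m n hζ hA hB
  have hP := paramE6_prod m n (A := A) (B := B) hζ
  have hpos : ∀ k : ℕ, ∃ l : ℤ, ζ ^ k = ζ ^ l := fun k => ⟨k, (zpow_natCast ζ k).symm⟩
  have hneg : ∀ k : ℕ, ∃ l : ℤ, ζ⁻¹ ^ k = ζ ^ l :=
    fun k => ⟨-k, by rw [zpow_neg, zpow_natCast, inv_pow]⟩
  have hmix : ∀ (c : ℤ) {u v : K}, (∃ k : ℤ, u = ζ ^ k) → (∃ l : ℤ, v = ζ ^ l) → ∀ j,
      triE m n (ζ ^ 9) c (u * A ^ 3)⁻¹ (v * B ^ 3)⁻¹ (u * A ^ 3 * (v * B ^ 3)) j ≠ 0 := by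
    rintro c _ _ ⟨k, rfl⟩ ⟨l, rfl⟩ j
    exact hnz c k l j
  obtain ⟨⟨κ₁, b₁⟩, ⟨κ₂, b₂⟩, ⟨κ₃, b₃⟩, ⟨κ₄, b₄⟩⟩ :=
    bilinearE6_solution (m := m) (n := n) hζ hq ha hb rfl rfl rfl rfl rfl rfl rfl
  have hchain := translE6_of_bilinear (X := ⟨paramE6 m n ζ A B, solE6f m n ζ (A ^ 3) (B ^ 3),
    solE6g m n ζ (A ^ 3) (B ^ 3)⟩) hα
    (fun j => by
      have := hmix 0 (hpos 0) (hpos 0) j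
      rwa [pow_zero, one_mul, one_mul] at this)
    (hmix 1 (hpos 3) (hneg 6)) (hmix 2 (hneg 3) (hneg 3))
    (fun j => by
      have := hmix 0 (hpos 0) (hneg 9) j
      rwa [pow_zero, one_mul] at this)
    (hmix 1 (hneg 6) (hneg 6)) (hmix 2 (hneg 3) (hneg 12)) (hmix 1 (hpos 3) (hneg 15))
    b₁ b₂ b₃ b₄ a₁ a₂ a₃ a₄ n₁ n₂ n₃ n₄ x₀ y₀ z₀ x₁ y₁ z₁ x₂ y₂ z₂
    (by
      simp only [← solU_eq, ← solV_eq, ← solW_eq]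
      rfl)
    (by
      simp only [← solU_eq, ← solV_eq, ← solW_eq]
      rfl)
    (hasValueE6_generic _)
  rw [← ellE6_eq] at hchain
  -- Since σ(b) = q⁻¹b, the shifts of U, V, W are the functions U', V'', W' reached by the
  -- translation.
  have e₁ : ζ⁻¹ ^ 6 * (ζ⁻¹ ^ 9 * B ^ 3) = ζ⁻¹ ^ 15 * B ^ 3 := by ring
  have e₂ : ζ⁻¹ ^ 3 * (ζ⁻¹ ^ 9 * B ^ 3) = ζ⁻¹ ^ 12 * B ^ 3 := by ring
  obtain ⟨tU, hU⟩ : ∃ t, t = triE m n (ζ ^ 9) 0 (A ^ 3)⁻¹ (ζ⁻¹ ^ 9 * B ^ 3)⁻¹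
    (A ^ 3 * (ζ⁻¹ ^ 9 * B ^ 3)) := ⟨_, rfl⟩
  obtain ⟨tV, hV⟩ : ∃ t, t = triE m n (ζ ^ 9) 1 (ζ ^ 3 * A ^ 3)⁻¹ (ζ⁻¹ ^ 15 * B ^ 3)⁻¹
    (ζ ^ 3 * A ^ 3 * (ζ⁻¹ ^ 15 * B ^ 3)) := ⟨_, rfl⟩
  obtain ⟨tW, hW⟩ : ∃ t, t = triE m n (ζ ^ 9) 2 (ζ⁻¹ ^ 3 * A ^ 3)⁻¹ (ζ⁻¹ ^ 12 * B ^ 3)⁻¹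
    (ζ⁻¹ ^ 3 * A ^ 3 * (ζ⁻¹ ^ 12 * B ^ 3)) := ⟨_, rfl⟩
  have hσU : ∀ j : Fin 3, σ (solU m n ζ (A ^ 3) (B ^ 3) ((j : ℕ) + 1 : ℤ)) = tU j := fun j => by
    rw [solU, hσR, hσa, hσb, ← solU, solU_eq, hU]
  have hσV : ∀ j : Fin 3, σ (solV m n ζ (A ^ 3) (B ^ 3) ((j : ℕ) + 1 : ℤ)) = tV j := fun j => by
    rw [solV, hσR, hσm₁, hσm₂, hσa, hσb, ← solV, solV_eq, e₁, hV]
  have hσW : ∀ j : Fin 3, σ (solW m n ζ (A ^ 3) (B ^ 3) ((j : ℕ) + 1 : ℤ)) = tW j := fun j => by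
    rw [solW, hσR, hσm₂, hσm₂, hσa, hσb, ← solW, solW_eq, e₂, hW]
  have hσf : σ (solE6f m n ζ (A ^ 3) (B ^ 3)) =
      tU 0 * tV 0 * tW 0 / (tU 2 * tV 2 * tW 2) := by
    rw [solE6f, map_div₀, map_mul, map_mul, map_mul, map_mul]
    exact congrArg₂ (· / ·) (congrArg₂ (· * ·) (congrArg₂ (· * ·) (hσU 0) (hσV 0)) (hσW 0))
      (congrArg₂ (· * ·) (congrArg₂ (· * ·) (hσU 2) (hσV 2)) (hσW 2))
  have hσg : σ (solE6g m n ζ (A ^ 3) (B ^ 3)) =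
      tU 1 * tV 1 * tW 1 / (tU 2 * tV 2 * tW 2) := by
    rw [solE6g, map_div₀, map_mul, map_mul, map_mul, map_mul]
    exact congrArg₂ (· / ·) (congrArg₂ (· * ·) (congrArg₂ (· * ·) (hσU 1) (hσV 1)) (hσW 1))
      (congrArg₂ (· * ·) (congrArg₂ (· * ·) (hσU 2) (hσV 2)) (hσW 2))
  rw [← hU, ← hV, ← hW] at hchain
  refine ⟨?_, hα, ?_, ?_, ?_, ?_⟩
  · obtain ⟨h₁, h₂⟩ := hP
    have h₃ := paramE6_three_eq m n (ζ := ζ) (A := A) (B := B)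
    rw [map_pow, hζ₀]
    generalize paramE6 m n ζ A B = α at *
    trans (α 0 * α 1 * α 5) * (α 2 * α 4 * α 6) ^ 2 * α 3 ^ 3
    · ring
    · rw [h₁, h₂, h₃]
      field_simp
  · intro h
    apply pow_ne_zero 3 hζ
    rw [← hζ₀, ← map_pow, h, map_zero]
  · exact shift_paramE6 m n hζ₀ hσA hσB
  · rw [hσf]
    exact hchain.1
  · rw [hσg]
    exact hchain.2

end Solution

section RationalFunctions

variable (m n : ZMod 3 → ℤ) {ζ : ℂ}

theorem tauE_ne_zero (hζ : ζ ≠ 0) (hq : ∀ k : ℕ, 0 < k → ζ ^ k ≠ 1) (c j : ℤ) {a b : ℂ}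
    (ha : a ≠ 0) (hb : b ≠ 0) :
    tauE m n (rconst ζ ^ 9 : RatFun 2) c j (rconst a * rvar 0 ^ 3)⁻¹ (rconst b * rvar 1 ^ 3)⁻¹
      (rconst a * rvar 0 ^ 3 * (rconst b * rvar 1 ^ 3)) ≠ 0 := by
  rw [tauE, ← rconst_pow]
  -- The degeneration B → 0 with u = B³: b⁻¹ dominates in the x-part, and the inverse of ab in the
  -- y-part.
  set x : Fin 2 → ℂ := ![1, 0] with hx
  have hA : HasValueAt (rvar 0 : RatFun 2) x 1 := hasValueAt_rvar x 0
  have hB : HasValueAt (rvar 1 : RatFun 2) x 0 := hasValueAt_rvar x 1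
  have hB3 : HasValueAt (rvar 1 ^ 3 : RatFun 2) x 0 := by simpa using hB.pow 3
  have hA3 : HasValueAt (rconst a * rvar 0 ^ 3 : RatFun 2) x a := by
    simpa using (hasValueAt_rconst x a).mul (hA.pow 3)
  have hb' := hasValueAt_rconst (k := 2) x b
  have hA0 := rvar_ne_zero (k := 2) 0
  have hB1 := rvar_ne_zero (k := 2) 1
  have hB0 := pow_ne_zero 3 (rvar_ne_zero (k := 2) 1)
  have ha0 := rconst_ne_zero (k := 2) ha
  have hb0 := rconst_ne_zero (k := 2) hb
  refine coreTau_ne_zero x (pow_ne_zero 9 hζ) (c := b⁻¹) (c' := (a * b)⁻¹) (u := rvar 1 ^ 3)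
    (vI := ![0, b⁻¹, 0]) (vI' := ![0, 0, (a * b)⁻¹]) (vJ := ![]) (vJ' := ![])
    ?_ (inv_ne_zero hb) (inv_ne_zero (mul_ne_zero ha hb)) hB0 hB3 ?_ (fun i => i.elim0) ?_
    (fun i => i.elim0) ?_ ?_ _ _
  · intro k hk
    rw [← pow_mul]
    exact hq _ (by omega)
  · simp only [Fin.forall_fin_succ, Matrix.cons_val_zero, Matrix.cons_val_succ]
    refine ⟨?_, ?_, ?_, fun i => i.elim0⟩
    · simpa using hB3.mul (hA3.inv ha)
    · have : (rvar 1 ^ 3 * (rconst b * rvar 1 ^ 3)⁻¹ : RatFun 2) = (rconst b)⁻¹ := by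
        field_simp
      rw [this]
      exact hb'.inv hb
    · simpa using hB3.mul (hA3.mul (hb'.mul hB3))
  · simp only [Fin.forall_fin_succ, Matrix.cons_val_zero, Matrix.cons_val_succ, inv_inv]
    refine ⟨?_, ?_, ?_, fun i => i.elim0⟩
    · simpa using hB3.mul hA3
    · simpa using hB3.mul (hb'.mul hB3)
    · have : (rvar 1 ^ 3 * (rconst a * rvar 0 ^ 3 * (rconst b * rvar 1 ^ 3))⁻¹ : RatFun 2) =
          (rconst a * rvar 0 ^ 3 * rconst b)⁻¹ := by
        field_simp
      rw [this]
      exact (hA3.mul hb').inv (mul_ne_zero ha hb)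
  · intro n
    simp [Fin.sum_univ_three]
  · intro n
    simp [Fin.sum_univ_three]

theorem sol_ne_zero_E6 (hζ : ζ ≠ 0) (hq : ∀ k : ℕ, 0 < k → ζ ^ k ≠ 1) (i : ℤ) :
    solU m n (rconst ζ) (rvar 0 ^ 3 : RatFun 2) (rvar 1 ^ 3) i ≠ 0 ∧
      solV m n (rconst ζ) (rvar 0 ^ 3 : RatFun 2) (rvar 1 ^ 3) i ≠ 0 ∧
      solW m n (rconst ζ) (rvar 0 ^ 3 : RatFun 2) (rvar 1 ^ 3) i ≠ 0 := by
  rw [solU_eq_tauE, solV_eq_tauE, solW_eq_tauE]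
  have h := fun (c : ℤ) {a b : ℂ} => tauE_ne_zero m n hζ hq c i (a := a) (b := b)
  have hp : ∀ k : ℕ, ζ ^ k ≠ 0 := fun k => pow_ne_zero k hζ
  have hn : ∀ k : ℕ, ζ⁻¹ ^ k ≠ 0 := fun k => pow_ne_zero k (inv_ne_zero hζ)
  have h0 := h 0 one_ne_zero one_ne_zero
  have h1 := h 1 (hp 3) (hn 6)
  have h2 := h 2 (hn 3) (hn 3)
  have hone : (rconst 1 : RatFun 2) = 1 := map_one _
  simp only [rconst_pow, rconst_inv, hone, one_mul] at h0 h1 h2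
  exact ⟨h0, h1, h2⟩

theorem exists_isSolutionE6 (hζ : ζ ≠ 0) (hq : ∀ k : ℕ, 0 < k → ζ ^ k ≠ 1) :
    ∃ σ : RatFun 2 ≃ₐ[ℂ] RatFun 2, σ (rvar 0) = rvar 0 ∧
      σ (rvar 1) = rconst (ζ ^ (-3 : ℤ)) * rvar 1 ∧
      IsSolutionE6 σ (ζ ^ 3) (paramE6 m n (rconst ζ) (rvar 0) (rvar 1))
        (solE6f m n (rconst ζ) (rvar 0 ^ 3) (rvar 1 ^ 3))
        (solE6g m n (rconst ζ) (rvar 0 ^ 3) (rvar 1 ^ 3)) := by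
  obtain ⟨σ, hσ⟩ := exists_scale ![1, ζ ^ (-3 : ℤ)]
    (by simp [Fin.forall_fin_succ, hζ])
  have hσ0 : σ (rvar 0) = rvar 0 := by simpa [rconst] using hσ 0
  have hσ1 : σ (rvar 1) = rconst (ζ ^ (-3 : ℤ)) * rvar 1 := hσ 1
  have hζ' := rconst_ne_zero (k := 2) hζ
  have hA := rvar_ne_zero (k := 2) 0
  have hB := rvar_ne_zero (k := 2) 1
  have hζ₀ : algebraMap ℂ (RatFun 2) ζ = rconst ζ := by rw [rconst]
  have hσB : σ (rvar 1) = (rconst ζ)⁻¹ ^ 3 * rvar 1 := by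
    rw [hσ1, rconst_zpow, zpow_neg, inv_pow]
    rfl
  have v0 : HasValueAt (rvar 0 : RatFun 2) ![(1 : ℂ), 0] 1 := hasValueAt_rvar _ 0
  have v1 : HasValueAt (rvar 1 : RatFun 2) ![(1 : ℂ), 0] 0 := hasValueAt_rvar _ 1
  have hne : ∀ {F G : RatFun 2} {v w : ℂ}, F ≠ 0 → HasValueAt F ![(1 : ℂ), 0] w →
      HasValueAt G ![(1 : ℂ), 0] v → w = 0 → v ≠ 0 → (G / F) ^ 3 ≠ 1 := by
    rintro F G v w hF0 hF hG rfl hv h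
    rw [div_pow, div_eq_one_iff_eq (pow_ne_zero 3 hF0), ← sub_eq_zero] at h
    exact ((hG.pow 3).sub (hF.pow 3)).ne_zero (by simpa using hv) h
  have w0 := v0.pow 3
  have w1 := v1.pow 3
  have hA3 := pow_ne_zero 3 hA
  have hB3 := pow_ne_zero 3 hB
  have vζ := hasValueAt_rconst (k := 2) ![(1 : ℂ), 0] ζ
  refine ⟨σ, hσ0, hσ1, isSolutionE6_of_ne_zero m n hζ₀ hζ' ?_ hA hB hσ0 hσB
    ?_ ?_ ?_ ?_ ?_⟩
  · intro k hk
    rw [← pow_mul]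
    exact rconst_pow_ne_one hq _ (by omega)
  · intro c k l j
    rw [triE, ← rconst_zpow, ← rconst_zpow]
    exact tauE_ne_zero m n hζ hq c _ (zpow_ne_zero k hζ) (zpow_ne_zero l hζ)
  · exact hne (mul_ne_zero hA3 (pow_ne_zero 2 hB3)) (w0.mul (w1.pow 2)) (vζ.pow 9) (by simp)
      (pow_ne_zero 9 hζ)
  · exact hne (mul_ne_zero (pow_ne_zero 2 hA3) hB3) ((w0.pow 2).mul w1) (vζ.pow 9) (by simp)
      (pow_ne_zero 9 hζ)
  · exact hne (mul_ne_zero hA3 (pow_ne_zero 2 hB3)) (w0.mul (w1.pow 2)) (vζ.pow 18) (by simp)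
      (pow_ne_zero 18 hζ)
  · exact hne hB3 w1 ((vζ.pow 9).mul w0) (by simp) (by simpa using hζ)

/-- A and B are constant multiples of the cube roots of a_0 and a_2, hence algebraic over the
parameters themselves. -/
theorem algebraicIn_paramE6 (hζ : ζ ≠ 0) (F : RatFun 2) :
    AlgebraicIn (Set.range fun j => paramE6 m n (rconst ζ) (rvar 0 : RatFun 2) (rvar 1) j ^ 3)
      F := by
  refine algebraicIn_of_rvar ?_ F
  have key : ∀ (j : Fin 7) (v : RatFun 2) (k : ℤ),
      paramE6 m n (rconst ζ) (rvar 0 : RatFun 2) (rvar 1) j = v * rconst ζ ^ k →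
      AlgebraicIn (Set.range fun j =>
        paramE6 m n (rconst ζ) (rvar 0 : RatFun 2) (rvar 1) j ^ 3) v := by
    intro j v k h
    have h1 := (algebraicIn_of_mem (S := Set.range fun j =>
      paramE6 m n (rconst ζ) (rvar 0 : RatFun 2) (rvar 1) j ^ 3) ⟨j, rfl⟩).of_pow (by norm_num)
    have h2 : v = rconst (ζ ^ (-k)) *
        paramE6 m n (rconst ζ) (rvar 0 : RatFun 2) (rvar 1) j := by
      rw [h, rconst_zpow, zpow_neg]
      have := zpow_ne_zero k (rconst_ne_zero (k := 2) hζ)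
      field_simp
    rw [h2]
    exact IsAlgebraic.mul (algebraicIn_rconst _ _) h1
  rw [Fin.forall_fin_two]
  exact ⟨key 0 _ _ rfl, key 2 _ _ rfl⟩

end RationalFunctions

end TypeE

end

/-! ### The three families together -/

theorem mainTheorem4 :
    -- type `A_{2g+1}^{(1)}`, `q = r ^ (2g+2)`, pairs of `(g+1)`-cores
    (∀ (g : ℕ) (_ : 1 ≤ g) (r : ℂ) (_ : r ≠ 0) (_ : ∀ k : ℕ, 0 < k → r ^ k ≠ 1)
      (m n : ZMod (g + 1) → ℤ) (κ z : RatFun 2) (_ : κ = rvar 0) (_ : z = rvar 1),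
      (∀ j : ℤ, tauA m n (rconst r) κ (rconst r * z) j ≠ 0 ∧
        tauA m n (rconst r) κ ((rconst r)⁻¹ * z) j ≠ 0) ∧
      ∃ σ : RatFun 2 ≃ₐ[ℂ] RatFun 2, σ κ = κ ∧ σ z = rconst (r ^ 2) * z ∧
        IsSolutionA g σ (r ^ (2 * g + 2)) (z ^ (g + 1)) (paramA m n (rconst r) κ)
          (solA m n (rconst r) κ z) ∧
        ∀ j : ℤ, AlgebraicIn (insert (z ^ (g + 1)) (Set.range (paramA m n (rconst r) κ)))
          (solA m n (rconst r) κ z j)) ∧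
    -- type `D_5^{(1)}`, `q = p ^ 2`, pairs of `2`-cores
    (∀ (p : ℂ) (_ : p ≠ 0) (_ : ∀ k : ℕ, 0 < k → p ^ k ≠ 1)
      (m n : ZMod 2 → ℤ) (α β x γ δ : RatFun 3)
      (_ : α = rvar 0) (_ : β = rvar 1) (_ : x = rvar 2)
      (_ : γ = rconst (p ^ (2 * n 2 - vecSum n))) (_ : δ = rconst (p ^ (2 * m 2 - vecSum m))),
      (∀ i : ℤ, phiPlus m n (rconst p) α β x i ≠ 0 ∧ phiMinus m n (rconst p) α β x i ≠ 0 ∧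
        psiPlus m n (rconst p) α β x i ≠ 0 ∧ psiMinus m n (rconst p) α β x i ≠ 0) ∧
      ∃ σ : RatFun 3 ≃ₐ[ℂ] RatFun 3, σ α = α ∧ σ β = β ∧ σ x = rconst (p ^ 2) * x ∧
        IsSolutionD5 σ (p ^ 2) x α β γ δ (solD5f m n (rconst p) α β x)
          (solD5g m n (rconst p) α β x) ∧
        AlgebraicIn {x, α, β, γ, δ} (solD5f m n (rconst p) α β x) ∧
        AlgebraicIn {x, α, β, γ, δ} (solD5g m n (rconst p) α β x)) ∧
    -- type `E_6^{(1)}`, `q = ζ ^ 9`, pairs of `3`-cores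
    (∀ (ζ : ℂ) (_ : ζ ≠ 0) (_ : ∀ k : ℕ, 0 < k → ζ ^ k ≠ 1)
      (m n : ZMod 3 → ℤ) (A B : RatFun 2) (_ : A = rvar 0) (_ : B = rvar 1),
      (∀ i : ℤ, solU m n (rconst ζ) (A ^ 3) (B ^ 3) i ≠ 0 ∧
        solV m n (rconst ζ) (A ^ 3) (B ^ 3) i ≠ 0 ∧
        solW m n (rconst ζ) (A ^ 3) (B ^ 3) i ≠ 0) ∧
      ∃ σ : RatFun 2 ≃ₐ[ℂ] RatFun 2, σ A = A ∧ σ B = rconst (ζ ^ (-3 : ℤ)) * B ∧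
        IsSolutionE6 σ (ζ ^ 3) (paramE6 m n (rconst ζ) A B)
          (solE6f m n (rconst ζ) (A ^ 3) (B ^ 3)) (solE6g m n (rconst ζ) (A ^ 3) (B ^ 3)) ∧
        AlgebraicIn (Set.range fun j => paramE6 m n (rconst ζ) A B j ^ 3)
          (solE6f m n (rconst ζ) (A ^ 3) (B ^ 3)) ∧
        AlgebraicIn (Set.range fun j => paramE6 m n (rconst ζ) A B j ^ 3)
          (solE6g m n (rconst ζ) (A ^ 3) (B ^ 3))) := by
  refine ⟨?_, ?_, ?_⟩
  · rintro g - r hr hq m n κ z rfl rfl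
    refine ⟨fun j => ⟨tauA_ne_zero m n hr hr hq j, ?_⟩, ?_⟩
    · rw [← rconst_inv]
      exact tauA_ne_zero m n hr (inv_ne_zero hr) hq j
    · obtain ⟨σ, h₀, h₁, h⟩ := exists_isSolutionA m n hr hq
      exact ⟨σ, h₀, h₁, h, fun j => algebraicIn_paramA m n hr _⟩
  · rintro p hp hq m n α β x γ δ rfl rfl rfl rfl rfl
    have alg : ∀ (γ δ F : RatFun 3), AlgebraicIn {rvar 2, rvar 0, rvar 1, γ, δ} F := by
      intro γ δ F
      refine algebraicIn_of_rvar ?_ F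
      intro i
      apply algebraicIn_of_mem
      fin_cases i <;> simp
    refine ⟨fun i => ?_, ?_⟩
    · have h := rhoD5_family_ne_zero m n hp hq one_ne_zero i
      rwa [show (rconst 1 : RatFun 3) = 1 from map_one _, one_mul] at h
    · obtain ⟨σ, h₀, h₁, h₂, h⟩ := exists_isSolutionD5 m n hp hq
      exact ⟨σ, h₀, h₁, h₂, h, alg _ _ _, alg _ _ _⟩
  · rintro ζ hζ hq m n A B rfl rfl
    refine ⟨sol_ne_zero_E6 m n hζ hq, ?_⟩
    obtain ⟨σ, h₀, h₁, h⟩ := exists_isSolutionE6 m n hζ hq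
    exact ⟨σ, h₀, h₁, h, algebraicIn_paramE6 m n hζ _, algebraicIn_paramE6 m n hζ _⟩
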